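/- **Conventions.** A *Gray-category* is a category enriched in 2-categories with the (pseudo) Gray tensor product. Concretely it has 0-, 1-, 2- and 3-cells; composition $\#_0$ of 1-cells, $\#_1$ of 2-cells, $\#_2$ of 3-cells; whiskerings $\#_0$ of 2- and 3-cells by 1-cells and $\#_1$ of 3-cells by 2-cells; and for 2-cells $\alpha:f\Rightarrow f'$, $\beta:g\Rightarrow g'$ incident on a 0-cell ($s_0g=t_0f$) an invertible 3-cell $$\beta\otimes\alpha:\ (\beta\#_0f')\#_1(g\#_0\alpha)\Rrightarrow(g'\#_0\alpha)\#_1(\beta\#_0f),$$ subject to the usual equations (0-composition of 1-cells is a category, the hom-objects are strict 2-categories, whiskering by 1-cells is strictly 2-functorial, unital and associative, $\otimes$ is natural in 3-cells, functorial in each variable, trivial on identities, and compatible with whiskering). Composites are written in functional order. $\mathrm{GrayCat}$ is the category of Gray-categories and strict Gray-functors. A *Gray-groupoid* is a Gray-category in which every 1-, 2- and 3-cell has a strict inverse (for $\#_0,\#_1,\#_2$ respectively); inverses are written $\bar{(\ )}$. **Path space.** For a Gray-category $\mathbb H$ the Gray-category $\vec{\mathbb H}$ is as follows. * 0-cells: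 1-cells $f$ of $\mathbb H$. * 1-cells $f\to f'$: squares $(g_2;g_0,g_1)$ with $g_0:s_0f\to s_0f'$, $g_1:t_0f\to t_0f'$ and $g_2:g_1\#_0f\Rightarrow f'\#_0g_0$. * 2-cells $(g_2;g_0,g_1)\Rightarrow(g_2';g_0',g_1')$ between 1-cells $f\to f'$: triples $(\alpha_3;\alpha_1,\alpha_2)$ with $\alpha_1:g_0\Rightarrow g_0'$, $\alpha_2:g_1\Rightarrow g_1'$ and $\alpha_3:(f'\#_0\alpha_1)\#_1g_2\Rrightarrow g_2'\#_1(\alpha_2\#_0f)$. * 3-cells $(\alpha_3;\alpha_1,\alpha_2)\Rrightarrow(\beta_3;\beta_1,\beta_2)$ between 2-cells $g\Rightarrow g'$ of 1-cells $f\to f'$: pairs $(\Gamma_1,\Gamma_2)$, $\Gamma_i:\alpha_i\Rrightarrow\beta_i$, with $\beta_3\#_2\big((f'\#_0\Gamma_1)\#_1g_2\big)=\big(g_2'\#_1(\Gamma_2\#_0f)\big)\#_2\alpha_3$. All operations act as those of $\mathbb H$ on the components indexed by sources and targets ($g_0,g_1$; $\alpha_1,\alpha_2$; $\Gamma_1,\Gamma_2$);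 identity squares and identity 2-cells have identities as third components. The remaining components of composites are: * $(k_2;k_0,k_1)\#_0(g_2;g_0,g_1)$ has third component $(k_2\#_0g_0)\#_1(k_1\#_0g_2)$. * For $\beta\#_1\alpha$, with $\alpha$ between 1-cells $f\to f'$: $\big(\beta_3\#_1(\alpha_2\#_0f)\big)\#_2\big((f'\#_0\beta_1)\#_1\alpha_3\big)$. * For $k\#_0\alpha$, with $\alpha:g\Rightarrow g'$: $\big((k_2\#_0g_0')\#_1(k_1\#_0\alpha_3)\big)\#_2\big((k_2\otimes\alpha_1)^{-1}\#_1(k_1\#_0g_2)\big)$. * For $\beta\#_0n$, with $\beta:g\Rightarrow g'$: $\big((g_2'\#_0n_0)\#_1(\beta_2\otimes n_2)\big)\#_2\big((\beta_3\#_0n_0)\#_1(g_1\#_0n_2)\big)$. There are strict Gray-functors $d_0,d_1:\vec{\mathbb H}\to\mathbb H$ taking the source and target components ($d_0f=s_0f$, $d_0(g_2;g_0,g_1)=g_0$, $d_0(\alpha_3;\alpha_1,\alpha_2)=\alpha_1$, $d_0(\Gamma_1,\Gamma_2)=\Gamma_1$; similarly $d_1$) and $i:\mathbb H\to\vec{\mathbb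 H}$ taking constant paths ($x\mapsto\mathrm{id}_x$, $f\mapsto(\mathrm{id}_f;f,f)$, $\alpha\mapsto(\mathrm{id}_\alpha;\alpha,\alpha)$, $\Gamma\mapsto(\Gamma,\Gamma)$). Let $\vec{\mathbb H}\times_{\mathbb H}\vec{\mathbb H}$ be the componentwise fibre product consisting of pairs $(\hat x,x)$ with $d_0\hat x=d_1x$. **$Q^1$-maps.** For a Gray-category $\mathbb G$, $Q^1\mathbb G$ is the Gray-category with the 0-cells of $\mathbb G$; its 1-cells form the free category on the underlying reflexive graph of $\mathbb G$, i.e. they are composable words of non-identity 1-cells ($[f]$ is the one-letter word on $f$, empty if $f$ is an identity); its 2-cells $p\Rightarrow q$ between parallel words are the 2-cells $\mathrm{ev}\,p\Rightarrow\mathrm{ev}\,q$ of $\mathbb G$, where $\mathrm{ev}$ is composition in $\mathbb G$; its 3-cells are those of $\mathbb G$ between such 2-cells; all operations on 2- and 3-cells are those of $\mathbb G$. $Q^1$ is a comonad on $\mathrm{GrayCat}$ with counit $\mathrm{ev}$ and comultiplication $[f_1,\dots,f_n]\mapsto[[f_1],\dots,[f_n]]$. $\mathrm{GrayCat}_{Q^1}$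 is its co-Kleisli category: a map $F:\mathbb A\rightharpoonup\mathbb B$ (a *$Q^1$-map*) is a strict Gray-functor $Q^1\mathbb A\to\mathbb B$, and strict Gray-functors are regarded as $Q^1$-maps by precomposition with $\mathrm{ev}$. The value of $F$ at a cell of $\mathbb A$ is its value at the corresponding cell of $Q^1\mathbb A$ (between one-letter words); its *2-cocycle* is the family $F^2_{k,g}:Fk\#_0Fg\Rightarrow F(k\#_0g)$ of images of the 2-cells $\mathrm{id}:[k,g]\Rightarrow[k\#_0g]$. An internal category or groupoid below has the usual meaning; in particular the object of composable pairs is a pullback in $\mathrm{GrayCat}_{Q^1}$. **Theorem.** Let $\mathbb H$ be a Gray-groupoid. There are $Q^1$-maps $$m:\vec{\mathbb H}\times_{\mathbb H}\vec{\mathbb H}\rightharpoonup\vec{\mathbb H},\qquad o:\vec{\mathbb H}\rightharpoonup\vec{\mathbb H}$$ with the following values and cocycles. 1. $m$ is vertical pasting: * $m(\hat f,f)=\hat f\#_0f$. * For squares $g:f\to f'$, $\hat g:\hat f\to\hat f'$ with $\hat g_0=g_1$: $m(\hat g,g)=\big((\hat f'\#_0g_2)\#_1(\hat g_2\#_0f);\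 g_0,\hat g_1\big)$. * For $\alpha:g\Rightarrow g'$, $\hat\alpha:\hat g\Rightarrow\hat g'$ with $\hat\alpha_1=\alpha_2$: $m(\hat\alpha,\alpha)=(\mu;\alpha_1,\hat\alpha_2)$, with $\mu=\big((\hat f'\#_0g_2')\#_1(\hat\alpha_3\#_0f)\big)\#_2\big((\hat f'\#_0\alpha_3)\#_1(\hat g_2\#_0f)\big)$. * $m(\hat\Gamma,\Gamma)=(\Gamma_1,\hat\Gamma_2)$. * For composable pairs $(\hat g,g)$, $(\hat h,h)$ with $g:f\to f'$, $h:f'\to f''$, $\hat g:\hat f\to\hat f'$, $\hat h:\hat f'\to\hat f''$, the cocycle at $(\hat h,h),(\hat g,g)$ is $$\Big((\hat f''\#_0h_2\#_0g_0)\#_1(\hat h_2\otimes g_2)\#_1(\hat h_1\#_0\hat g_2\#_0f);\ \mathrm{id}_{h_0\#_0g_0},\ \mathrm{id}_{\hat h_1\#_0\hat g_1}\Big).$$ 2. $o$ is vertical inversion: * $o(f)=\bar f$. * For $g:f\to f'$: $o(g_2;g_0,g_1)=(\bar f'\#_0\bar g_2\#_0\bar f;\ g_1,g_0)$. * For $\alpha:g\Rightarrow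 h$ with $g,h:f\to f'$: $o(\alpha_3;\alpha_1,\alpha_2)=\big(\bar f'\#_0(\bar h_2\#_1\bar\alpha_3\#_1\bar g_2)\#_0\bar f;\ \alpha_2,\alpha_1\big)$, with $\bar\alpha_3$ the $\#_2$-inverse. * $o(\Gamma_1,\Gamma_2)=(\Gamma_2,\Gamma_1)$. * For $g:f\to f'$, $h:f'\to f''$, the cocycle $o^2_{h,g}:o(h)\#_0o(g)\Rightarrow o(h\#_0g)$ is $$\Big(\bar f''\#_0\big((\bar h_2\#_0\bar f')\otimes\bar g_2\big)\#_0\bar f;\ \mathrm{id}_{h_1\#_0g_1},\ \mathrm{id}_{h_0\#_0g_0}\Big).$$ Moreover $(\vec{\mathbb H},\mathbb H,d_0,d_1,i,m)$ is an internal category in $\mathrm{GrayCat}_{Q^1}$ whose object of composable pairs is $\vec{\mathbb H}\times_{\mathbb H}\vec{\mathbb H}$, and $o$ makes it an internal groupoid in $\mathrm{GrayCat}_{Q^1}$; that is, $d_0o=d_1$, $d_1o=d_0$, $m\langle o,1\rangle=i\,d_0$ and $m\langle 1,o\rangle=i\,d_1$ as $Q^1$-maps. -/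

import Mathlib

open CategoryTheory

universe u

set_option linter.unusedSimpArgs false
set_option linter.unusedSectionVars false

/-- Globular data of dimension three with the elementwise operations of a Gray-category.
`sᵢ`, `tᵢ` send an `(i+1)`-cell to its `i`-dimensional source and target.  Composites are written
in the order of composition of functions, and every (partial) operation takes a proof that its
arguments are incident. -/
structure GrayData where
  /-- the 0-cells -/
  C0 : Type u
  /-- the 1-cells -/
  C1 : Type u
  /-- the 2-cells -/
  C2 : Type u
  /-- the 3-cells -/
  C3 : Type u
  s0 : C1 → C0
  t0 : C1 → C0
  s1 : C2 → C1
  t1 : C2 → C1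
  s2 : C3 → C2
  t2 : C3 → C2
  s0_t1 : ∀ a, s0 (t1 a) = s0 (s1 a)
  t0_t1 : ∀ a, t0 (t1 a) = t0 (s1 a)
  s1_t2 : ∀ A, s1 (t2 A) = s1 (s2 A)
  t1_t2 : ∀ A, t1 (t2 A) = t1 (s2 A)
  /-- identity 1-cells -/
  id1 : C0 → C1
  s0_id1 : ∀ x, s0 (id1 x) = x
  t0_id1 : ∀ x, t0 (id1 x) = x
  /-- identity 2-cells -/
  id2 : C1 → C2
  s1_id2 : ∀ f, s1 (id2 f) = f
  t1_id2 : ∀ f, t1 (id2 f) = f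
  /-- identity 3-cells -/
  id3 : C2 → C3
  s2_id3 : ∀ a, s2 (id3 a) = a
  t2_id3 : ∀ a, t2 (id3 a) = a
  /-- `g #₀ f` for 1-cells -/
  comp1 : ∀ g f : C1, s0 g = t0 f → C1
  s0_comp1 : ∀ g f h, s0 (comp1 g f h) = s0 f
  t0_comp1 : ∀ g f h, t0 (comp1 g f h) = t0 g
  /-- `b #₁ a` for 2-cells -/
  comp2 : ∀ b a : C2, s1 b = t1 a → C2
  s1_comp2 : ∀ b a h, s1 (comp2 b a h) = s1 a
  t1_comp2 : ∀ b a h, t1 (comp2 b a h) = t1 b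
  /-- `B #₂ A` for 3-cells -/
  comp3 : ∀ B A : C3, s2 B = t2 A → C3
  s2_comp3 : ∀ B A h, s2 (comp3 B A h) = s2 A
  t2_comp3 : ∀ B A h, t2 (comp3 B A h) = t2 B
  /-- `g #₀ a` for a 1-cell `g` and a 2-cell `a` -/
  wl2 : ∀ (g : C1) (a : C2), s0 g = t0 (s1 a) → C2
  s1_wl2 : ∀ g a h, s1 (wl2 g a h) = comp1 g (s1 a) h
  t1_wl2 : ∀ g a h, t1 (wl2 g a h) = comp1 g (t1 a) (h.trans (t0_t1 a).symm)
  /-- `a #₀ f` for a 2-cell `a` and a 1-cell `f` -/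
  wr2 : ∀ (a : C2) (f : C1), s0 (s1 a) = t0 f → C2
  s1_wr2 : ∀ a f h, s1 (wr2 a f h) = comp1 (s1 a) f h
  t1_wr2 : ∀ a f h, t1 (wr2 a f h) = comp1 (t1 a) f ((s0_t1 a).trans h)
  /-- `g #₀ A` for a 1-cell `g` and a 3-cell `A` -/
  wl3 : ∀ (g : C1) (A : C3), s0 g = t0 (s1 (s2 A)) → C3
  s2_wl3 : ∀ g A h, s2 (wl3 g A h) = wl2 g (s2 A) h
  t2_wl3 : ∀ g A h, t2 (wl3 g A h) = wl2 g (t2 A) (by rw [s1_t2]; exact h)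
  /-- `A #₀ f` for a 3-cell `A` and a 1-cell `f` -/
  wr3 : ∀ (A : C3) (f : C1), s0 (s1 (s2 A)) = t0 f → C3
  s2_wr3 : ∀ A f h, s2 (wr3 A f h) = wr2 (s2 A) f h
  t2_wr3 : ∀ A f h, t2 (wr3 A f h) = wr2 (t2 A) f (by rw [s1_t2]; exact h)
  /-- `b #₁ A` for a 2-cell `b` and a 3-cell `A` -/
  vl3 : ∀ (b : C2) (A : C3), s1 b = t1 (s2 A) → C3
  s2_vl3 : ∀ b A h, s2 (vl3 b A h) = comp2 b (s2 A) h
  t2_vl3 : ∀ b A h, t2 (vl3 b A h) = comp2 b (t2 A) (by rw [t1_t2]; exact h)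
  /-- `A #₁ a` for a 3-cell `A` and a 2-cell `a` -/
  vr3 : ∀ (A : C3) (a : C2), s1 (s2 A) = t1 a → C3
  s2_vr3 : ∀ A a h, s2 (vr3 A a h) = comp2 (s2 A) a h
  t2_vr3 : ∀ A a h, t2 (vr3 A a h) = comp2 (t2 A) a (by rw [s1_t2]; exact h)
  /-- the tensor `b ⊗ a` of 2-cells incident on a 0-cell, a 3-cell from `b ◁ a` to `b ▷ a` -/
  tensor : ∀ b a : C2, s0 (s1 b) = t0 (s1 a) → C3
  s2_tensor : ∀ b a h, s2 (tensor b a h) =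
    comp2 (wr2 b (t1 a) (by rw [t0_t1]; exact h)) (wl2 (s1 b) a h)
      (by rw [s1_wr2, t1_wl2])
  t2_tensor : ∀ b a h, t2 (tensor b a h) =
    comp2 (wl2 (t1 b) a (by rw [s0_t1]; exact h)) (wr2 b (s1 a) h)
      (by rw [s1_wl2, t1_wr2])

namespace GrayData

attribute [simp] s0_t1 t0_t1 s1_t2 t1_t2 s0_id1 t0_id1 s1_id2 t1_id2 s2_id3 t2_id3
  s0_comp1 t0_comp1 s1_comp2 t1_comp2 s2_comp3 t2_comp3 s1_wl2 t1_wl2 s1_wr2 t1_wr2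
  s2_wl3 t2_wl3 s2_wr3 t2_wr3 s2_vl3 t2_vl3 s2_vr3 t2_vr3 s2_tensor t2_tensor

/-- `g` is a strict two-sided inverse of the 1-cell `f` with respect to `#₀`. -/
def IsInv1 (G : GrayData.{u}) (f g : G.C1) : Prop :=
  ∃ (h₁ : G.s0 g = G.t0 f) (h₂ : G.s0 f = G.t0 g),
    G.comp1 g f h₁ = G.id1 (G.s0 f) ∧ G.comp1 f g h₂ = G.id1 (G.t0 f)

/-- `b` is a strict two-sided inverse of the 2-cell `a` with respect to `#₁`. -/
def IsInv2 (G : GrayData.{u}) (a b : G.C2) : Prop :=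
  ∃ (h₁ : G.s1 b = G.t1 a) (h₂ : G.s1 a = G.t1 b),
    G.comp2 b a h₁ = G.id2 (G.s1 a) ∧ G.comp2 a b h₂ = G.id2 (G.t1 a)

/-- `B` is a strict two-sided inverse of the 3-cell `A` with respect to `#₂`. -/
def IsInv3 (G : GrayData.{u}) (A B : G.C3) : Prop :=
  ∃ (h₁ : G.s2 B = G.t2 A) (h₂ : G.s2 A = G.t2 B),
    G.comp3 B A h₁ = G.id3 (G.s2 A) ∧ G.comp3 A B h₂ = G.id3 (G.t2 A)

/-- The equational axioms of a Gray-category: 1-cells form a category; the cells between two fixed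
0-cells form a strict 2-category; whiskering with a 1-cell is a strict 2-functor, strictly unital
and associative; the tensor is invertible, natural, functorial, unital and compatible with
whiskering. -/
class IsGray (G : GrayData.{u}) : Prop where
  comp1_id : ∀ f x h, G.comp1 f (G.id1 x) h = f
  id_comp1 : ∀ x f h, G.comp1 (G.id1 x) f h = f
  comp1_assoc : ∀ h g f hg hf, G.comp1 (G.comp1 h g hg) f hf =
    G.comp1 h (G.comp1 g f (by simpa using hf)) (by simpa using hg)
  comp2_id : ∀ a f h, G.comp2 a (G.id2 f) h = a
  id_comp2 : ∀ f a h, G.comp2 (G.id2 f) a h = a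
  comp2_assoc : ∀ c b a cb ha, G.comp2 (G.comp2 c b cb) a ha =
    G.comp2 c (G.comp2 b a (by simpa using ha)) (by simpa using cb)
  comp3_id : ∀ A a h, G.comp3 A (G.id3 a) h = A
  id_comp3 : ∀ a A h, G.comp3 (G.id3 a) A h = A
  comp3_assoc : ∀ C B A CB hA, G.comp3 (G.comp3 C B CB) A hA =
    G.comp3 C (G.comp3 B A (by simpa using hA)) (by simpa using CB)
  vl3_comp3 : ∀ b B A h hb, G.vl3 b (G.comp3 B A h) hb =
    G.comp3 (G.vl3 b B (by simpa [h] using hb)) (G.vl3 b A (by simpa using hb)) (by simp [h])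
  vl3_id3 : ∀ b a h, G.vl3 b (G.id3 a) h = G.id3 (G.comp2 b a (by simpa using h))
  vl3_comp2 : ∀ c b A cb hA, G.vl3 (G.comp2 c b cb) A hA =
    G.vl3 c (G.vl3 b A (by simpa using hA)) (by simpa using cb)
  id2_vl3 : ∀ f A h, G.vl3 (G.id2 f) A h = A
  vr3_comp3 : ∀ B A a h ha, G.vr3 (G.comp3 B A h) a ha =
    G.comp3 (G.vr3 B a (by simpa [h] using ha)) (G.vr3 A a (by simpa using ha)) (by simp [h])
  vr3_id3 : ∀ b a h, G.vr3 (G.id3 b) a h = G.id3 (G.comp2 b a (by simpa using h))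
  vr3_comp2 : ∀ A b a ba hA, G.vr3 A (G.comp2 b a ba) hA =
    G.vr3 (G.vr3 A b (by simpa using hA)) a (by simpa using ba)
  vr3_id2 : ∀ A f h, G.vr3 A (G.id2 f) h = A
  vr3_vl3 : ∀ b A a hb ha, G.vr3 (G.vl3 b A hb) a ha =
    G.vl3 b (G.vr3 A a (by simpa using ha)) (by simpa using hb)
  interchange : ∀ B A (h : G.s1 (G.s2 B) = G.t1 (G.s2 A)),
    G.comp3 (G.vr3 B (G.t2 A) (by simpa using h)) (G.vl3 (G.s2 B) A h) (by simp) =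
      G.comp3 (G.vl3 (G.t2 B) A (by simpa using h)) (G.vr3 B (G.s2 A) h) (by simp)
  wl2_comp2 : ∀ g b a ba h, G.wl2 g (G.comp2 b a ba) h =
    G.comp2 (G.wl2 g b (by simpa [ba] using h)) (G.wl2 g a (by simpa using h)) (by simp [ba])
  wl2_id2 : ∀ g f h, G.wl2 g (G.id2 f) h = G.id2 (G.comp1 g f (by simpa using h))
  id1_wl2 : ∀ x a h, G.wl2 (G.id1 x) a h = a
  wl2_comp1 : ∀ k g a kg ha, G.wl2 (G.comp1 k g kg) a ha =
    G.wl2 k (G.wl2 g a (by simpa using ha)) (by simpa using kg)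
  wr2_comp2 : ∀ b a f ba h, G.wr2 (G.comp2 b a ba) f h =
    G.comp2 (G.wr2 b f (by simpa [ba] using h)) (G.wr2 a f (by simpa using h)) (by simp [ba])
  wr2_id2 : ∀ g f h, G.wr2 (G.id2 g) f h = G.id2 (G.comp1 g f (by simpa using h))
  wr2_id1 : ∀ a x h, G.wr2 a (G.id1 x) h = a
  wr2_comp1 : ∀ a g f gf ha, G.wr2 a (G.comp1 g f gf) ha =
    G.wr2 (G.wr2 a g (by simpa using ha)) f (by simpa using gf)
  wr2_wl2 : ∀ g a f ga hf, G.wr2 (G.wl2 g a ga) f hf =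
    G.wl2 g (G.wr2 a f (by simpa using hf)) (by simpa using ga)
  wl3_comp3 : ∀ g B A BA h, G.wl3 g (G.comp3 B A BA) h =
    G.comp3 (G.wl3 g B (by simpa [BA] using h)) (G.wl3 g A (by simpa using h)) (by simp [BA])
  wl3_id3 : ∀ g a h, G.wl3 g (G.id3 a) h = G.id3 (G.wl2 g a (by simpa using h))
  wl3_vl3 : ∀ g b A bA h, G.wl3 g (G.vl3 b A bA) h =
    G.vl3 (G.wl2 g b (by simpa [bA] using h)) (G.wl3 g A (by simpa using h)) (by simp [bA])
  wl3_vr3 : ∀ g A a Aa h, G.wl3 g (G.vr3 A a Aa) h =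
    G.vr3 (G.wl3 g A (by simpa [Aa] using h)) (G.wl2 g a (by simpa using h)) (by simp [Aa])
  id1_wl3 : ∀ x A h, G.wl3 (G.id1 x) A h = A
  wl3_comp1 : ∀ k g A kg hA, G.wl3 (G.comp1 k g kg) A hA =
    G.wl3 k (G.wl3 g A (by simpa using hA)) (by simpa using kg)
  wr3_comp3 : ∀ B A f BA h, G.wr3 (G.comp3 B A BA) f h =
    G.comp3 (G.wr3 B f (by simpa [BA] using h)) (G.wr3 A f (by simpa using h)) (by simp [BA])
  wr3_id3 : ∀ a f h, G.wr3 (G.id3 a) f h = G.id3 (G.wr2 a f (by simpa using h))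
  wr3_vl3 : ∀ b A f bA h, G.wr3 (G.vl3 b A bA) f h =
    G.vl3 (G.wr2 b f (by simpa [bA] using h)) (G.wr3 A f (by simpa using h)) (by simp [bA])
  wr3_vr3 : ∀ A a f Aa h, G.wr3 (G.vr3 A a Aa) f h =
    G.vr3 (G.wr3 A f (by simpa [Aa] using h)) (G.wr2 a f (by simpa using h)) (by simp [Aa])
  wr3_id1 : ∀ A x h, G.wr3 A (G.id1 x) h = A
  wr3_comp1 : ∀ A g f gf hA, G.wr3 A (G.comp1 g f gf) hA =
    G.wr3 (G.wr3 A g (by simpa using hA)) f (by simpa using gf)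
  wr3_wl3 : ∀ g A f gA hf, G.wr3 (G.wl3 g A gA) f hf =
    G.wl3 g (G.wr3 A f (by simpa using hf)) (by simpa using gA)
  tensor_inv : ∀ b a h, ∃ T, G.IsInv3 (G.tensor b a h) T
  id2_tensor : ∀ g a h, G.tensor (G.id2 g) a h = G.id3 (G.wl2 g a (by simpa using h))
  tensor_id2 : ∀ b f h, G.tensor b (G.id2 f) h = G.id3 (G.wr2 b f (by simpa using h))
  comp2_tensor : ∀ c b a cb h, G.tensor (G.comp2 c b cb) a h =
    G.comp3
      (G.vr3 (G.tensor c a (by simpa [cb] using h)) (G.wr2 b (G.s1 a) (by simpa using h))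
        (by simp [cb]))
      (G.vl3 (G.wr2 c (G.t1 a) (by simpa [cb] using h)) (G.tensor b a (by simpa using h))
        (by simp [cb]))
      (by simp [cb, comp2_assoc])
  tensor_comp2 : ∀ c b a ba h, G.tensor c (G.comp2 b a ba) h =
    G.comp3
      (G.vl3 (G.wl2 (G.t1 c) b (by simpa [ba] using h)) (G.tensor c a (by simpa using h))
        (by simp [ba]))
      (G.vr3 (G.tensor c b (by simpa [ba] using h)) (G.wl2 (G.s1 c) a (by simpa using h))
        (by simp [ba]))
      (by simp [ba, comp2_assoc])
  tensor_natural_left : ∀ B a (h : G.s0 (G.s1 (G.s2 B)) = G.t0 (G.s1 a)),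
    G.comp3 (G.tensor (G.t2 B) a (by simpa using h))
        (G.vr3 (G.wr3 B (G.t1 a) (by simpa using h)) (G.wl2 (G.s1 (G.s2 B)) a h) (by simp))
        (by simp) =
      G.comp3 (G.vl3 (G.wl2 (G.t1 (G.s2 B)) a (by simpa using h)) (G.wr3 B (G.s1 a) h) (by simp))
        (G.tensor (G.s2 B) a h) (by simp)
  tensor_natural_right : ∀ b A (h : G.s0 (G.s1 b) = G.t0 (G.s1 (G.s2 A))),
    G.comp3 (G.tensor b (G.t2 A) (by simpa using h))
        (G.vl3 (G.wr2 b (G.t1 (G.s2 A)) (by simpa using h)) (G.wl3 (G.s1 b) A h) (by simp))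
        (by simp) =
      G.comp3 (G.vr3 (G.wl3 (G.t1 b) A (by simpa using h)) (G.wr2 b (G.s1 (G.s2 A)) h) (by simp))
        (G.tensor b (G.s2 A) h) (by simp)
  wl2_tensor : ∀ g b a gb h, G.tensor (G.wl2 g b gb) a h =
    G.wl3 g (G.tensor b a (by simpa using h)) (by simpa using gb)
  tensor_wr2 : ∀ b a f af h, G.tensor b (G.wr2 a f af) h =
    G.wr3 (G.tensor b a (by simpa using h)) f (by simpa using af)
  wr2_tensor : ∀ b g a bg h, G.tensor (G.wr2 b g bg) a h =
    G.tensor b (G.wl2 g a (by simpa using h)) (by simpa using bg)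

end GrayData

/-- Strict Gray-functors: globular maps that preserve all operations on the nose. -/
@[ext]
structure GrayFunctor (G H : GrayData.{u}) where
  map0 : G.C0 → H.C0
  map1 : G.C1 → H.C1
  map2 : G.C2 → H.C2
  map3 : G.C3 → H.C3
  s0_map1 : ∀ f, H.s0 (map1 f) = map0 (G.s0 f)
  t0_map1 : ∀ f, H.t0 (map1 f) = map0 (G.t0 f)
  s1_map2 : ∀ a, H.s1 (map2 a) = map1 (G.s1 a)
  t1_map2 : ∀ a, H.t1 (map2 a) = map1 (G.t1 a)
  s2_map3 : ∀ A, H.s2 (map3 A) = map2 (G.s2 A)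
  t2_map3 : ∀ A, H.t2 (map3 A) = map2 (G.t2 A)
  map1_id1 : ∀ x, map1 (G.id1 x) = H.id1 (map0 x)
  map2_id2 : ∀ f, map2 (G.id2 f) = H.id2 (map1 f)
  map3_id3 : ∀ a, map3 (G.id3 a) = H.id3 (map2 a)
  map1_comp1 : ∀ g f h, map1 (G.comp1 g f h) =
    H.comp1 (map1 g) (map1 f) (by rw [s0_map1, t0_map1, h])
  map2_comp2 : ∀ b a h, map2 (G.comp2 b a h) =
    H.comp2 (map2 b) (map2 a) (by rw [s1_map2, t1_map2, h])
  map3_comp3 : ∀ B A h, map3 (G.comp3 B A h) =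
    H.comp3 (map3 B) (map3 A) (by rw [s2_map3, t2_map3, h])
  map2_wl2 : ∀ g a h, map2 (G.wl2 g a h) =
    H.wl2 (map1 g) (map2 a) (by rw [s0_map1, s1_map2, t0_map1, h])
  map2_wr2 : ∀ a f h, map2 (G.wr2 a f h) =
    H.wr2 (map2 a) (map1 f) (by rw [s1_map2, s0_map1, t0_map1, h])
  map3_wl3 : ∀ g A h, map3 (G.wl3 g A h) =
    H.wl3 (map1 g) (map3 A) (by rw [s0_map1, s2_map3, s1_map2, t0_map1, h])
  map3_wr3 : ∀ A f h, map3 (G.wr3 A f h) =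
    H.wr3 (map3 A) (map1 f) (by rw [s2_map3, s1_map2, s0_map1, t0_map1, h])
  map3_vl3 : ∀ b A h, map3 (G.vl3 b A h) =
    H.vl3 (map2 b) (map3 A) (by rw [s1_map2, s2_map3, t1_map2, h])
  map3_vr3 : ∀ A a h, map3 (G.vr3 A a h) =
    H.vr3 (map3 A) (map2 a) (by rw [s2_map3, s1_map2, t1_map2, h])
  map3_tensor : ∀ b a h, map3 (G.tensor b a h) =
    H.tensor (map2 b) (map2 a) (by rw [s1_map2, s1_map2, s0_map1, t0_map1, h])

namespace GrayFunctor

attribute [simp] s0_map1 t0_map1 s1_map2 t1_map2 s2_map3 t2_map3 map1_id1 map2_id2 map3_id3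
  map1_comp1 map2_comp2 map3_comp3 map2_wl2 map2_wr2 map3_wl3 map3_wr3 map3_vl3 map3_vr3
  map3_tensor

/-- The identity Gray-functor. -/
@[simps]
def id (G : GrayData.{u}) : GrayFunctor G G where
  map0 x := x
  map1 f := f
  map2 a := a
  map3 A := A
  s0_map1 _ := rfl
  t0_map1 _ := rfl
  s1_map2 _ := rfl
  t1_map2 _ := rfl
  s2_map3 _ := rfl
  t2_map3 _ := rfl
  map1_id1 _ := rfl
  map2_id2 _ := rfl
  map3_id3 _ := rfl
  map1_comp1 _ _ _ := rfl
  map2_comp2 _ _ _ := rfl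
  map3_comp3 _ _ _ := rfl
  map2_wl2 _ _ _ := rfl
  map2_wr2 _ _ _ := rfl
  map3_wl3 _ _ _ := rfl
  map3_wr3 _ _ _ := rfl
  map3_vl3 _ _ _ := rfl
  map3_vr3 _ _ _ := rfl
  map3_tensor _ _ _ := rfl

/-- Composition of Gray-functors, in diagrammatic order. -/
@[simps]
def comp {G H K : GrayData.{u}} (F : GrayFunctor G H) (E : GrayFunctor H K) :
    GrayFunctor G K where
  map0 x := E.map0 (F.map0 x)
  map1 f := E.map1 (F.map1 f)
  map2 a := E.map2 (F.map2 a)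
  map3 A := E.map3 (F.map3 A)
  s0_map1 _ := by simp
  t0_map1 _ := by simp
  s1_map2 _ := by simp
  t1_map2 _ := by simp
  s2_map3 _ := by simp
  t2_map3 _ := by simp
  map1_id1 _ := by simp
  map2_id2 _ := by simp
  map3_id3 _ := by simp
  map1_comp1 _ _ _ := by simp
  map2_comp2 _ _ _ := by simp
  map3_comp3 _ _ _ := by simp
  map2_wl2 _ _ _ := by simp
  map2_wr2 _ _ _ := by simp
  map3_wl3 _ _ _ := by simp
  map3_wr3 _ _ _ := by simp
  map3_vl3 _ _ _ := by simp
  map3_vr3 _ _ _ := by simp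
  map3_tensor _ _ _ := by simp

end GrayFunctor

/-- Gray-categories. -/
structure GrayCat where
  toGrayData : GrayData.{u}
  isGray : toGrayData.IsGray

/-- The category of Gray-categories and strict Gray-functors. -/
instance : Category GrayCat.{u} where
  Hom G H := GrayFunctor G.toGrayData H.toGrayData
  id G := GrayFunctor.id G.toGrayData
  comp F E := F.comp E

namespace GrayCat

@[ext]
lemma hom_ext {G H : GrayCat.{u}} {F E : G ⟶ H} (h0 : F.map0 = E.map0) (h1 : F.map1 = E.map1)
    (h2 : F.map2 = E.map2) (h3 : F.map3 = E.map3) : F = E :=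
  GrayFunctor.ext h0 h1 h2 h3

lemma id_def (G : GrayCat.{u}) : 𝟙 G = GrayFunctor.id G.toGrayData := rfl

lemma comp_def {G H K : GrayCat.{u}} (F : G ⟶ H) (E : H ⟶ K) : F ≫ E = GrayFunctor.comp F E := rfl

end GrayCat

/-- A Gray-groupoid is a Gray-category all of whose 1-, 2- and 3-cells are strictly invertible. -/
structure GrayData.IsGroupoid (G : GrayData.{u}) : Prop where
  exists_inv1 : ∀ f, ∃ g, G.IsInv1 f g
  exists_inv2 : ∀ a, ∃ b, G.IsInv2 a b
  exists_inv3 : ∀ A, ∃ B, G.IsInv3 A B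

/-- A category with the same objects as `G` together with an identity-on-objects functor `ev` to
the underlying category of `G`. -/
structure CatOver (G : GrayData.{u}) where
  C1 : Type u
  s0 : C1 → G.C0
  t0 : C1 → G.C0
  id1 : G.C0 → C1
  s0_id1 : ∀ x, s0 (id1 x) = x
  t0_id1 : ∀ x, t0 (id1 x) = x
  comp1 : ∀ g f : C1, s0 g = t0 f → C1
  s0_comp1 : ∀ g f h, s0 (comp1 g f h) = s0 f
  t0_comp1 : ∀ g f h, t0 (comp1 g f h) = t0 g
  comp1_id : ∀ f x h, comp1 f (id1 x) h = f
  id_comp1 : ∀ x f h, comp1 (id1 x) f h = f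
  comp1_assoc : ∀ k g f kg hf, comp1 (comp1 k g kg) f hf =
    comp1 k (comp1 g f ((s0_comp1 k g kg).symm.trans hf))
      (kg.trans (t0_comp1 g f ((s0_comp1 k g kg).symm.trans hf)).symm)
  ev : C1 → G.C1
  s0_ev : ∀ f, G.s0 (ev f) = s0 f
  t0_ev : ∀ f, G.t0 (ev f) = t0 f
  ev_id1 : ∀ x, ev (id1 x) = G.id1 x
  ev_comp1 : ∀ g f h, ev (comp1 g f h) = G.comp1 (ev g) (ev f) (by rw [s0_ev, t0_ev, h])

namespace CatOver

variable {G : GrayData.{u}} (P : CatOver G)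

attribute [simp] s0_id1 t0_id1 s0_comp1 t0_comp1 s0_ev t0_ev ev_id1 ev_comp1

/-- A 2-cell `(a; f, g)` of the Cartesian lift: parallel 1-cells `f`, `g` and `a : ev f ⟹ ev g`. -/
@[ext]
structure Cell2 where
  src : P.C1
  tgt : P.C1
  val : G.C2
  s1_val : G.s1 val = P.ev src
  t1_val : G.t1 val = P.ev tgt

/-- A 3-cell of the Cartesian lift: parallel 1-cells `f`, `g` and a 3-cell of `G` between 2-cells
from `ev f` to `ev g`. -/
@[ext]
structure Cell3 where
  src : P.C1
  tgt : P.C1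
  val : G.C3
  s1_val : G.s1 (G.s2 val) = P.ev src
  t1_val : G.t1 (G.s2 val) = P.ev tgt

attribute [simp] Cell2.s1_val Cell2.t1_val Cell3.s1_val Cell3.t1_val

variable {P}

lemma Cell2.s0_tgt (a : P.Cell2) : P.s0 a.tgt = P.s0 a.src := by
  rw [← P.s0_ev, ← P.s0_ev, ← a.s1_val, ← a.t1_val, G.s0_t1]

lemma Cell2.t0_tgt (a : P.Cell2) : P.t0 a.tgt = P.t0 a.src := by
  rw [← P.t0_ev, ← P.t0_ev, ← a.s1_val, ← a.t1_val, G.t0_t1]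

attribute [simp] Cell2.s0_tgt Cell2.t0_tgt

variable (P)

/-- The Cartesian lift of `ev`, with the 2- and 3-cells pulled back from `G` and all operations on
them carried out in `G`. -/
abbrev liftData : GrayData.{u} where
  C0 := G.C0
  C1 := P.C1
  C2 := P.Cell2
  C3 := P.Cell3
  s0 := P.s0
  t0 := P.t0
  s1 a := a.src
  t1 a := a.tgt
  s2 A := ⟨A.src, A.tgt, G.s2 A.val, by simp, by simp⟩
  t2 A := ⟨A.src, A.tgt, G.t2 A.val, by simp, by simp⟩
  s0_t1 a := by simp
  t0_t1 a := by simp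
  s1_t2 a := rfl
  t1_t2 a := rfl
  id1 := P.id1
  s0_id1 := P.s0_id1
  t0_id1 := P.t0_id1
  id2 f := ⟨f, f, G.id2 (P.ev f), by simp, by simp⟩
  s1_id2 _ := rfl
  t1_id2 _ := rfl
  id3 a := ⟨a.src, a.tgt, G.id3 a.val, by simp, by simp⟩
  s2_id3 _ := by simp
  t2_id3 _ := by simp
  comp1 := P.comp1
  s0_comp1 := P.s0_comp1
  t0_comp1 := P.t0_comp1
  comp2 b a h := ⟨a.src, b.tgt, G.comp2 b.val a.val (by simp [h]), by simp, by simp⟩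
  s1_comp2 _ _ _ := rfl
  t1_comp2 _ _ _ := rfl
  comp3 B A h := ⟨A.src, A.tgt, G.comp3 B.val A.val (congrArg Cell2.val h), by simp, by simp⟩
  s2_comp3 _ _ _ := by simp
  t2_comp3 B A h := by
    ext
    · exact (congrArg Cell2.src h).symm
    · exact (congrArg Cell2.tgt h).symm
    · simp
  wl2 g a h := ⟨P.comp1 g a.src h, P.comp1 g a.tgt (by simp [h]),
    G.wl2 (P.ev g) a.val (by simp [h]), by simp, by simp⟩
  s1_wl2 _ _ _ := rfl
  t1_wl2 _ _ _ := rfl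
  wr2 a f h := ⟨P.comp1 a.src f h, P.comp1 a.tgt f (by simp [h]),
    G.wr2 a.val (P.ev f) (by simp [h]), by simp, by simp⟩
  s1_wr2 _ _ _ := rfl
  t1_wr2 _ _ _ := rfl
  wl3 g A h := ⟨P.comp1 g A.src h,
    P.comp1 g A.tgt (by rw [← P.t0_ev, ← A.t1_val, G.t0_t1, A.s1_val, P.t0_ev]; exact h),
    G.wl3 (P.ev g) A.val (by simpa using h), by simp, by simp⟩
  s2_wl3 _ _ _ := by ext <;> simp
  t2_wl3 _ _ _ := by ext <;> simp
  wr3 A f h := ⟨P.comp1 A.src f h,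
    P.comp1 A.tgt f (by rw [← P.s0_ev, ← A.t1_val, G.s0_t1, A.s1_val, P.s0_ev]; exact h),
    G.wr3 A.val (P.ev f) (by simpa using h), by simp, by simp⟩
  s2_wr3 _ _ _ := by ext <;> simp
  t2_wr3 _ _ _ := by ext <;> simp
  vl3 b A h := ⟨A.src, b.tgt, G.vl3 b.val A.val (by simpa using congrArg P.ev h), by simp, by simp⟩
  s2_vl3 _ _ _ := by ext <;> simp
  t2_vl3 _ _ _ := by ext <;> simp
  vr3 A a h := ⟨a.src, A.tgt, G.vr3 A.val a.val (by simpa using congrArg P.ev h), by simp, by simp⟩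
  s2_vr3 _ _ _ := by ext <;> simp
  t2_vr3 _ _ _ := by ext <;> simp
  tensor b a h := ⟨P.comp1 b.src a.src h, P.comp1 b.tgt a.tgt (by simpa using h),
    G.tensor b.val a.val (by simpa using h), by simp, by simp⟩
  s2_tensor _ _ _ := by ext <;> simp
  t2_tensor _ _ _ := by ext <;> simp

end CatOver

namespace CatOver

variable {G : GrayData.{u}} (P : CatOver G)

lemma liftData_isGray (hG : G.IsGray) : P.liftData.IsGray where
  comp1_id := P.comp1_id
  id_comp1 := P.id_comp1
  comp1_assoc := P.comp1_assoc
  comp2_id := by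
    intro a f h
    obtain rfl : a.src = f := h
    ext <;> simp [hG.comp2_id]
  id_comp2 := by
    intro f a h
    obtain rfl : f = a.tgt := h
    ext <;> simp [hG.id_comp2]
  comp2_assoc := by
    intros; ext <;> simp [hG.comp2_assoc, P.comp1_id, P.id_comp1, P.comp1_assoc]
  comp3_id := by
    intro A a h
    have h1 := congrArg Cell2.src h
    have h2 := congrArg Cell2.tgt h
    ext <;> simp_all [hG.comp3_id]
  id_comp3 := by
    intros; ext <;> simp [hG.id_comp3, P.comp1_id, P.id_comp1, P.comp1_assoc]
  comp3_assoc := by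
    intros; ext <;> simp [hG.comp3_assoc, P.comp1_id, P.id_comp1, P.comp1_assoc]
  vl3_comp3 := by
    intros; ext <;> simp [hG.vl3_comp3, P.comp1_id, P.id_comp1, P.comp1_assoc]
  vl3_id3 := by
    intros; ext <;> simp [hG.vl3_id3, P.comp1_id, P.id_comp1, P.comp1_assoc]
  vl3_comp2 := by
    intros; ext <;> simp [hG.vl3_comp2, P.comp1_id, P.id_comp1, P.comp1_assoc]
  id2_vl3 := by
    intro f A h
    obtain rfl : f = A.tgt := h
    ext <;> simp [hG.id2_vl3]
  vr3_comp3 := by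
    intros; ext <;> simp [hG.vr3_comp3, P.comp1_id, P.id_comp1, P.comp1_assoc]
  vr3_id3 := by
    intros; ext <;> simp [hG.vr3_id3, P.comp1_id, P.id_comp1, P.comp1_assoc]
  vr3_comp2 := by
    intros; ext <;> simp [hG.vr3_comp2, P.comp1_id, P.id_comp1, P.comp1_assoc]
  vr3_id2 := by
    intro A f h
    obtain rfl : A.src = f := h
    ext <;> simp [hG.vr3_id2]
  vr3_vl3 := by
    intros; ext <;> simp [hG.vr3_vl3, P.comp1_id, P.id_comp1, P.comp1_assoc]
  interchange := by
    intros; ext <;> simp [hG.interchange, P.comp1_id, P.id_comp1, P.comp1_assoc]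
  wl2_comp2 := by
    intros; ext <;> simp [hG.wl2_comp2, P.comp1_id, P.id_comp1, P.comp1_assoc]
  wl2_id2 := by
    intros; ext <;> simp [hG.wl2_id2, P.comp1_id, P.id_comp1, P.comp1_assoc]
  id1_wl2 := by
    intros; ext <;> simp [hG.id1_wl2, P.comp1_id, P.id_comp1, P.comp1_assoc]
  wl2_comp1 := by
    intros; ext <;> simp [hG.wl2_comp1, P.comp1_id, P.id_comp1, P.comp1_assoc]
  wr2_comp2 := by
    intros; ext <;> simp [hG.wr2_comp2, P.comp1_id, P.id_comp1, P.comp1_assoc]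
  wr2_id2 := by
    intros; ext <;> simp [hG.wr2_id2, P.comp1_id, P.id_comp1, P.comp1_assoc]
  wr2_id1 := by
    intros; ext <;> simp [hG.wr2_id1, P.comp1_id, P.id_comp1, P.comp1_assoc]
  wr2_comp1 := by
    intros; ext <;> simp [hG.wr2_comp1, P.comp1_id, P.id_comp1, P.comp1_assoc]
  wr2_wl2 := by
    intros; ext <;> simp [hG.wr2_wl2, P.comp1_id, P.id_comp1, P.comp1_assoc]
  wl3_comp3 := by
    intros; ext <;> simp [hG.wl3_comp3, P.comp1_id, P.id_comp1, P.comp1_assoc]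
  wl3_id3 := by
    intros; ext <;> simp [hG.wl3_id3, P.comp1_id, P.id_comp1, P.comp1_assoc]
  wl3_vl3 := by
    intros; ext <;> simp [hG.wl3_vl3, P.comp1_id, P.id_comp1, P.comp1_assoc]
  wl3_vr3 := by
    intros; ext <;> simp [hG.wl3_vr3, P.comp1_id, P.id_comp1, P.comp1_assoc]
  id1_wl3 := by
    intros; ext <;> simp [hG.id1_wl3, P.comp1_id, P.id_comp1, P.comp1_assoc]
  wl3_comp1 := by
    intros; ext <;> simp [hG.wl3_comp1, P.comp1_id, P.id_comp1, P.comp1_assoc]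
  wr3_comp3 := by
    intros; ext <;> simp [hG.wr3_comp3, P.comp1_id, P.id_comp1, P.comp1_assoc]
  wr3_id3 := by
    intros; ext <;> simp [hG.wr3_id3, P.comp1_id, P.id_comp1, P.comp1_assoc]
  wr3_vl3 := by
    intros; ext <;> simp [hG.wr3_vl3, P.comp1_id, P.id_comp1, P.comp1_assoc]
  wr3_vr3 := by
    intros; ext <;> simp [hG.wr3_vr3, P.comp1_id, P.id_comp1, P.comp1_assoc]
  wr3_id1 := by
    intros; ext <;> simp [hG.wr3_id1, P.comp1_id, P.id_comp1, P.comp1_assoc]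
  wr3_comp1 := by
    intros; ext <;> simp [hG.wr3_comp1, P.comp1_id, P.id_comp1, P.comp1_assoc]
  wr3_wl3 := by
    intros; ext <;> simp [hG.wr3_wl3, P.comp1_id, P.id_comp1, P.comp1_assoc]
  tensor_inv := by
    intro b a h
    obtain ⟨T, h₁, h₂, e₁, e₂⟩ := hG.tensor_inv b.val a.val (by simpa using h)
    refine ⟨⟨P.comp1 b.src a.src h, P.comp1 b.tgt a.tgt (by simpa using h), T,
      by rw [h₁]; simp, by rw [h₁]; simp⟩, ?_, ?_, ?_, ?_⟩
    · ext <;> simp [h₁]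
    · ext <;> simp [← h₂]
    · ext <;> simp [e₁]
    · ext <;> simp [e₂]
  id2_tensor := by
    intros; ext <;> simp [hG.id2_tensor, P.comp1_id, P.id_comp1, P.comp1_assoc]
  tensor_id2 := by
    intros; ext <;> simp [hG.tensor_id2, P.comp1_id, P.id_comp1, P.comp1_assoc]
  comp2_tensor := by
    intros; ext <;> simp [hG.comp2_tensor, P.comp1_id, P.id_comp1, P.comp1_assoc]
  tensor_comp2 := by
    intros; ext <;> simp [hG.tensor_comp2, P.comp1_id, P.id_comp1, P.comp1_assoc]
  tensor_natural_left := by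
    intro B a h
    ext
    · simp
    · simp
    · simpa using hG.tensor_natural_left B.val a.val (by simpa using h)
  tensor_natural_right := by
    intro b A h
    ext
    · simp
    · simp
    · simpa using hG.tensor_natural_right b.val A.val (by simpa using h)
  wl2_tensor := by
    intros; ext <;> simp [hG.wl2_tensor, P.comp1_id, P.id_comp1, P.comp1_assoc]
  tensor_wr2 := by
    intros; ext <;> simp [hG.tensor_wr2, P.comp1_id, P.id_comp1, P.comp1_assoc]
  wr2_tensor := by
    intros; ext <;> simp [hG.wr2_tensor, P.comp1_id, P.id_comp1, P.comp1_assoc]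

end CatOver

namespace CatOver

variable {G : GrayData.{u}} (P : CatOver G)

/-- The projection of the Cartesian lift to the base, given on 1-cells by `ev`. -/
@[simps]
def proj : GrayFunctor P.liftData G where
  map0 x := x
  map1 f := P.ev f
  map2 a := a.val
  map3 A := A.val
  s0_map1 _ := by simp
  t0_map1 _ := by simp
  s1_map2 _ := by simp
  t1_map2 _ := by simp
  s2_map3 _ := rfl
  t2_map3 _ := rfl
  map1_id1 _ := by simp
  map2_id2 _ := rfl
  map3_id3 _ := rfl
  map1_comp1 _ _ _ := by simp
  map2_comp2 _ _ _ := rfl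
  map3_comp3 _ _ _ := rfl
  map2_wl2 _ _ _ := rfl
  map2_wr2 _ _ _ := rfl
  map3_wl3 _ _ _ := rfl
  map3_wr3 _ _ _ := rfl
  map3_vl3 _ _ _ := rfl
  map3_vr3 _ _ _ := rfl
  map3_tensor _ _ _ := rfl

/-- The universal property of the Cartesian lift: a Gray-functor to the base together with a lift
of its 1-dimensional part along `ev` gives a Gray-functor to the lift. -/
@[simps]
def lift {K : GrayData.{u}} (F : GrayFunctor K G) (k : K.C1 → P.C1)
    (ev_k : ∀ f, P.ev (k f) = F.map1 f) (k_id1 : ∀ x, k (K.id1 x) = P.id1 (F.map0 x))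
    (k_comp1 : ∀ g f h h', k (K.comp1 g f h) = P.comp1 (k g) (k f) h') :
    GrayFunctor K P.liftData where
  map0 := F.map0
  map1 := k
  map2 a := ⟨k (K.s1 a), k (K.t1 a), F.map2 a, by simp [ev_k], by simp [ev_k]⟩
  map3 A := ⟨k (K.s1 (K.s2 A)), k (K.t1 (K.s2 A)), F.map3 A, by simp [ev_k], by simp [ev_k]⟩
  s0_map1 f := by rw [← F.s0_map1, ← ev_k, P.s0_ev]
  t0_map1 f := by rw [← F.t0_map1, ← ev_k, P.t0_ev]
  s1_map2 _ := rfl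
  t1_map2 _ := rfl
  s2_map3 _ := by simp
  t2_map3 _ := by simp
  map1_id1 x := k_id1 x
  map2_id2 _ := by simp [ev_k]
  map3_id3 _ := by simp
  map1_comp1 _ _ _ := k_comp1 _ _ _ _
  map2_comp2 _ _ _ := by simp
  map3_comp3 B A h := by simp
  map2_wl2 g a h := by
    have h' : P.s0 (k g) = P.t0 (k (K.s1 a)) := by
      rw [← P.s0_ev, ← P.t0_ev, ev_k, ev_k, F.s0_map1, F.t0_map1, h]
    have h'' : P.s0 (k g) = P.t0 (k (K.t1 a)) := by
      rw [← P.s0_ev, ← P.t0_ev, ev_k, ev_k, F.s0_map1, F.t0_map1, h, K.t0_t1]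
    ext
    · simp [k_comp1 _ _ _ h']
    · simp [k_comp1 _ _ _ h'']
    · simp [ev_k]
  map2_wr2 a f h := by
    have h' : P.s0 (k (K.s1 a)) = P.t0 (k f) := by
      rw [← P.s0_ev, ← P.t0_ev, ev_k, ev_k, F.s0_map1, F.t0_map1, h]
    have h'' : P.s0 (k (K.t1 a)) = P.t0 (k f) := by
      rw [← P.s0_ev, ← P.t0_ev, ev_k, ev_k, F.s0_map1, F.t0_map1, K.s0_t1, h]
    ext
    · simp [k_comp1 _ _ _ h']
    · simp [k_comp1 _ _ _ h'']
    · simp [ev_k]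
  map3_wl3 g A h := by
    have h' : P.s0 (k g) = P.t0 (k (K.s1 (K.s2 A))) := by
      rw [← P.s0_ev, ← P.t0_ev, ev_k, ev_k, F.s0_map1, F.t0_map1, h]
    have h'' : P.s0 (k g) = P.t0 (k (K.t1 (K.s2 A))) := by
      rw [← P.s0_ev, ← P.t0_ev, ev_k, ev_k, F.s0_map1, F.t0_map1, h, K.t0_t1]
    ext
    · simp [k_comp1 _ _ _ h']
    · simp [k_comp1 _ _ _ h'']
    · simp [ev_k]
  map3_wr3 A f h := by
    have h' : P.s0 (k (K.s1 (K.s2 A))) = P.t0 (k f) := by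
      rw [← P.s0_ev, ← P.t0_ev, ev_k, ev_k, F.s0_map1, F.t0_map1, h]
    have h'' : P.s0 (k (K.t1 (K.s2 A))) = P.t0 (k f) := by
      rw [← P.s0_ev, ← P.t0_ev, ev_k, ev_k, F.s0_map1, F.t0_map1, K.s0_t1, h]
    ext
    · simp [k_comp1 _ _ _ h']
    · simp [k_comp1 _ _ _ h'']
    · simp [ev_k]
  map3_vl3 _ _ _ := by ext <;> simp
  map3_vr3 _ _ _ := by ext <;> simp
  map3_tensor b a h := by
    have h' : P.s0 (k (K.s1 b)) = P.t0 (k (K.s1 a)) := by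
      rw [← P.s0_ev, ← P.t0_ev, ev_k, ev_k, F.s0_map1, F.t0_map1, h]
    have h'' : P.s0 (k (K.t1 b)) = P.t0 (k (K.t1 a)) := by
      rw [← P.s0_ev, ← P.t0_ev, ev_k, ev_k, F.s0_map1, F.t0_map1, K.s0_t1, K.t0_t1, h]
    ext
    · simp [k_comp1 _ _ _ h']
    · simp [k_comp1 _ _ _ h'']
    · simp

end CatOver

namespace GrayData

variable (G : GrayData.{u})

/-- `f` is an identity 1-cell. -/
def IsId1 (f : G.C1) : Prop := f = G.id1 (G.s0 f)

/-- The list `[f₁, …, fₙ]` is composable, with composite `f₁ #₀ ⋯ #₀ fₙ` from `x` to `y`. -/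
def IsPath (x : G.C0) : G.C0 → List G.C1 → Prop
  | y, [] => x = y
  | y, f :: l => G.t0 f = y ∧ IsPath x (G.s0 f) l

/-- The 1-cells of the free category on the underlying reflexive graph of `G`, in normal form:
composable lists of non-identity 1-cells. -/
@[ext]
structure Word where
  src : G.C0
  tgt : G.C0
  cells : List G.C1
  isPath : G.IsPath src tgt cells
  nonId : ∀ f ∈ cells, ¬ G.IsId1 f

variable {G}

lemma IsPath.append {x y z : G.C0} {l m : List G.C1} (hl : G.IsPath y z l) (hm : G.IsPath x y m) :
    G.IsPath x z (l ++ m) := by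
  induction l generalizing z with
  | nil => cases hl; exact hm
  | cons f l ih => exact ⟨hl.1, ih hl.2⟩

/-- The composite of a composable list. -/
def evList (x : G.C0) : ∀ (l : List G.C1) (y : G.C0), G.IsPath x y l →
    {f : G.C1 // G.s0 f = x ∧ G.t0 f = y}
  | [], _, h => ⟨G.id1 x, G.s0_id1 x, (G.t0_id1 x).trans h⟩
  | f :: l, _, h => ⟨G.comp1 f (evList x l (G.s0 f) h.2).1 (evList x l (G.s0 f) h.2).2.2.symm,
      by simpa using (evList x l (G.s0 f) h.2).2.1, by simpa using h.1⟩

lemma evList_append (hG : G.IsGray) {x y z : G.C0} {l m : List G.C1} (hl : G.IsPath y z l)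
    (hm : G.IsPath x y m) :
    (evList x (l ++ m) z (hl.append hm)).1 =
      G.comp1 (evList y l z hl).1 (evList x m y hm).1
        ((evList y l z hl).2.1.trans (evList x m y hm).2.2.symm) := by
  induction l generalizing z with
  | nil => cases hl; simp [evList, hG.id_comp1]
  | cons f l ih => simp [evList, ih hl.2, hG.comp1_assoc]

/-- The category of words in the 1-cells of a Gray-category, with its evaluation functor. -/
abbrev wordCat (hG : G.IsGray) : CatOver G where
  C1 := G.Word
  s0 w := w.src
  t0 w := w.tgt
  id1 x := ⟨x, x, [], rfl, by simp⟩
  s0_id1 _ := rfl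
  t0_id1 _ := rfl
  comp1 v w h := ⟨w.src, v.tgt, v.cells ++ w.cells, IsPath.append (by simpa [h] using v.isPath)
    w.isPath, by
      intro f hf
      rcases List.mem_append.1 hf with hf | hf
      · exact v.nonId f hf
      · exact w.nonId f hf⟩
  s0_comp1 _ _ _ := rfl
  t0_comp1 _ _ _ := rfl
  comp1_id w x h := by ext <;> simp [← show w.src = x from h]
  id_comp1 x w h := by ext <;> simp [show x = w.tgt from h]
  comp1_assoc _ _ _ _ _ := by ext <;> simp
  ev w := (evList w.src w.cells w.tgt w.isPath).1
  s0_ev w := (evList w.src w.cells w.tgt w.isPath).2.1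
  t0_ev w := (evList w.src w.cells w.tgt w.isPath).2.2
  ev_id1 _ := rfl
  ev_comp1 v w h := by
    obtain ⟨y, z, l, hl, hl'⟩ := v
    obtain ⟨x, y', m, hm, hm'⟩ := w
    obtain rfl : y = y' := h
    exact evList_append hG hl hm

/-- The length-one word on a 1-cell, which is the empty word if that 1-cell is an identity. -/
noncomputable def single (f : G.C1) : G.Word := by
  classical
  exact if h : G.IsId1 f then ⟨G.s0 f, G.s0 f, [], rfl, by simp⟩
    else ⟨G.s0 f, G.t0 f, [f], ⟨rfl, rfl⟩, by simpa using h⟩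

end GrayData

namespace GrayData

variable {G H K : GrayData.{u}}

open Classical in
/-- Removal of identities from a list of 1-cells. -/
noncomputable def reduce (G : GrayData.{u}) (l : List G.C1) : List G.C1 :=
  l.filter fun f => ¬ G.IsId1 f

@[simp] lemma reduce_nil : G.reduce [] = [] := rfl

lemma reduce_cons (f : G.C1) (l : List G.C1) (h : ¬ G.IsId1 f) :
    G.reduce (f :: l) = f :: G.reduce l := by simp [reduce, h]

lemma reduce_cons_id (f : G.C1) (l : List G.C1) (h : G.IsId1 f) :
    G.reduce (f :: l) = G.reduce l := by simp [reduce, h]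

lemma reduce_append (l m : List G.C1) : G.reduce (l ++ m) = G.reduce l ++ G.reduce m := by
  simp [reduce]

lemma not_isId1_of_mem_reduce {f : G.C1} {l : List G.C1} (h : f ∈ G.reduce l) : ¬ G.IsId1 f := by
  simp only [reduce, List.mem_filter, decide_eq_true_eq] at h
  exact h.2

lemma reduce_eq_self {l : List G.C1} (h : ∀ f ∈ l, ¬ G.IsId1 f) : G.reduce l = l := by
  simpa [reduce] using h

lemma IsId1.t0_eq {f : G.C1} (h : G.IsId1 f) : G.t0 f = G.s0 f := by
  have := congrArg G.t0 h
  simpa using this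

lemma isPath_reduce {x y : G.C0} {l : List G.C1} (h : G.IsPath x y l) :
    G.IsPath x y (G.reduce l) := by
  induction l generalizing y with
  | nil => exact h
  | cons f l ih =>
    by_cases hf : G.IsId1 f
    · rw [reduce_cons_id f l hf]
      have := ih h.2
      rwa [← hf.t0_eq, h.1] at this
    · rw [reduce_cons f l hf]
      exact ⟨h.1, ih h.2⟩

lemma evList_congr {x y y' : G.C0} {l l' : List G.C1} (h : G.IsPath x y l) (e : l = l')
    (h' : G.IsPath x y' l') (hy : y = y') :
    (evList x l y h).1 = (evList x l' y' h').1 := by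
  subst e hy; rfl

lemma evList_reduce (hG : G.IsGray) {x y : G.C0} {l : List G.C1} (h : G.IsPath x y l) :
    (evList x (G.reduce l) y (isPath_reduce h)).1 = (evList x l y h).1 := by
  induction l generalizing y with
  | nil => rfl
  | cons f l ih =>
    by_cases hf : G.IsId1 f
    · have e := reduce_cons_id f l hf
      rw [evList_congr (isPath_reduce h) e (isPath_reduce h.2) (by rw [← h.1, hf.t0_eq]), ih h.2]
      have e' : ∀ (g : G.C1) (hg : G.s0 f = G.t0 g), G.comp1 f g hg = g := by
        intro g hg
        have : ∀ (f' : G.C1) (h' : G.s0 f' = G.t0 g), f' = G.id1 (G.s0 f) →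
            G.comp1 f' g h' = g := by
          rintro _ h' rfl
          exact hG.id_comp1 _ _ _
        exact this f hg hf
      simp only [evList, e']
    · have e := reduce_cons f l hf
      rw [evList_congr (isPath_reduce h) e ⟨h.1, isPath_reduce h.2⟩ rfl]
      simp only [evList, ih h.2]

lemma isPath_map (φ : GrayFunctor G H) {x y : G.C0} {l : List G.C1} (h : G.IsPath x y l) :
    H.IsPath (φ.map0 x) (φ.map0 y) (l.map φ.map1) := by
  induction l generalizing y with
  | nil => exact congrArg φ.map0 h
  | cons f l ih => exact ⟨by rw [φ.t0_map1, h.1], by rw [φ.s0_map1]; exact ih h.2⟩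

lemma evList_map (φ : GrayFunctor G H) {x y : G.C0} {l : List G.C1} (h : G.IsPath x y l) :
    (evList (φ.map0 x) (l.map φ.map1) (φ.map0 y) (isPath_map φ h)).1 =
      φ.map1 (evList x l y h).1 := by
  induction l generalizing y with
  | nil => simp [evList]
  | cons f l ih =>
    have e := ih h.2
    simp only [List.map_cons, evList, φ.map1_comp1, ← e]
    congr 1
    exact evList_congr _ rfl _ (φ.s0_map1 f)

lemma IsId1.map (φ : GrayFunctor G H) {f : G.C1} (h : G.IsId1 f) : H.IsId1 (φ.map1 f) := by
  unfold IsId1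
  rw [φ.s0_map1, ← φ.map1_id1, ← h]

lemma reduce_map_reduce (φ : GrayFunctor G H) (l : List G.C1) :
    H.reduce ((G.reduce l).map φ.map1) = H.reduce (l.map φ.map1) := by
  induction l with
  | nil => rfl
  | cons f l ih =>
    by_cases hf : G.IsId1 f
    · rw [reduce_cons_id f l hf, ih, List.map_cons, reduce_cons_id _ _ (hf.map φ)]
    · rw [reduce_cons f l hf, List.map_cons, List.map_cons]
      by_cases hf' : H.IsId1 (φ.map1 f)
      · rw [reduce_cons_id _ _ hf', reduce_cons_id _ _ hf', ih]
      · rw [reduce_cons _ _ hf', reduce_cons _ _ hf', ih]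

/-- The action of a Gray-functor on words: letterwise, followed by removal of identities. -/
noncomputable def Word.map (φ : GrayFunctor G H) (w : G.Word) : H.Word where
  src := φ.map0 w.src
  tgt := φ.map0 w.tgt
  cells := H.reduce (w.cells.map φ.map1)
  isPath := isPath_reduce (isPath_map φ w.isPath)
  nonId _ hf := not_isId1_of_mem_reduce hf

end GrayData

namespace GrayCat

variable (G : GrayCat.{u})

/-- `Q¹G`: the same 0-cells as `G`, words in the 1-cells of `G` as 1-cells, and the higher cells of
`G` between the evaluations of such words. -/
abbrev Q1obj : GrayCat.{u} where
  toGrayData := (GrayData.wordCat G.isGray).liftData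
  isGray := CatOver.liftData_isGray _ G.isGray

variable {G}

/-- The functor `Q¹G ⟶ Q¹H` induced by a Gray-functor `G ⟶ H`. -/
noncomputable def Q1map {H : GrayCat.{u}} (φ : G ⟶ H) : G.Q1obj ⟶ H.Q1obj :=
  CatOver.lift (GrayData.wordCat H.isGray)
    ((GrayData.wordCat G.isGray).proj.comp φ) (GrayData.Word.map φ)
    (fun w => (GrayData.evList_reduce H.isGray _).trans (GrayData.evList_map φ w.isPath))
    (fun _ => rfl)
    (fun v w _ _ => by
      apply GrayData.Word.ext
      · rfl
      · rfl
      · exact (congrArg _ List.map_append).trans (GrayData.reduce_append _ _))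

lemma evList_single {f : G.toGrayData.C1} {x y : G.toGrayData.C0}
    (h : G.toGrayData.IsPath x y [f]) : (GrayData.evList x [f] y h).1 = f := by
  obtain ⟨_, h'⟩ := h
  change x = _ at h'
  subst h'
  simp [GrayData.evList, G.isGray.comp1_id]

lemma ev_single (f : G.toGrayData.C1) :
    (GrayData.wordCat G.isGray).ev (GrayData.single f) = f := by
  by_cases h : G.toGrayData.IsId1 f
  · have : GrayData.single f = ⟨G.toGrayData.s0 f, G.toGrayData.s0 f, [], rfl, by simp⟩ := by
      simp [GrayData.single, h]
    rw [this]
    exact h.symm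
  · have : GrayData.single f =
      ⟨G.toGrayData.s0 f, G.toGrayData.t0 f, [f], ⟨rfl, rfl⟩, by simpa using h⟩ := by
      simp [GrayData.single, h]
    rw [this]
    exact evList_single ⟨rfl, rfl⟩

end GrayCat

namespace GrayCat

variable {G H K : GrayCat.{u}}

open GrayData (single reduce evList Word)

lemma single_of_not_id (f : G.toGrayData.C1) (h : ¬ G.toGrayData.IsId1 f) :
    single f = ⟨G.toGrayData.s0 f, G.toGrayData.t0 f, [f], ⟨rfl, rfl⟩, by simpa using h⟩ := by
  simp [single, h]

lemma single_of_id (f : G.toGrayData.C1) (h : G.toGrayData.IsId1 f) :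
    single f = ⟨G.toGrayData.s0 f, G.toGrayData.s0 f, [], rfl, by simp⟩ := by
  simp [single, h]

lemma Q1obj_isId1 (w : G.toGrayData.Word) :
    G.Q1obj.toGrayData.IsId1 w ↔ w.cells = [] := by
  constructor
  · intro h
    exact congrArg Word.cells h
  · intro h
    obtain ⟨x, y, l, hl, hl'⟩ := w
    obtain rfl : l = [] := h
    obtain rfl : x = y := hl
    rfl

lemma not_isId1_single (f : G.toGrayData.C1) (h : ¬ G.toGrayData.IsId1 f) :
    ¬ G.Q1obj.toGrayData.IsId1 (single f) := by
  rw [single_of_not_id f h, Q1obj_isId1]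
  simp

lemma src_single (f : G.toGrayData.C1) : (single f).src = G.toGrayData.s0 f := by
  by_cases h : G.toGrayData.IsId1 f
  · rw [single_of_id f h]
  · rw [single_of_not_id f h]

lemma tgt_single (f : G.toGrayData.C1) : (single f).tgt = G.toGrayData.t0 f := by
  by_cases h : G.toGrayData.IsId1 f
  · rw [single_of_id f h]; exact h.t0_eq.symm
  · rw [single_of_not_id f h]

lemma isPath_single {x y : G.toGrayData.C0} {l : List G.toGrayData.C1}
    (h : G.toGrayData.IsPath x y l) :
    G.Q1obj.toGrayData.IsPath x y (l.map single) := by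
  induction l generalizing y with
  | nil => exact h
  | cons f l ih =>
    refine ⟨(tgt_single f).trans h.1, ?_⟩
    have := ih h.2
    rwa [← src_single f] at this

/-- The comultiplication on words: `[f₁, …, fₙ]` is sent to `[[f₁], …, [fₙ]]`. -/
noncomputable def wordDelta (w : G.toGrayData.Word) : G.Q1obj.toGrayData.Word where
  src := w.src
  tgt := w.tgt
  cells := w.cells.map single
  isPath := isPath_single w.isPath
  nonId f hf := by
    obtain ⟨g, hg, rfl⟩ := List.mem_map.1 hf
    exact not_isId1_single g (w.nonId g hg)

lemma evList_single_map {x y : G.toGrayData.C0} {l : List G.toGrayData.C1}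
    (h : G.toGrayData.IsPath x y l) (h' : ∀ f ∈ l, ¬ G.toGrayData.IsId1 f)
    (hp : G.Q1obj.toGrayData.IsPath x y (l.map single)) :
    (evList (G := G.Q1obj.toGrayData) x (l.map single) y hp).1 = ⟨x, y, l, h, h'⟩ := by
  induction l generalizing y with
  | nil =>
    cases h
    rfl
  | cons f l ih =>
    have e := ih h.2 (fun g hg => h' g (List.mem_cons_of_mem _ hg)) (isPath_single h.2)
    have hs := single_of_not_id f (h' f List.mem_cons_self)
    have e2 := (GrayData.evList_congr hp.2 rfl (isPath_single h.2) (src_single f)).trans e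
    apply Word.ext
    · exact (evList (G := G.Q1obj.toGrayData) x _ y hp).2.1
    · exact (evList (G := G.Q1obj.toGrayData) x _ y hp).2.2
    · change (single f).cells ++ Word.cells
        (evList (G := G.Q1obj.toGrayData) x (l.map single) _ hp.2).1 = _
      rw [e2, hs]
      rfl

/-- The comultiplication of `Q¹`. -/
noncomputable def Q1delta (G : GrayCat.{u}) : G.Q1obj ⟶ G.Q1obj.Q1obj :=
  CatOver.lift (GrayData.wordCat G.Q1obj.isGray) (GrayFunctor.id _) wordDelta
    (fun w => evList_single_map w.isPath w.nonId _)
    (fun _ => rfl)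
    (fun v w _ _ => by
      apply Word.ext
      · rfl
      · rfl
      · exact List.map_append)

lemma wordMap_single (φ : G ⟶ H) (f : G.toGrayData.C1) :
    Word.map φ (single f) = single (φ.map1 f) := by
  by_cases h : G.toGrayData.IsId1 f
  · rw [single_of_id f h, single_of_id _ (h.map φ)]
    apply Word.ext
    · exact (φ.s0_map1 f).symm
    · exact (φ.s0_map1 f).symm
    · rfl
  · rw [single_of_not_id f h]
    by_cases h' : H.toGrayData.IsId1 (φ.map1 f)
    · rw [single_of_id _ h']
      apply Word.ext
      · exact (φ.s0_map1 f).symm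
      · exact (φ.t0_map1 f).symm.trans h'.t0_eq
      · exact GrayData.reduce_cons_id _ _ h'
    · rw [single_of_not_id _ h']
      apply Word.ext
      · exact (φ.s0_map1 f).symm
      · exact (φ.t0_map1 f).symm
      · exact GrayData.reduce_cons _ _ h'

lemma wordMap_id (w : G.toGrayData.Word) : Word.map (GrayFunctor.id _) w = w := by
  apply Word.ext
  · rfl
  · rfl
  · exact (congrArg _ (List.map_id _)).trans (GrayData.reduce_eq_self w.nonId)

lemma wordMap_comp (φ : G ⟶ H) (ψ : H ⟶ K) (w : G.toGrayData.Word) :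
    Word.map (GrayFunctor.comp φ ψ) w = Word.map ψ (Word.map φ w) := by
  apply Word.ext
  · rfl
  · rfl
  · refine Eq.trans ?_ (GrayData.reduce_map_reduce ψ _).symm
    exact congrArg K.toGrayData.reduce (List.map_map (l := w.cells) (g := ψ.map1)
      (f := φ.map1)).symm

lemma wordMap_delta (φ : G ⟶ H) (w : G.toGrayData.Word) :
    wordDelta (Word.map φ w) = Word.map (Q1map φ) (wordDelta w) := by
  apply Word.ext
  · rfl
  · rfl
  · change ((reduce _ (w.cells.map φ.map1)).map single) =
      reduce H.Q1obj.toGrayData ((w.cells.map single).map (Word.map φ))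
    generalize w.cells = l
    induction l with
    | nil => rfl
    | cons f l ih =>
      simp only [List.map_cons]
      rw [wordMap_single]
      by_cases h : H.toGrayData.IsId1 (φ.map1 f)
      · rw [GrayData.reduce_cons_id _ _ h, ih, GrayData.reduce_cons_id]
        rw [single_of_id _ h, Q1obj_isId1]
      · rw [GrayData.reduce_cons _ _ h, List.map_cons, ih, GrayData.reduce_cons]
        exact not_isId1_single _ h

lemma wordMap_ev_delta (w : G.toGrayData.Word) :
    Word.map (H := G.toGrayData) (GrayData.wordCat G.isGray).proj (wordDelta w) = w := by
  apply Word.ext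
  · rfl
  · rfl
  · change reduce _ ((w.cells.map single).map (GrayData.wordCat G.isGray).ev) = w.cells
    rw [List.map_map, show (GrayData.wordCat G.isGray).ev ∘ single = _root_.id from
      funext ev_single, List.map_id]
    exact GrayData.reduce_eq_self w.nonId

lemma wordDelta_delta (w : G.toGrayData.Word) :
    Word.map (Q1delta G) (wordDelta w) = wordDelta (G := G.Q1obj) (wordDelta w) := by
  apply Word.ext
  · rfl
  · rfl
  · change reduce G.Q1obj.Q1obj.toGrayData ((w.cells.map single).map wordDelta) =
      (w.cells.map single).map (single (G := G.Q1obj.toGrayData))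
    have h := w.nonId
    revert h
    generalize w.cells = l
    intro h
    induction l with
    | nil => rfl
    | cons f l ih =>
      have hf := h f List.mem_cons_self
      have e : wordDelta (single f) = single (G := G.Q1obj.toGrayData) (single f) := by
        rw [single_of_not_id (G := G.Q1obj) _ (not_isId1_single f hf)]
        apply Word.ext
        · rfl
        · rfl
        · exact congrArg (fun v : G.toGrayData.Word => v.cells.map single)
            (single_of_not_id f hf)
      simp only [List.map_cons, e]
      rw [GrayData.reduce_cons, ih fun g hg => h g (List.mem_cons_of_mem _ hg)]
      exact not_isId1_single (G := G.Q1obj) _ (not_isId1_single f hf)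

/-- The comonad `Q¹` on the category of Gray-categories: it replaces the underlying category by the
free category on its underlying reflexive graph. -/
noncomputable def Q1 : Comonad GrayCat.{u} where
  obj := Q1obj
  map := Q1map
  map_id G := by
    apply hom_ext
    · rfl
    · funext w; exact wordMap_id w
    · funext a
      apply CatOver.Cell2.ext
      · exact wordMap_id _
      · exact wordMap_id _
      · rfl
    · funext a
      apply CatOver.Cell3.ext
      · exact wordMap_id _
      · exact wordMap_id _
      · rfl
  map_comp φ ψ := by
    apply hom_ext
    · rfl
    · funext w; exact wordMap_comp φ ψ w
    · funext a
      apply CatOver.Cell2.ext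
      · exact wordMap_comp φ ψ _
      · exact wordMap_comp φ ψ _
      · rfl
    · funext a
      apply CatOver.Cell3.ext
      · exact wordMap_comp φ ψ _
      · exact wordMap_comp φ ψ _
      · rfl
  ε :=
    { app := fun G => (GrayData.wordCat G.isGray).proj
      naturality := fun G H φ => by
        apply hom_ext
        · rfl
        · funext w
          exact (GrayData.evList_reduce H.isGray _).trans (GrayData.evList_map φ w.isPath)
        · rfl
        · rfl }
  δ :=
    { app := fun G => Q1delta G
      naturality := fun G H φ => by
        apply hom_ext
        · rfl
        · funext w; exact wordMap_delta φ w
        · funext a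
          apply CatOver.Cell2.ext
          · exact wordMap_delta φ _
          · exact wordMap_delta φ _
          · rfl
        · funext a
          apply CatOver.Cell3.ext
          · exact wordMap_delta φ _
          · exact wordMap_delta φ _
          · rfl }
  coassoc G := by
    apply hom_ext
    · rfl
    · funext w; exact wordDelta_delta w
    · funext a
      apply CatOver.Cell2.ext
      · exact wordDelta_delta _
      · exact wordDelta_delta _
      · rfl
    · funext a
      apply CatOver.Cell3.ext
      · exact wordDelta_delta _
      · exact wordDelta_delta _
      · rfl
  left_counit G := by
    apply hom_ext
    · rfl
    · funext w; exact evList_single_map w.isPath w.nonId _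
    · rfl
    · rfl
  right_counit G := by
    apply hom_ext
    · rfl
    · funext w; exact wordMap_ev_delta w
    · funext a
      apply CatOver.Cell2.ext
      · exact wordMap_ev_delta _
      · exact wordMap_ev_delta _
      · rfl
    · funext a
      apply CatOver.Cell3.ext
      · exact wordMap_ev_delta _
      · exact wordMap_ev_delta _
      · rfl

end GrayCat

attribute [instance] GrayCat.isGray

namespace GrayData

attribute [simp] IsGray.comp1_id IsGray.id_comp1 IsGray.comp1_assoc IsGray.comp2_id IsGray.id_comp2
  IsGray.comp2_assoc IsGray.comp3_id IsGray.id_comp3 IsGray.comp3_assoc IsGray.vl3_comp3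
  IsGray.vl3_id3 IsGray.vl3_comp2 IsGray.id2_vl3 IsGray.vr3_comp3 IsGray.vr3_id3 IsGray.vr3_comp2
  IsGray.vr3_id2 IsGray.vr3_vl3 IsGray.wl2_comp2 IsGray.wl2_id2 IsGray.id1_wl2 IsGray.wl2_comp1
  IsGray.wr2_comp2 IsGray.wr2_id2 IsGray.wr2_id1 IsGray.wr2_comp1 IsGray.wr2_wl2 IsGray.wl3_comp3
  IsGray.wl3_id3 IsGray.wl3_vl3 IsGray.wl3_vr3 IsGray.id1_wl3 IsGray.wl3_comp1 IsGray.wr3_comp3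
  IsGray.wr3_id3 IsGray.wr3_vl3 IsGray.wr3_vr3 IsGray.wr3_id1 IsGray.wr3_comp1 IsGray.wr3_wl3
  IsGray.id2_tensor IsGray.tensor_id2 IsGray.wl2_tensor IsGray.tensor_wr2 IsGray.wr2_tensor

section

variable {G : GrayData.{u}}

lemma IsInv3.symm {A B : G.C3} (h : G.IsInv3 A B) : G.IsInv3 B A := by
  obtain ⟨h₁, h₂, e₁, e₂⟩ := h
  exact ⟨h₂, h₁, by rw [e₂, h₁], by rw [e₁, h₂]⟩

lemma IsInv3.eq₁ {A B : G.C3} (H : G.IsInv3 A B) (h : G.s2 B = G.t2 A) :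
    G.comp3 B A h = G.id3 (G.s2 A) := by
  obtain ⟨_, _, e₁, _⟩ := H
  exact e₁

lemma IsInv3.eq₂ {A B : G.C3} (H : G.IsInv3 A B) (h : G.s2 A = G.t2 B) :
    G.comp3 A B h = G.id3 (G.t2 A) := by
  obtain ⟨_, _, _, e₂⟩ := H
  exact e₂

lemma comp3_congr {A B A' B' : G.C3} {h : G.s2 A = G.t2 B} (e : A = A') (e' : B = B') :
    G.comp3 A B h = G.comp3 A' B' (e ▸ e' ▸ h) := by
  subst e e'; rfl

lemma vl3_congr {A A' : G.C3} {b : G.C2} {h : G.s1 b = G.t1 (G.s2 A)} (e : A = A') :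
    G.vl3 b A h = G.vl3 b A' (e ▸ h) := by
  subst e; rfl

lemma vr3_congr {A A' : G.C3} {a : G.C2} {h : G.s1 (G.s2 A) = G.t1 a} (e : A = A') :
    G.vr3 A a h = G.vr3 A' a (e ▸ h) := by
  subst e; rfl

lemma wl3_congr {A A' : G.C3} {g : G.C1} {h : G.s0 g = G.t0 (G.s1 (G.s2 A))} (e : A = A') :
    G.wl3 g A h = G.wl3 g A' (e ▸ h) := by
  subst e; rfl

lemma wr3_congr {A A' : G.C3} {f : G.C1} {h : G.s0 (G.s1 (G.s2 A)) = G.t0 f} (e : A = A') :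
    G.wr3 A f h = G.wr3 A' f (e ▸ h) := by
  subst e; rfl

end

variable {G : GrayData.{u}} [G.IsGray]

lemma IsInv3.unique {A B B' : G.C3} (h : G.IsInv3 A B) (h' : G.IsInv3 A B') : B = B' := by
  obtain ⟨h₁, h₂, e₁, e₂⟩ := h
  obtain ⟨h₁', h₂', e₁', e₂'⟩ := h'
  have := IsGray.comp3_assoc (G := G) B A B' h₁ (by simpa using h₂')
  rw [comp3_congr e₁ rfl, comp3_congr rfl e₂'] at this
  simpa using this.symm

/-- Reassociated form of an equation between composites of two 3-cells. -/
lemma comp3_reassoc {A B C D : G.C3} {h h'} (e : G.comp3 A B h = G.comp3 C D h') (X : G.C3)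
    (hX : G.s2 B = G.t2 X) :
    G.comp3 A (G.comp3 B X hX) (by simpa using h) =
      G.comp3 C (G.comp3 D X ((by simpa using (congrArg G.s2 e) : G.s2 B = G.s2 D).symm.trans hX))
        (by simpa using h') := by
  have hD : G.s2 D = G.t2 X := (by simpa using (congrArg G.s2 e) : G.s2 B = G.s2 D).symm.trans hX
  have := comp3_congr (h := by simpa using hX) e (rfl : X = X)
  simpa using this

lemma comp3_reassoc' {A B C : G.C3} {h} (e : G.comp3 A B h = C) (X : G.C3)
    (hX : G.s2 B = G.t2 X) :
    G.comp3 A (G.comp3 B X hX) (by simpa using h) =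
      G.comp3 C X ((by simpa using (congrArg G.s2 e) : G.s2 B = G.s2 C).symm.trans hX) := by
  subst e
  simp

lemma IsInv3.wl3 {A B : G.C3} (H : G.IsInv3 A B) (g : G.C1)
    (h : G.s0 g = G.t0 (G.s1 (G.s2 A))) (h' : G.s0 g = G.t0 (G.s1 (G.s2 B))) :
    G.IsInv3 (G.wl3 g A h) (G.wl3 g B h') := by
  obtain ⟨h₁, h₂, e₁, e₂⟩ := H
  exact ⟨by simp [h₁], by simp [h₂],
    (IsGray.wl3_comp3 g B A h₁ (by simpa using h)).symm.trans (by simp [e₁]),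
    (IsGray.wl3_comp3 g A B h₂ (by simpa using h')).symm.trans (by simp [e₂])⟩

lemma IsInv3.wr3 {A B : G.C3} (H : G.IsInv3 A B) (f : G.C1)
    (h : G.s0 (G.s1 (G.s2 A)) = G.t0 f) (h' : G.s0 (G.s1 (G.s2 B)) = G.t0 f) :
    G.IsInv3 (G.wr3 A f h) (G.wr3 B f h') := by
  obtain ⟨h₁, h₂, e₁, e₂⟩ := H
  exact ⟨by simp [h₁], by simp [h₂],
    (IsGray.wr3_comp3 B A f h₁ (by simpa using h)).symm.trans (by simp [e₁]),
    (IsGray.wr3_comp3 A B f h₂ (by simpa using h')).symm.trans (by simp [e₂])⟩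

lemma IsInv3.vl3 {A B : G.C3} (H : G.IsInv3 A B) (b : G.C2)
    (h : G.s1 b = G.t1 (G.s2 A)) (h' : G.s1 b = G.t1 (G.s2 B)) :
    G.IsInv3 (G.vl3 b A h) (G.vl3 b B h') := by
  obtain ⟨h₁, h₂, e₁, e₂⟩ := H
  exact ⟨by simp [h₁], by simp [h₂],
    (IsGray.vl3_comp3 b B A h₁ (by simpa using h)).symm.trans (by simp [e₁]),
    (IsGray.vl3_comp3 b A B h₂ (by simpa using h')).symm.trans (by simp [e₂])⟩

lemma IsInv3.vr3 {A B : G.C3} (H : G.IsInv3 A B) (a : G.C2)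
    (h : G.s1 (G.s2 A) = G.t1 a) (h' : G.s1 (G.s2 B) = G.t1 a) :
    G.IsInv3 (G.vr3 A a h) (G.vr3 B a h') := by
  obtain ⟨h₁, h₂, e₁, e₂⟩ := H
  exact ⟨by simp [h₁], by simp [h₂],
    (IsGray.vr3_comp3 B A a h₁ (by simpa using h)).symm.trans (by simp [e₁]),
    (IsGray.vr3_comp3 A B a h₂ (by simpa using h')).symm.trans (by simp [e₂])⟩

lemma isInv3_id3 (a : G.C2) : G.IsInv3 (G.id3 a) (G.id3 a) := by
  refine ⟨by simp, by simp, by simp, by simp⟩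

lemma IsInv3.comp3 {A B A' B' : G.C3} (H : G.IsInv3 A B) (H' : G.IsInv3 A' B')
    (h : G.s2 A' = G.t2 A) (h' : G.s2 B = G.t2 B') :
    G.IsInv3 (G.comp3 A' A h) (G.comp3 B B' h') := by
  obtain ⟨h₁, h₂, e₁, e₂⟩ := H
  obtain ⟨h₁', h₂', e₁', e₂'⟩ := H'
  refine ⟨by simp [h₁'], by simp [h₂], ?_, ?_⟩
  · simp [comp3_reassoc' e₁' A h, h, e₁]
  · simp [comp3_reassoc' e₂ B' h', ← h', e₂', h₁, h₁']

/-- The inverse of the tensor of two 2-cells. -/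
noncomputable def tinv (b a : G.C2) (h : G.s0 (G.s1 b) = G.t0 (G.s1 a)) : G.C3 :=
  (IsGray.tensor_inv b a h).choose

lemma tinv_spec (b a : G.C2) (h : G.s0 (G.s1 b) = G.t0 (G.s1 a)) :
    G.IsInv3 (G.tensor b a h) (tinv b a h) :=
  (IsGray.tensor_inv b a h).choose_spec

@[simp] lemma s2_tinv (b a : G.C2) (h : G.s0 (G.s1 b) = G.t0 (G.s1 a)) :
    G.s2 (tinv b a h) = G.comp2 (G.wl2 (G.t1 b) a (by simpa using h)) (G.wr2 b (G.s1 a) h)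
      (by simp) := by
  obtain ⟨h₁, h₂, -⟩ := tinv_spec b a h
  simpa using h₁

@[simp] lemma t2_tinv (b a : G.C2) (h : G.s0 (G.s1 b) = G.t0 (G.s1 a)) :
    G.t2 (tinv b a h) = G.comp2 (G.wr2 b (G.t1 a) (by simpa using h)) (G.wl2 (G.s1 b) a h)
      (by simp) := by
  obtain ⟨h₁, h₂, -⟩ := tinv_spec b a h
  simpa using h₂.symm

@[simp] lemma wl2_tinv (g : G.C1) (b a : G.C2) (gb) (h) :
    tinv (G.wl2 g b gb) a h = G.wl3 g (tinv b a (by simpa using h)) (by simpa using gb) := by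
  refine (tinv_spec _ _ _).unique ?_
  simpa using (tinv_spec b a (by simpa using h)).wl3 g (by simpa using gb) (by simpa using gb)

@[simp] lemma tinv_wr2 (b a : G.C2) (f : G.C1) (af) (h) :
    tinv b (G.wr2 a f af) h = G.wr3 (tinv b a (by simpa using h)) f (by simpa using af) := by
  refine (tinv_spec _ _ _).unique ?_
  simpa using (tinv_spec b a (by simpa using h)).wr3 f (by simpa using af) (by simpa using af)

@[simp] lemma wr2_tinv (b a : G.C2) (g : G.C1) (bg) (h) :
    tinv (G.wr2 b g bg) a h = tinv b (G.wl2 g a (by simpa using h)) (by simpa using bg) := by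
  refine (tinv_spec _ _ _).unique ?_
  simpa using tinv_spec b (G.wl2 g a (by simpa using h)) (by simpa using bg)

@[simp] lemma id2_tinv (g : G.C1) (a : G.C2) (h) :
    tinv (G.id2 g) a h = G.id3 (G.wl2 g a (by simpa using h)) := by
  refine (tinv_spec _ _ _).unique ?_
  simpa using isInv3_id3 _

@[simp] lemma tinv_id2 (b : G.C2) (f : G.C1) (h) :
    tinv b (G.id2 f) h = G.id3 (G.wr2 b f (by simpa using h)) := by
  refine (tinv_spec _ _ _).unique ?_
  simpa using isInv3_id3 _

lemma comp2_tinv (c b a : G.C2) (cb) (h) : tinv (G.comp2 c b cb) a h =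
    G.comp3
      (G.vl3 (G.wr2 c (G.t1 a) (by simpa [cb] using h)) (tinv b a (by simpa using h))
        (by simp [cb]))
      (G.vr3 (tinv c a (by simpa [cb] using h)) (G.wr2 b (G.s1 a) (by simpa using h))
        (by simp [cb]))
      (by simp [cb]) := by
  refine (tinv_spec _ _ _).unique ?_
  rw [IsGray.comp2_tensor]
  exact ((tinv_spec _ _ _).vl3 _ _ _).comp3 ((tinv_spec _ _ _).vr3 _ _ _) _ _

lemma tinv_comp2 (c b a : G.C2) (ba) (h) : tinv c (G.comp2 b a ba) h =
    G.comp3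
      (G.vr3 (tinv c b (by simpa [ba] using h)) (G.wl2 (G.s1 c) a (by simpa using h))
        (by simp [ba]))
      (G.vl3 (G.wl2 (G.t1 c) b (by simpa [ba] using h)) (tinv c a (by simpa using h))
        (by simp [ba]))
      (by simp [ba]) := by
  refine (tinv_spec _ _ _).unique ?_
  rw [IsGray.tensor_comp2]
  exact ((tinv_spec _ _ _).vr3 _ _ _).comp3 ((tinv_spec _ _ _).vl3 _ _ _) _ _

lemma comp3_inv_move {A A' B B' X Y : G.C3} (hA : G.IsInv3 A A') (hB : G.IsInv3 B B')
    {h : G.s2 A = G.t2 X} {h' : G.s2 Y = G.t2 B} (e : G.comp3 A X h = G.comp3 Y B h')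
    (h₁ : G.s2 X = G.t2 B') (h₂ : G.s2 A' = G.t2 Y) :
    G.comp3 X B' h₁ = G.comp3 A' Y h₂ := by
  obtain ⟨a₁, a₂, e₁, e₂⟩ := hA
  obtain ⟨b₁, b₂, f₁, f₂⟩ := hB
  have k : G.s2 Y = G.s2 B' := h'.trans b₁.symm
  have k' : G.t2 X = G.s2 A := h.symm
  calc G.comp3 X B' h₁ = G.comp3 (G.comp3 A' A a₁) (G.comp3 X B' h₁) (by simp [h]) := by
        simp only [e₁, k', IsGray.id_comp3]
    _ = G.comp3 A' (G.comp3 A (G.comp3 X B' h₁) (by simp [h])) (by simp [a₁]) :=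
        IsGray.comp3_assoc _ _ _ _ _
    _ = G.comp3 A' (G.comp3 Y (G.comp3 B B' b₂) (by simp [h'])) (by simp [h₂]) :=
        comp3_congr rfl (comp3_reassoc e B' h₁)
    _ = _ := by simp [f₂, ← h']

lemma tinv_natural_left (B : G.C3) (a : G.C2) (h : G.s0 (G.s1 (G.s2 B)) = G.t0 (G.s1 a)) :
    G.comp3 (G.vr3 (G.wr3 B (G.t1 a) (by simpa using h)) (G.wl2 (G.s1 (G.s2 B)) a h) (by simp))
        (tinv (G.s2 B) a h) (by simp) =
      G.comp3 (tinv (G.t2 B) a (by simpa using h))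
        (G.vl3 (G.wl2 (G.t1 (G.s2 B)) a (by simpa using h)) (G.wr3 B (G.s1 a) h) (by simp))
        (by simp) :=
  comp3_inv_move (tinv_spec _ _ _) (tinv_spec _ _ _) (IsGray.tensor_natural_left B a h) _ _

lemma tinv_natural_right (b : G.C2) (A : G.C3) (h : G.s0 (G.s1 b) = G.t0 (G.s1 (G.s2 A))) :
    G.comp3 (G.vl3 (G.wr2 b (G.t1 (G.s2 A)) (by simpa using h)) (G.wl3 (G.s1 b) A h) (by simp))
        (tinv b (G.s2 A) h) (by simp) =
      G.comp3 (tinv b (G.t2 A) (by simpa using h))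
        (G.vr3 (G.wl3 (G.t1 b) A (by simpa using h)) (G.wr2 b (G.s1 (G.s2 A)) h) (by simp))
        (by simp) :=
  comp3_inv_move (tinv_spec _ _ _) (tinv_spec _ _ _) (IsGray.tensor_natural_right b A h) _ _

end GrayData

namespace GrayData

/-- A 1-cell of the path space `→G` from `src` to `tgt`: a square with vertical sides the 1-cells
`src` and `tgt`, with horizontal sides `left` (between the sources) and `right` (between the
targets), filled by a 2-cell `sq : right #₀ src ⟹ tgt #₀ left`. -/
@[ext]
structure Path1 (G : GrayData.{u}) where
  src : G.C1
  tgt : G.C1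
  left : G.C1
  right : G.C1
  sq : G.C2
  s0_left : G.s0 left = G.s0 src
  t0_left : G.t0 left = G.s0 tgt
  s0_right : G.s0 right = G.t0 src
  t0_right : G.t0 right = G.t0 tgt
  s1_sq : G.s1 sq = G.comp1 right src s0_right
  t1_sq : G.t1 sq = G.comp1 tgt left t0_left.symm

attribute [simp] Path1.s0_left Path1.t0_left Path1.s0_right Path1.t0_right Path1.s1_sq Path1.t1_sq

/-- A 2-cell of `→G`: 2-cells `left`, `right` between the horizontal sides of two parallel squares
and a 3-cell `cell : (f' #₀ left) #₁ src.sq ⇛ tgt.sq #₁ (right #₀ f)`. -/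
@[ext]
structure Path2 (G : GrayData.{u}) where
  src : G.Path1
  tgt : G.Path1
  src_tgt : tgt.src = src.src
  tgt_tgt : tgt.tgt = src.tgt
  left : G.C2
  right : G.C2
  s1_left : G.s1 left = src.left
  t1_left : G.t1 left = tgt.left
  s1_right : G.s1 right = src.right
  t1_right : G.t1 right = tgt.right
  cell : G.C3
  s2_cell : G.s2 cell =
    G.comp2 (G.wl2 src.tgt left (by rw [s1_left, src.t0_left])) src.sq
      (by simp only [G.s1_wl2, src.t1_sq, s1_left])
  t2_cell : G.t2 cell =
    G.comp2 tgt.sq (G.wr2 right src.src (by rw [s1_right, src.s0_right]))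
      (by simp only [G.t1_wr2, tgt.s1_sq, t1_right, src_tgt])

attribute [simp] Path2.src_tgt Path2.tgt_tgt Path2.s1_left Path2.t1_left Path2.s1_right
  Path2.t1_right Path2.s2_cell Path2.t2_cell

/-- A 3-cell of `→G`: 3-cells `left`, `right` between the corresponding 2-cells of two parallel
2-cells of `→G`, compatible with their 3-cells. -/
@[ext]
structure Path3 (G : GrayData.{u}) where
  src : G.Path2
  tgt : G.Path2
  src_tgt : tgt.src = src.src
  tgt_tgt : tgt.tgt = src.tgt
  left : G.C3
  right : G.C3
  s2_left : G.s2 left = src.left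
  t2_left : G.t2 left = tgt.left
  s2_right : G.s2 right = src.right
  t2_right : G.t2 right = tgt.right
  comm :
    G.comp3 tgt.cell
      (G.vr3 (G.wl3 src.src.tgt left (by simp [s2_left])) src.src.sq (by simp [s2_left]))
      (by simp [src_tgt, t2_left]) =
    G.comp3
      (G.vl3 src.tgt.sq (G.wr3 right src.src.src (by simp [s2_right])) (by simp [s2_right]))
      src.cell
      (by simp [s2_right])

attribute [simp] Path3.src_tgt Path3.tgt_tgt Path3.s2_left Path3.t2_left Path3.s2_right
  Path3.t2_right

namespace Path

variable {G : GrayData.{u}} [G.IsGray]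

@[simps]
def id1 (f : G.C1) : G.Path1 where
  src := f
  tgt := f
  left := G.id1 (G.s0 f)
  right := G.id1 (G.t0 f)
  sq := G.id2 f
  s0_left := by simp
  t0_left := by simp
  s0_right := by simp
  t0_right := by simp
  s1_sq := by simp
  t1_sq := by simp

@[simps]
def id2 (g : G.Path1) : G.Path2 where
  src := g
  tgt := g
  src_tgt := rfl
  tgt_tgt := rfl
  left := G.id2 g.left
  right := G.id2 g.right
  s1_left := by simp
  t1_left := by simp
  s1_right := by simp
  t1_right := by simp
  cell := G.id3 g.sq
  s2_cell := by simp
  t2_cell := by simp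

@[simps]
def id3 (a : G.Path2) : G.Path3 where
  src := a
  tgt := a
  src_tgt := rfl
  tgt_tgt := rfl
  left := G.id3 a.left
  right := G.id3 a.right
  s2_left := by simp
  t2_left := by simp
  s2_right := by simp
  t2_right := by simp
  comm := by simp

/-- Horizontal pasting of squares. -/
@[simps]
def comp1 (k g : G.Path1) (h : k.src = g.tgt) : G.Path1 where
  src := g.src
  tgt := k.tgt
  left := G.comp1 k.left g.left (by simp [h])
  right := G.comp1 k.right g.right (by simp [h])
  sq := G.comp2 (G.wr2 k.sq g.left (by simp [h])) (G.wl2 k.right g.sq (by simp [h])) (by simp [h])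
  s0_left := by simp
  t0_left := by simp
  s0_right := by simp
  t0_right := by simp
  s1_sq := by simp
  t1_sq := by simp

@[simps]
def comp2 (b a : G.Path2) (h : b.src = a.tgt) : G.Path2 where
  src := a.src
  tgt := b.tgt
  src_tgt := by simp [h]
  tgt_tgt := by simp [h]
  left := G.comp2 b.left a.left (by simp [h])
  right := G.comp2 b.right a.right (by simp [h])
  s1_left := by simp
  t1_left := by simp
  s1_right := by simp
  t1_right := by simp
  cell := G.comp3
    (G.vr3 b.cell (G.wr2 a.right a.src.src (by simp)) (by simp [h]))
    (G.vl3 (G.wl2 a.src.tgt b.left (by simp [h])) a.cell (by simp [h])) (by simp [h])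
  s2_cell := by simp [h]
  t2_cell := by simp [h]

/-- `k #₀ a` for a 1-cell `k` and a 2-cell `a` of `→G`. -/
@[simps]
noncomputable def wl2 (k : G.Path1) (a : G.Path2) (h : k.src = a.src.tgt) : G.Path2 where
  src := comp1 k a.src h
  tgt := comp1 k a.tgt (by simp [h])
  src_tgt := by simp
  tgt_tgt := by simp
  left := G.wl2 k.left a.left (by simp [h])
  right := G.wl2 k.right a.right (by simp [h])
  s1_left := by simp
  t1_left := by simp
  s1_right := by simp
  t1_right := by simp
  cell := G.comp3
    (G.vl3 (G.wr2 k.sq a.tgt.left (by simp [h])) (G.wl3 k.right a.cell (by simp [h]))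
      (by simp [h]))
    (G.vr3 (tinv k.sq a.left (by simp [h])) (G.wl2 k.right a.src.sq (by simp [h])) (by simp [h]))
    (by simp [h])
  s2_cell := by simp
  t2_cell := by simp

/-- `b #₀ n` for a 2-cell `b` and a 1-cell `n` of `→G`. -/
@[simps]
def wr2 (b : G.Path2) (n : G.Path1) (h : b.src.src = n.tgt) : G.Path2 where
  src := comp1 b.src n h
  tgt := comp1 b.tgt n (by simp [h])
  src_tgt := by simp
  tgt_tgt := by simp
  left := G.wr2 b.left n.left (by simp [h])
  right := G.wr2 b.right n.right (by simp [h])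
  s1_left := by simp
  t1_left := by simp
  s1_right := by simp
  t1_right := by simp
  cell := G.comp3
    (G.vl3 (G.wr2 b.tgt.sq n.left (by simp [h])) (G.tensor b.right n.sq (by simp [h]))
      (by simp [h]))
    (G.vr3 (G.wr3 b.cell n.left (by simp [h])) (G.wl2 b.src.right n.sq (by simp [h]))
      (by simp [h]))
    (by simp [h])
  s2_cell := by simp
  t2_cell := by simp

end Path

end GrayData

namespace GrayData

namespace Path

variable {G : GrayData.{u}} [G.IsGray]

@[simps]
def comp3 (B A : G.Path3) (h : B.src = A.tgt) : G.Path3 where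
  src := A.src
  tgt := B.tgt
  src_tgt := by simp [h]
  tgt_tgt := by simp [h]
  left := G.comp3 B.left A.left (by simp [h])
  right := G.comp3 B.right A.right (by simp [h])
  s2_left := by simp
  t2_left := by simp
  s2_right := by simp
  t2_right := by simp
  comm := by
    have eB := B.comm
    have eA := A.comm
    simp only [h, Path3.src_tgt, Path3.tgt_tgt] at eB
    have e1 := comp3_reassoc eB
    simp [e1, eA]

/-- `b #₁ A` for a 2-cell `b` and a 3-cell `A` of `→G`. -/
@[simps]
def vl3 (b : G.Path2) (A : G.Path3) (h : b.src = A.src.tgt) : G.Path3 where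
  src := comp2 b A.src h
  tgt := comp2 b A.tgt (by simp [h])
  src_tgt := by simp
  tgt_tgt := by simp
  left := G.vl3 b.left A.left (by simp [h])
  right := G.vl3 b.right A.right (by simp [h])
  s2_left := by simp
  t2_left := by simp
  s2_right := by simp
  t2_right := by simp
  comm := by
    have e := vl3_congr (b := G.wl2 A.src.src.tgt b.left (by simp [h])) (h := by simp [h]) A.comm
    have i := IsGray.interchange b.cell (G.wr3 A.right A.src.src.src (by simp)) (by simp [h])
    simp [h] at e i
    simp [h, e]
    exact comp3_reassoc i _ (by simp)

/-- `A #₁ a` for a 3-cell `A` and a 2-cell `a` of `→G`. -/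
@[simps]
def vr3 (A : G.Path3) (a : G.Path2) (h : A.src.src = a.tgt) : G.Path3 where
  src := comp2 A.src a h
  tgt := comp2 A.tgt a (by simp [h])
  src_tgt := by simp
  tgt_tgt := by simp
  left := G.vr3 A.left a.left (by simp [h])
  right := G.vr3 A.right a.right (by simp [h])
  s2_left := by simp
  t2_left := by simp
  s2_right := by simp
  t2_right := by simp
  comm := by
    have e := vr3_congr (a := G.wr2 a.right a.src.src (by simp)) (h := by simp [h]) A.comm
    have i := IsGray.interchange (G.wl3 a.src.tgt A.left (by simp [h])) a.cell (by simp [h])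
    simp [h] at e i
    have e' := comp3_reassoc e
    simp [h, ← i, e']

/-- `k #₀ A` for a 1-cell `k` and a 3-cell `A` of `→G`. -/
@[simps]
noncomputable def wl3 (k : G.Path1) (A : G.Path3) (h : k.src = A.src.src.tgt) : G.Path3 where
  src := wl2 k A.src h
  tgt := wl2 k A.tgt (by simp [h])
  src_tgt := by simp
  tgt_tgt := by simp
  left := G.wl3 k.left A.left (by simp [h])
  right := G.wl3 k.right A.right (by simp [h])
  s2_left := by simp
  t2_left := by simp
  s2_right := by simp
  t2_right := by simp
  comm := by
    have e := vl3_congr (b := G.wr2 k.sq A.src.tgt.left (by simp [h])) (h := by simp [h])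
      (wl3_congr (g := k.right) (h := by simp [h]) A.comm)
    have i := vr3_congr (a := G.wl2 k.right A.src.src.sq (by simp [h])) (h := by simp [h])
      (tinv_natural_right k.sq A.left (by simp [h]))
    simp [h] at e i
    have e' := comp3_reassoc e
    simp [h, ← i, e']

/-- `B #₀ n` for a 3-cell `B` and a 1-cell `n` of `→G`. -/
@[simps]
def wr3 (B : G.Path3) (n : G.Path1) (h : B.src.src.src = n.tgt) : G.Path3 where
  src := wr2 B.src n h
  tgt := wr2 B.tgt n (by simp [h])
  src_tgt := by simp
  tgt_tgt := by simp
  left := G.wr3 B.left n.left (by simp [h])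
  right := G.wr3 B.right n.right (by simp [h])
  s2_left := by simp
  t2_left := by simp
  s2_right := by simp
  t2_right := by simp
  comm := by
    have e := vr3_congr (a := G.wl2 B.src.src.right n.sq (by simp [h])) (h := by simp [h])
      (wr3_congr (f := n.left) (h := by simp [h]) B.comm)
    have i := vl3_congr (b := G.wr2 B.src.tgt.sq n.left (by simp [h])) (h := by simp [h])
      (IsGray.tensor_natural_left B.right n.sq (by simp [h]))
    simp [h] at e i
    have i' := comp3_reassoc i
    simp [h, e, i']

end Path

end GrayData

namespace GrayData

namespace Path

variable {G : GrayData.{u}} [G.IsGray]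

lemma tensor_comm_aux (b a : G.Path2) (h : b.src.src = a.src.tgt) :
    G.comp3
      (G.vl3 (G.wl2 b.src.tgt (G.wl2 b.tgt.left a.left (by simp [h])) (by simp [h]))
        (G.wr3 b.cell a.src.left (by simp [h])) (by simp [h]))
      (G.vr3 (G.wl3 b.src.tgt (G.tensor b.left a.left (by simp [h])) (by simp [h]))
        (G.wr2 b.src.sq a.src.left (by simp [h])) (by simp [h])) (by simp [h]) =
    G.comp3 (G.vr3 (G.tensor b.tgt.sq a.left (by simp [h]))
        (G.wr2 b.right (G.comp1 a.src.tgt a.src.left (by simp)) (by simp [h])) (by simp [h]))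
      (G.comp3
        (G.vl3 (G.wr2 b.tgt.sq a.tgt.left (by simp [h]))
          (G.tensor b.right (G.wl2 a.src.tgt a.left (by simp)) (by simp [h])) (by simp [h]))
        (G.comp3
          (G.vr3 (G.wr3 b.cell a.tgt.left (by simp [h]))
            (G.wl2 b.src.right (G.wl2 a.src.tgt a.left (by simp)) (by simp [h])) (by simp [h]))
          (G.vl3 (G.wl2 b.src.tgt (G.wr2 b.left a.tgt.left (by simp [h])) (by simp [h]))
            (tinv b.src.sq a.left (by simp [h])) (by simp [h])) (by simp [h])) (by simp [h]))
        (by simp [h]) := by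
  have i := IsGray.tensor_natural_left b.cell a.left (by simp [h])
  have e₂ := ((tinv_spec b.src.sq a.left (by simp [h])).vl3
    (G.wl2 b.src.tgt (G.wr2 b.left a.tgt.left (by simp [h])) (by simp [h])) (by simp [h])
    (by simp [h])).eq₂ (by simp [h])
  simp [h, IsGray.comp2_tensor] at i
  have i' := comp3_congr (B := G.vl3 (G.wl2 b.src.tgt (G.wr2 b.left a.tgt.left (by simp [h]))
    (by simp [h])) (tinv b.src.sq a.left (by simp [h])) (by simp [h])) (h := by simp [h]) i rfl
  simp [h, IsGray.comp2_tensor] at i' e₂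
  simp [h, i', e₂]

/-- The tensor of 2-cells of `→G`. -/
@[simps]
noncomputable def tensor (b a : G.Path2) (h : b.src.src = a.src.tgt) : G.Path3 where
  src := comp2 (wr2 b a.tgt (by simp [h])) (wl2 b.src a h) (by simp)
  tgt := comp2 (wl2 b.tgt a (by simp [h])) (wr2 b a.src h) (by simp)
  src_tgt := by simp
  tgt_tgt := by simp
  left := G.tensor b.left a.left (by simp [h])
  right := G.tensor b.right a.right (by simp [h])
  s2_left := by simp
  t2_left := by simp
  s2_right := by simp
  t2_right := by simp
  comm := by
    have e := vr3_congr (a := G.wl2 b.src.right a.src.sq (by simp [h])) (h := by simp [h])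
      (tensor_comm_aux b a h)
    have e₁' := comp3_reassoc' (((tinv_spec b.tgt.sq a.left (by simp [h])).vr3
      (G.wr2 b.right (G.comp1 a.src.tgt a.src.left (by simp)) (by simp [h])) (by simp [h])
      (by simp [h])).vr3 (G.wl2 b.src.right a.src.sq (by simp [h])) (by simp [h])
      (by simp [h]) |>.eq₁ (by simp [h]))
    have i := IsGray.interchange (tinv b.tgt.sq a.left (by simp [h]))
      (G.tensor b.right a.src.sq (by simp [h])) (by simp [h])
    have j := vl3_congr (b := G.wr2 b.tgt.sq a.tgt.left (by simp [h])) (h := by simp [h])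
      (IsGray.tensor_natural_right b.right a.cell (by simp [h]))
    have k := IsGray.interchange (G.wr3 b.cell a.tgt.left (by simp [h]))
      (G.wl3 b.src.right a.cell (by simp [h])) (by simp [h])
    simp [h, IsGray.tensor_comp2] at e e₁' i j k
    have i' := comp3_reassoc i
    have j' := comp3_reassoc j
    simp only [IsGray.comp3_assoc] at j'
    have k' := comp3_reassoc k
    simp [h, e, i', e₁', j', k']

end Path

end GrayData

namespace GrayData

namespace Path

variable {G : GrayData.{u}} [G.IsGray]

lemma comp1_id (g : G.Path1) (f : G.C1) (h) : comp1 g (id1 f) h = g := by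
  have e : g.src = f := h
  ext <;> simp [← e]

lemma id_comp1 (f : G.C1) (g : G.Path1) (h) : comp1 (id1 f) g h = g := by
  have e : f = g.tgt := h
  ext <;> simp [e]

lemma comp1_assoc (k g f : G.Path1) (h h') : comp1 (comp1 k g h) f h' =
    comp1 k (comp1 g f (by simpa using h')) (by simpa using h) := by
  ext <;> simp

lemma comp2_id (a : G.Path2) (f : G.Path1) (h) : comp2 a (id2 f) h = a := by
  have e : a.src = f := h
  ext1 <;> simp [← e]

lemma id_comp2 (f : G.Path1) (a : G.Path2) (h) : comp2 (id2 f) a h = a := by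
  have e : f = a.tgt := h
  ext1 <;> simp [e]

lemma comp2_assoc (c b a : G.Path2) (h h') : comp2 (comp2 c b h) a h' =
    comp2 c (comp2 b a (by simpa using h')) (by simpa using h) := by
  have hc : c.src = b.tgt := h
  have hb : b.src = a.tgt := h'
  ext1 <;> simp [hc, hb]

lemma wl2_comp2 (g : G.Path1) (b a : G.Path2) (ba h) : wl2 g (comp2 b a ba) h =
    comp2 (wl2 g b (by simpa [ba] using h)) (wl2 g a (by simpa using h)) (by simp [ba]) := by
  have hg : g.src = a.src.tgt := h
  have i := IsGray.interchange (tinv g.sq b.left (by simp [ba, hg]))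
    (G.wl3 g.right a.cell (by simp [hg])) (by simp [ba, hg])
  simp [ba, hg] at i
  have i' := comp3_reassoc i
  ext1 <;> simp [ba, hg, tinv_comp2, i']

lemma wl2_id2 (g f : G.Path1) (h) : wl2 g (id2 f) h = id2 (comp1 g f (by simpa using h)) := by
  have hg : g.src = f.tgt := h
  ext1 <;> simp [hg]

lemma id1_wl2 (f : G.C1) (a : G.Path2) (h) : wl2 (id1 f) a h = a := by
  have e : f = a.src.tgt := h
  ext1 <;> simp [e, id_comp1]

lemma wl2_comp1 (k g : G.Path1) (a : G.Path2) (kg ha) : wl2 (comp1 k g kg) a ha =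
    wl2 k (wl2 g a (by simpa using ha)) (by simpa using kg) := by
  have hg : g.src = a.src.tgt := ha
  ext1 <;> simp [kg, hg, comp2_tinv, comp1_assoc]

lemma wr2_comp2 (b a : G.Path2) (f : G.Path1) (ba h) : wr2 (comp2 b a ba) f h =
    comp2 (wr2 b f (by simpa [ba] using h)) (wr2 a f (by simpa using h)) (by simp [ba]) := by
  have hg : a.src.src = f.tgt := h
  have i := IsGray.interchange (G.wr3 b.cell f.left (by simp [ba, hg]))
    (G.tensor a.right f.sq (by simp [hg])) (by simp [ba, hg])
  simp [ba, hg] at i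
  have i' := comp3_reassoc i
  ext1 <;> simp [ba, hg, IsGray.comp2_tensor, i']

lemma wr2_id2 (g f : G.Path1) (h) : wr2 (id2 g) f h = id2 (comp1 g f (by simpa using h)) := by
  have hg : g.src = f.tgt := h
  ext1 <;> simp [hg]

lemma wr2_id1 (a : G.Path2) (f : G.C1) (h) : wr2 a (id1 f) h = a := by
  have e : a.src.src = f := h
  ext1 <;> simp [← e, comp1_id]

lemma wr2_comp1 (a : G.Path2) (g f : G.Path1) (gf ha) : wr2 a (comp1 g f gf) ha =
    wr2 (wr2 a g (by simpa using ha)) f (by simpa using gf) := by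
  have hg : a.src.src = g.tgt := ha
  ext1 <;> simp [gf, hg, IsGray.tensor_comp2, comp1_assoc]

lemma wr2_wl2 (g : G.Path1) (a : G.Path2) (f : G.Path1) (ga hf) : wr2 (wl2 g a ga) f hf =
    wl2 g (wr2 a f (by simpa using hf)) (by simpa using ga) := by
  have h1 : a.src.src = f.tgt := hf
  ext1 <;> simp [h1, ga, comp1_assoc]

end Path

end GrayData

/-- The path space `→G` of a Gray-category: 0-cells are the 1-cells of `G`, 1-cells are squares
filled by a 2-cell, 2- and 3-cells are the corresponding higher cells. -/
noncomputable abbrev GrayData.pathData (G : GrayData.{u}) [G.IsGray] : GrayData.{u} where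
  C0 := G.C1
  C1 := G.Path1
  C2 := G.Path2
  C3 := G.Path3
  s0 g := g.src
  t0 g := g.tgt
  s1 a := a.src
  t1 a := a.tgt
  s2 A := A.src
  t2 A := A.tgt
  s0_t1 a := a.src_tgt
  t0_t1 a := a.tgt_tgt
  s1_t2 A := A.src_tgt
  t1_t2 A := A.tgt_tgt
  id1 := Path.id1
  s0_id1 _ := rfl
  t0_id1 _ := rfl
  id2 := Path.id2
  s1_id2 _ := rfl
  t1_id2 _ := rfl
  id3 := Path.id3
  s2_id3 _ := rfl
  t2_id3 _ := rfl
  comp1 := Path.comp1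
  s0_comp1 _ _ _ := rfl
  t0_comp1 _ _ _ := rfl
  comp2 := Path.comp2
  s1_comp2 _ _ _ := rfl
  t1_comp2 _ _ _ := rfl
  comp3 := Path.comp3
  s2_comp3 _ _ _ := rfl
  t2_comp3 _ _ _ := rfl
  wl2 := Path.wl2
  s1_wl2 _ _ _ := rfl
  t1_wl2 _ _ _ := rfl
  wr2 := Path.wr2
  s1_wr2 _ _ _ := rfl
  t1_wr2 _ _ _ := rfl
  wl3 := Path.wl3
  s2_wl3 _ _ _ := rfl
  t2_wl3 _ _ _ := rfl
  wr3 := Path.wr3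
  s2_wr3 _ _ _ := rfl
  t2_wr3 _ _ _ := rfl
  vl3 := Path.vl3
  s2_vl3 _ _ _ := rfl
  t2_vl3 _ _ _ := rfl
  vr3 := Path.vr3
  s2_vr3 _ _ _ := rfl
  t2_vr3 _ _ _ := rfl
  tensor := Path.tensor
  s2_tensor _ _ _ := rfl
  t2_tensor _ _ _ := rfl

namespace GrayData

attribute [simp] Path.comp1_id Path.id_comp1 Path.comp1_assoc Path.comp2_id Path.id_comp2
  Path.comp2_assoc Path.wl2_comp2 Path.wl2_id2 Path.id1_wl2 Path.wl2_comp1 Path.wr2_comp2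
  Path.wr2_id2 Path.wr2_id1 Path.wr2_comp1 Path.wr2_wl2

lemma Path3.exists_inv {G : GrayData.{u}} [G.IsGray] (A : G.Path3)
    (hl : ∃ B, G.IsInv3 A.left B) (hr : ∃ B, G.IsInv3 A.right B) :
    ∃ B, G.pathData.IsInv3 A B := by
  obtain ⟨L, hL⟩ := hl
  obtain ⟨R, hR⟩ := hr
  have sL : G.s2 L = A.tgt.left := by simpa using hL.choose
  have tL : G.t2 L = A.src.left := by simpa using hL.choose_spec.choose.symm
  have sR : G.s2 R = A.tgt.right := by simpa using hR.choose
  have tR : G.t2 R = A.src.right := by simpa using hR.choose_spec.choose.symm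
  refine ⟨⟨A.tgt, A.src, by simp, by simp, L, R, sL, tL, sR, tR, ?_⟩, ?_, ?_, ?_, ?_⟩
  · have m := comp3_inv_move
      ((hR.wr3 A.src.src.src (by simp) (by simp [sR])).vl3 A.src.tgt.sq (by simp) (by simp [sR]))
      ((hL.wl3 A.src.src.tgt (by simp) (by simp [sL])).vr3 A.src.src.sq (by simp) (by simp [sL]))
      A.comm.symm (by simp [tL]) (by simp [sR])
    simpa using m
  · rfl
  · rfl
  · apply Path3.ext
    · rfl
    · rfl
    · simpa using hL.eq₁ (by simp [sL])
    · simpa using hR.eq₁ (by simp [sR])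
  · apply Path3.ext
    · rfl
    · rfl
    · simpa using hL.eq₂ (by simp [tL])
    · simpa using hR.eq₂ (by simp [tR])

lemma pathData_isGray (G : GrayData.{u}) [G.IsGray] : G.pathData.IsGray where
  comp1_id := Path.comp1_id
  id_comp1 := Path.id_comp1
  comp1_assoc := Path.comp1_assoc
  comp2_id := Path.comp2_id
  id_comp2 := Path.id_comp2
  comp2_assoc := Path.comp2_assoc
  wl2_comp2 := Path.wl2_comp2
  wl2_id2 := Path.wl2_id2
  id1_wl2 := Path.id1_wl2
  wl2_comp1 := Path.wl2_comp1
  wr2_comp2 := Path.wr2_comp2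
  wr2_id2 := Path.wr2_id2
  wr2_id1 := Path.wr2_id1
  wr2_comp1 := Path.wr2_comp1
  wr2_wl2 := Path.wr2_wl2
  comp3_id := by
    intro A a h
    have e : A.src = a := h
    apply Path3.ext <;> simp [← e]
  id_comp3 := by
    intro a A h
    have e : a = A.tgt := h
    apply Path3.ext <;> simp [e]
  comp3_assoc := by
    intro C B A h h'
    have e : C.src = B.tgt := h
    have e' : B.src = A.tgt := h'
    apply Path3.ext <;> simp [e, e']
  vl3_comp3 := by
    intro b B A h hb
    have e : b.src = A.src.tgt := hb
    have e' : B.src = A.tgt := h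
    apply Path3.ext <;> simp [e, e']
  vl3_id3 := by
    intro b a h
    have e : b.src = a.tgt := h
    apply Path3.ext <;> simp [e]
  vl3_comp2 := by
    intro c b A cb h
    have e : b.src = A.src.tgt := h
    apply Path3.ext <;> simp [e, cb]
  id2_vl3 := by
    intro f A h
    have e : f = A.src.tgt := h
    apply Path3.ext <;> simp [e]
  vr3_comp3 := by
    intro B A a h ha
    have e : A.src.src = a.tgt := ha
    have e' : B.src = A.tgt := h
    apply Path3.ext <;> simp [e, e']
  vr3_id3 := by
    intro b a h
    have e : b.src = a.tgt := h
    apply Path3.ext <;> simp [e]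
  vr3_comp2 := by
    intro A b a ba h
    have e : A.src.src = b.tgt := h
    apply Path3.ext <;> simp [e, ba]
  vr3_id2 := by
    intro A f h
    have e : A.src.src = f := h
    apply Path3.ext <;> simp [← e]
  vr3_vl3 := by
    intro b A a hb ha
    have e : A.src.src = a.tgt := ha
    apply Path3.ext <;> simp [e, hb]
  interchange := by
    intro B A h
    have e : B.src.src = A.src.tgt := h
    have i := IsGray.interchange B.left A.left (by simp [e])
    have j := IsGray.interchange B.right A.right (by simp [e])
    simp at i j
    apply Path3.ext <;> simp [e, i, j]
  wl3_comp3 := by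
    intro g B A BA h
    have e : g.src = A.src.src.tgt := h
    have e' : B.src = A.tgt := BA
    apply Path3.ext <;> simp [e, e']
  wl3_id3 := by
    intro g a h
    have e : g.src = a.src.tgt := h
    apply Path3.ext <;> simp [e]
  wl3_vl3 := by
    intro g b A bA h
    have e : g.src = A.src.src.tgt := h
    apply Path3.ext <;> simp [e, bA]
  wl3_vr3 := by
    intro g A a Aa h
    have e : g.src = a.src.tgt := h
    apply Path3.ext <;> simp [e, Aa]
  id1_wl3 := by
    intro x A h
    have e : x = A.src.src.tgt := h
    apply Path3.ext <;> simp [e]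
  wl3_comp1 := by
    intro k g A kg h
    have e : g.src = A.src.src.tgt := h
    apply Path3.ext <;> simp [e, kg]
  wr3_comp3 := by
    intro B A f BA h
    have e : A.src.src.src = f.tgt := h
    have e' : B.src = A.tgt := BA
    apply Path3.ext <;> simp [e, e']
  wr3_id3 := by
    intro a f h
    have e : a.src.src = f.tgt := h
    apply Path3.ext <;> simp [e]
  wr3_vl3 := by
    intro b A f bA h
    have e : A.src.src.src = f.tgt := h
    apply Path3.ext <;> simp [e, bA]
  wr3_vr3 := by
    intro A a f Aa h
    have e : a.src.src = f.tgt := h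
    apply Path3.ext <;> simp [e, Aa]
  wr3_id1 := by
    intro A x h
    have e : A.src.src.src = x := h
    apply Path3.ext <;> simp [← e]
  wr3_comp1 := by
    intro A g f gf h
    have e : A.src.src.src = g.tgt := h
    apply Path3.ext <;> simp [e, gf]
  wr3_wl3 := by
    intro g A f gA h
    have e : A.src.src.src = f.tgt := h
    apply Path3.ext <;> simp [e, gA]
  id2_tensor := by
    intro g a h
    have e : g.src = a.src.tgt := h
    apply Path3.ext <;> simp [e]
  tensor_id2 := by
    intro b f h
    have e : b.src.src = f.tgt := h
    apply Path3.ext <;> simp [e]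
  comp2_tensor := by
    intro c b a cb h
    have e : b.src.src = a.src.tgt := h
    have e' : c.src = b.tgt := cb
    apply Path3.ext <;> simp [e, e', IsGray.comp2_tensor]
  tensor_comp2 := by
    intro c b a ba h
    have e : c.src.src = a.src.tgt := h
    have e' : b.src = a.tgt := ba
    apply Path3.ext <;> simp [e, e', IsGray.tensor_comp2]
  tensor_natural_left := by
    intro B a h
    have e : B.src.src.src = a.src.tgt := h
    have i := IsGray.tensor_natural_left B.left a.left (by simp [e])
    have j := IsGray.tensor_natural_left B.right a.right (by simp [e])
    simp at i j
    apply Path3.ext <;> simp [e, i, j]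
  tensor_natural_right := by
    intro b A h
    have e : b.src.src = A.src.src.tgt := h
    have i := IsGray.tensor_natural_right b.left A.left (by simp [e])
    have j := IsGray.tensor_natural_right b.right A.right (by simp [e])
    simp at i j
    apply Path3.ext <;> simp [e, i, j]
  wl2_tensor := by
    intro g b a gb h
    have e : b.src.src = a.src.tgt := h
    apply Path3.ext <;> simp [e, gb]
  tensor_wr2 := by
    intro b a f af h
    have e : b.src.src = a.src.tgt := h
    apply Path3.ext <;> simp [e, af]
  wr2_tensor := by
    intro b g a bg h
    have e : g.src = a.src.tgt := h
    apply Path3.ext <;> simp [e, bg]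
  tensor_inv b a h := Path3.exists_inv _ (IsGray.tensor_inv _ _ _) (IsGray.tensor_inv _ _ _)

end GrayData

/-- The path space of a Gray-category as a Gray-category. -/
noncomputable abbrev GrayCat.path (H : GrayCat.{u}) : GrayCat.{u} where
  toGrayData := H.toGrayData.pathData
  isGray := H.toGrayData.pathData_isGray

namespace GrayCat

variable (H : GrayCat.{u})

/-- `d₀ : →H ⟶ H`, which takes sources. -/
noncomputable def d0 : H.path ⟶ H where
  map0 f := H.toGrayData.s0 f
  map1 g := g.left
  map2 a := a.left
  map3 A := A.left
  s0_map1 _ := by simp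
  t0_map1 _ := by simp
  s1_map2 _ := by simp
  t1_map2 _ := by simp
  s2_map3 _ := by simp
  t2_map3 _ := by simp
  map1_id1 _ := rfl
  map2_id2 _ := rfl
  map3_id3 _ := rfl
  map1_comp1 _ _ _ := rfl
  map2_comp2 _ _ _ := rfl
  map3_comp3 _ _ _ := rfl
  map2_wl2 _ _ _ := rfl
  map2_wr2 _ _ _ := rfl
  map3_wl3 _ _ _ := rfl
  map3_wr3 _ _ _ := rfl
  map3_vl3 _ _ _ := rfl
  map3_vr3 _ _ _ := rfl
  map3_tensor _ _ _ := rfl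

/-- `d₁ : →H ⟶ H`, which takes targets. -/
noncomputable def d1 : H.path ⟶ H where
  map0 f := H.toGrayData.t0 f
  map1 g := g.right
  map2 a := a.right
  map3 A := A.right
  s0_map1 _ := by simp
  t0_map1 _ := by simp
  s1_map2 _ := by simp
  t1_map2 _ := by simp
  s2_map3 _ := by simp
  t2_map3 _ := by simp
  map1_id1 _ := rfl
  map2_id2 _ := rfl
  map3_id3 _ := rfl
  map1_comp1 _ _ _ := rfl
  map2_comp2 _ _ _ := rfl
  map3_comp3 _ _ _ := rfl
  map2_wl2 _ _ _ := rfl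
  map2_wr2 _ _ _ := rfl
  map3_wl3 _ _ _ := rfl
  map3_wr3 _ _ _ := rfl
  map3_vl3 _ _ _ := rfl
  map3_vr3 _ _ _ := rfl
  map3_tensor _ _ _ := rfl

end GrayCat

namespace GrayData

variable {G : GrayData.{u}} [G.IsGray]

/-- The constant path on a 1-cell. -/
@[simps]
def const1 (f : G.C1) : G.Path1 where
  src := G.id1 (G.s0 f)
  tgt := G.id1 (G.t0 f)
  left := f
  right := f
  sq := G.id2 f
  s0_left := by simp
  t0_left := by simp
  s0_right := by simp
  t0_right := by simp
  s1_sq := by simp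
  t1_sq := by simp

/-- The constant path on a 2-cell. -/
@[simps]
def const2 (a : G.C2) : G.Path2 where
  src := const1 (G.s1 a)
  tgt := const1 (G.t1 a)
  src_tgt := by simp
  tgt_tgt := by simp
  left := a
  right := a
  s1_left := by simp
  t1_left := by simp
  s1_right := by simp
  t1_right := by simp
  cell := G.id3 a
  s2_cell := by simp
  t2_cell := by simp

/-- The constant path on a 3-cell. -/
@[simps]
def const3 (A : G.C3) : G.Path3 where
  src := const2 (G.s2 A)
  tgt := const2 (G.t2 A)
  src_tgt := by simp
  tgt_tgt := by simp
  left := A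
  right := A
  s2_left := by simp
  t2_left := by simp
  s2_right := by simp
  t2_right := by simp
  comm := by simp

lemma const1_id1 (x : G.C0) : const1 (G.id1 x) = Path.id1 (G.id1 x) := by
  apply Path1.ext <;> simp

lemma const1_comp1 (g f : G.C1) (h) :
    const1 (G.comp1 g f h) = Path.comp1 (const1 g) (const1 f) (by simp [h]) := by
  apply Path1.ext <;> simp [h]

lemma const2_id2 (f : G.C1) : const2 (G.id2 f) = Path.id2 (const1 f) := by
  apply Path2.ext <;> simp

lemma const2_comp2 (b a : G.C2) (h) :
    const2 (G.comp2 b a h) = Path.comp2 (const2 b) (const2 a) (by simp [h]) := by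
  apply Path2.ext <;> simp [h]

lemma const2_wl2 (g : G.C1) (a : G.C2) (h) :
    const2 (G.wl2 g a h) = Path.wl2 (const1 g) (const2 a) (by simp [h]) := by
  apply Path2.ext <;> simp [h, const1_comp1]

lemma const2_wr2 (a : G.C2) (f : G.C1) (h) :
    const2 (G.wr2 a f h) = Path.wr2 (const2 a) (const1 f) (by simp [h]) := by
  apply Path2.ext <;> simp [h, const1_comp1]

end GrayData

namespace GrayCat

open GrayData

variable (H : GrayCat.{u})

/-- `i : H ⟶ →H`, which takes constant paths. -/
noncomputable def i : H ⟶ H.path where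
  map0 x := H.toGrayData.id1 x
  map1 f := const1 f
  map2 a := const2 a
  map3 A := const3 A
  s0_map1 _ := rfl
  t0_map1 _ := rfl
  s1_map2 _ := rfl
  t1_map2 _ := rfl
  s2_map3 _ := rfl
  t2_map3 _ := rfl
  map1_id1 _ := const1_id1 _
  map2_id2 _ := const2_id2 _
  map3_id3 _ := by apply Path3.ext <;> simp
  map1_comp1 _ _ _ := const1_comp1 _ _ _
  map2_comp2 _ _ _ := const2_comp2 _ _ _
  map3_comp3 _ _ _ := by apply Path3.ext <;> simp
  map2_wl2 _ _ _ := const2_wl2 _ _ _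
  map2_wr2 _ _ _ := const2_wr2 _ _ _
  map3_wl3 _ _ _ := by apply Path3.ext <;> simp [const2_wl2]
  map3_wr3 _ _ _ := by apply Path3.ext <;> simp [const2_wr2]
  map3_vl3 _ _ _ := by apply Path3.ext <;> simp [const2_comp2]
  map3_vr3 _ _ _ := by apply Path3.ext <;> simp [const2_comp2]
  map3_tensor _ _ _ := by apply Path3.ext <;> simp [const2_comp2, const2_wl2, const2_wr2]

end GrayCat

/-- Pairs of elements with the same image: the fibre product of types. -/
@[ext]
structure Fib {X Y Z : Type u} (f : X → Z) (g : Y → Z) where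
  fst : X
  snd : Y
  eq : f fst = g snd

namespace GrayFunctor

variable {A B C : GrayData.{u}} (F : GrayFunctor A C) (E : GrayFunctor B C)

/-- The fibre product of two Gray-functors, computed componentwise. -/
abbrev fibData : GrayData.{u} where
  C0 := Fib F.map0 E.map0
  C1 := Fib F.map1 E.map1
  C2 := Fib F.map2 E.map2
  C3 := Fib F.map3 E.map3
  s0 p := ⟨A.s0 p.fst, B.s0 p.snd, by rw [← F.s0_map1, ← E.s0_map1, p.eq]⟩
  t0 p := ⟨A.t0 p.fst, B.t0 p.snd, by rw [← F.t0_map1, ← E.t0_map1, p.eq]⟩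
  s1 p := ⟨A.s1 p.fst, B.s1 p.snd, by rw [← F.s1_map2, ← E.s1_map2, p.eq]⟩
  t1 p := ⟨A.t1 p.fst, B.t1 p.snd, by rw [← F.t1_map2, ← E.t1_map2, p.eq]⟩
  s2 p := ⟨A.s2 p.fst, B.s2 p.snd, by rw [← F.s2_map3, ← E.s2_map3, p.eq]⟩
  t2 p := ⟨A.t2 p.fst, B.t2 p.snd, by rw [← F.t2_map3, ← E.t2_map3, p.eq]⟩
  s0_t1 _ := by simp
  t0_t1 _ := by simp
  s1_t2 _ := by simp
  t1_t2 _ := by simp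
  id1 p := ⟨A.id1 p.fst, B.id1 p.snd, by simp [p.eq]⟩
  s0_id1 _ := by simp
  t0_id1 _ := by simp
  id2 p := ⟨A.id2 p.fst, B.id2 p.snd, by simp [p.eq]⟩
  s1_id2 _ := by simp
  t1_id2 _ := by simp
  id3 p := ⟨A.id3 p.fst, B.id3 p.snd, by simp [p.eq]⟩
  s2_id3 _ := by simp
  t2_id3 _ := by simp
  comp1 q p h := ⟨A.comp1 q.fst p.fst (congrArg Fib.fst h), B.comp1 q.snd p.snd (congrArg Fib.snd h),
    by simp [q.eq, p.eq]⟩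
  s0_comp1 _ _ _ := by simp
  t0_comp1 _ _ _ := by simp
  comp2 q p h := ⟨A.comp2 q.fst p.fst (congrArg Fib.fst h), B.comp2 q.snd p.snd (congrArg Fib.snd h),
    by simp [q.eq, p.eq]⟩
  s1_comp2 _ _ _ := by simp
  t1_comp2 _ _ _ := by simp
  comp3 q p h := ⟨A.comp3 q.fst p.fst (congrArg Fib.fst h), B.comp3 q.snd p.snd (congrArg Fib.snd h),
    by simp [q.eq, p.eq]⟩
  s2_comp3 _ _ _ := by simp
  t2_comp3 _ _ _ := by simp
  wl2 q p h := ⟨A.wl2 q.fst p.fst (congrArg Fib.fst h), B.wl2 q.snd p.snd (congrArg Fib.snd h),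
    by simp [q.eq, p.eq]⟩
  s1_wl2 _ _ _ := by simp
  t1_wl2 _ _ _ := by simp
  wr2 q p h := ⟨A.wr2 q.fst p.fst (congrArg Fib.fst h), B.wr2 q.snd p.snd (congrArg Fib.snd h),
    by simp [q.eq, p.eq]⟩
  s1_wr2 _ _ _ := by simp
  t1_wr2 _ _ _ := by simp
  wl3 q p h := ⟨A.wl3 q.fst p.fst (congrArg Fib.fst h), B.wl3 q.snd p.snd (congrArg Fib.snd h),
    by simp [q.eq, p.eq]⟩
  s2_wl3 _ _ _ := by simp
  t2_wl3 _ _ _ := by simp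
  wr3 q p h := ⟨A.wr3 q.fst p.fst (congrArg Fib.fst h), B.wr3 q.snd p.snd (congrArg Fib.snd h),
    by simp [q.eq, p.eq]⟩
  s2_wr3 _ _ _ := by simp
  t2_wr3 _ _ _ := by simp
  vl3 q p h := ⟨A.vl3 q.fst p.fst (congrArg Fib.fst h), B.vl3 q.snd p.snd (congrArg Fib.snd h),
    by simp [q.eq, p.eq]⟩
  s2_vl3 _ _ _ := by simp
  t2_vl3 _ _ _ := by simp
  vr3 q p h := ⟨A.vr3 q.fst p.fst (congrArg Fib.fst h), B.vr3 q.snd p.snd (congrArg Fib.snd h),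
    by simp [q.eq, p.eq]⟩
  s2_vr3 _ _ _ := by simp
  t2_vr3 _ _ _ := by simp
  tensor q p h := ⟨A.tensor q.fst p.fst (congrArg Fib.fst h), B.tensor q.snd p.snd (congrArg Fib.snd h),
    by simp [q.eq, p.eq]⟩
  s2_tensor _ _ _ := by simp
  t2_tensor _ _ _ := by simp

lemma map_isInv3 {T S : A.C3} (h : A.IsInv3 T S) : C.IsInv3 (F.map3 T) (F.map3 S) := by
  obtain ⟨h₁, h₂, e₁, e₂⟩ := h
  exact ⟨by simp [h₁], by simp [← h₂], (F.map3_comp3 _ _ h₁).symm.trans (by simp [e₁]),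
    (F.map3_comp3 _ _ h₂).symm.trans (by simp [e₂])⟩

lemma fibData_isGray [A.IsGray] [B.IsGray] [C.IsGray] : (F.fibData E).IsGray where
  comp1_id _ _ := by intros; apply Fib.ext <;> apply GrayData.IsGray.comp1_id
  id_comp1 _ _ := by intros; apply Fib.ext <;> apply GrayData.IsGray.id_comp1
  comp1_assoc _ _ := by intros; apply Fib.ext <;> apply GrayData.IsGray.comp1_assoc
  comp2_id _ _ := by intros; apply Fib.ext <;> apply GrayData.IsGray.comp2_id
  id_comp2 _ _ := by intros; apply Fib.ext <;> apply GrayData.IsGray.id_comp2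
  comp2_assoc _ _ := by intros; apply Fib.ext <;> apply GrayData.IsGray.comp2_assoc
  comp3_id _ _ := by intros; apply Fib.ext <;> apply GrayData.IsGray.comp3_id
  id_comp3 _ _ := by intros; apply Fib.ext <;> apply GrayData.IsGray.id_comp3
  comp3_assoc _ _ := by intros; apply Fib.ext <;> apply GrayData.IsGray.comp3_assoc
  vl3_comp3 _ _ := by intros; apply Fib.ext <;> apply GrayData.IsGray.vl3_comp3
  vl3_id3 _ _ := by intros; apply Fib.ext <;> apply GrayData.IsGray.vl3_id3
  vl3_comp2 _ _ := by intros; apply Fib.ext <;> apply GrayData.IsGray.vl3_comp2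
  id2_vl3 _ _ := by intros; apply Fib.ext <;> apply GrayData.IsGray.id2_vl3
  vr3_comp3 _ _ := by intros; apply Fib.ext <;> apply GrayData.IsGray.vr3_comp3
  vr3_id3 _ _ := by intros; apply Fib.ext <;> apply GrayData.IsGray.vr3_id3
  vr3_comp2 _ _ := by intros; apply Fib.ext <;> apply GrayData.IsGray.vr3_comp2
  vr3_id2 _ _ := by intros; apply Fib.ext <;> apply GrayData.IsGray.vr3_id2
  vr3_vl3 _ _ := by intros; apply Fib.ext <;> apply GrayData.IsGray.vr3_vl3
  interchange _ _ := by intros; apply Fib.ext <;> apply GrayData.IsGray.interchange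
  wl2_comp2 _ _ := by intros; apply Fib.ext <;> apply GrayData.IsGray.wl2_comp2
  wl2_id2 _ _ := by intros; apply Fib.ext <;> apply GrayData.IsGray.wl2_id2
  id1_wl2 _ _ := by intros; apply Fib.ext <;> apply GrayData.IsGray.id1_wl2
  wl2_comp1 _ _ := by intros; apply Fib.ext <;> apply GrayData.IsGray.wl2_comp1
  wr2_comp2 _ _ := by intros; apply Fib.ext <;> apply GrayData.IsGray.wr2_comp2
  wr2_id2 _ _ := by intros; apply Fib.ext <;> apply GrayData.IsGray.wr2_id2
  wr2_id1 _ _ := by intros; apply Fib.ext <;> apply GrayData.IsGray.wr2_id1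
  wr2_comp1 _ _ := by intros; apply Fib.ext <;> apply GrayData.IsGray.wr2_comp1
  wr2_wl2 _ _ := by intros; apply Fib.ext <;> apply GrayData.IsGray.wr2_wl2
  wl3_comp3 _ _ := by intros; apply Fib.ext <;> apply GrayData.IsGray.wl3_comp3
  wl3_id3 _ _ := by intros; apply Fib.ext <;> apply GrayData.IsGray.wl3_id3
  wl3_vl3 _ _ := by intros; apply Fib.ext <;> apply GrayData.IsGray.wl3_vl3
  wl3_vr3 _ _ := by intros; apply Fib.ext <;> apply GrayData.IsGray.wl3_vr3
  id1_wl3 _ _ := by intros; apply Fib.ext <;> apply GrayData.IsGray.id1_wl3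
  wl3_comp1 _ _ := by intros; apply Fib.ext <;> apply GrayData.IsGray.wl3_comp1
  wr3_comp3 _ _ := by intros; apply Fib.ext <;> apply GrayData.IsGray.wr3_comp3
  wr3_id3 _ _ := by intros; apply Fib.ext <;> apply GrayData.IsGray.wr3_id3
  wr3_vl3 _ _ := by intros; apply Fib.ext <;> apply GrayData.IsGray.wr3_vl3
  wr3_vr3 _ _ := by intros; apply Fib.ext <;> apply GrayData.IsGray.wr3_vr3
  wr3_id1 _ _ := by intros; apply Fib.ext <;> apply GrayData.IsGray.wr3_id1
  wr3_comp1 _ _ := by intros; apply Fib.ext <;> apply GrayData.IsGray.wr3_comp1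
  wr3_wl3 _ _ := by intros; apply Fib.ext <;> apply GrayData.IsGray.wr3_wl3
  id2_tensor _ _ := by intros; apply Fib.ext <;> apply GrayData.IsGray.id2_tensor
  tensor_id2 _ _ := by intros; apply Fib.ext <;> apply GrayData.IsGray.tensor_id2
  comp2_tensor _ _ := by intros; apply Fib.ext <;> apply GrayData.IsGray.comp2_tensor
  tensor_comp2 _ _ := by intros; apply Fib.ext <;> apply GrayData.IsGray.tensor_comp2
  tensor_natural_left _ _ := by intros; apply Fib.ext <;> apply GrayData.IsGray.tensor_natural_left
  tensor_natural_right _ _ := by intros; apply Fib.ext <;> apply GrayData.IsGray.tensor_natural_right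
  wl2_tensor _ _ := by intros; apply Fib.ext <;> apply GrayData.IsGray.wl2_tensor
  tensor_wr2 _ _ := by intros; apply Fib.ext <;> apply GrayData.IsGray.tensor_wr2
  wr2_tensor _ _ := by intros; apply Fib.ext <;> apply GrayData.IsGray.wr2_tensor
  tensor_inv b a h := by
    obtain ⟨T, hT⟩ := GrayData.IsGray.tensor_inv b.fst a.fst (congrArg Fib.fst h)
    obtain ⟨S, hS⟩ := GrayData.IsGray.tensor_inv b.snd a.snd (congrArg Fib.snd h)
    have hT' := F.map_isInv3 hT
    have hS' := E.map_isInv3 hS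
    have e : F.map3 (A.tensor b.fst a.fst (congrArg Fib.fst h)) =
        E.map3 (B.tensor b.snd a.snd (congrArg Fib.snd h)) := by simp [b.eq, a.eq]
    rw [← e] at hS'
    obtain ⟨h₁, h₂, e₁, e₂⟩ := hT
    obtain ⟨k₁, k₂, f₁, f₂⟩ := hS
    exact ⟨⟨T, S, hT'.unique hS'⟩, Fib.ext h₁ k₁, Fib.ext h₂ k₂, Fib.ext e₁ f₁, Fib.ext e₂ f₂⟩

end GrayFunctor

namespace GrayCat

variable {A B C : GrayCat.{u}}

/-- The fibre product of two Gray-functors as a Gray-category. -/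
abbrev fib (F : A ⟶ C) (E : B ⟶ C) : GrayCat.{u} where
  toGrayData := GrayFunctor.fibData F E
  isGray := GrayFunctor.fibData_isGray (A := A.toGrayData) (B := B.toGrayData)
    (C := C.toGrayData) F E

/-- The first projection of the fibre product. -/
def fibFst (F : A ⟶ C) (E : B ⟶ C) : fib F E ⟶ A where
  map0 p := p.fst
  map1 p := p.fst
  map2 p := p.fst
  map3 p := p.fst
  s0_map1 _ := rfl
  t0_map1 _ := rfl
  s1_map2 _ := rfl
  t1_map2 _ := rfl
  s2_map3 _ := rfl
  t2_map3 _ := rfl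
  map1_id1 _ := rfl
  map2_id2 _ := rfl
  map3_id3 _ := rfl
  map1_comp1 _ _ _ := rfl
  map2_comp2 _ _ _ := rfl
  map3_comp3 _ _ _ := rfl
  map2_wl2 _ _ _ := rfl
  map2_wr2 _ _ _ := rfl
  map3_wl3 _ _ _ := rfl
  map3_wr3 _ _ _ := rfl
  map3_vl3 _ _ _ := rfl
  map3_vr3 _ _ _ := rfl
  map3_tensor _ _ _ := rfl

/-- The second projection of the fibre product. -/
def fibSnd (F : A ⟶ C) (E : B ⟶ C) : fib F E ⟶ B where
  map0 p := p.snd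
  map1 p := p.snd
  map2 p := p.snd
  map3 p := p.snd
  s0_map1 _ := rfl
  t0_map1 _ := rfl
  s1_map2 _ := rfl
  t1_map2 _ := rfl
  s2_map3 _ := rfl
  t2_map3 _ := rfl
  map1_id1 _ := rfl
  map2_id2 _ := rfl
  map3_id3 _ := rfl
  map1_comp1 _ _ _ := rfl
  map2_comp2 _ _ _ := rfl
  map3_comp3 _ _ _ := rfl
  map2_wl2 _ _ _ := rfl
  map2_wr2 _ _ _ := rfl
  map3_wl3 _ _ _ := rfl
  map3_wr3 _ _ _ := rfl
  map3_vl3 _ _ _ := rfl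
  map3_vr3 _ _ _ := rfl
  map3_tensor _ _ _ := rfl

/-- The Gray-category `→H ×_H →H` of composable pairs of paths: pairs `(f̂, f)` such that the
source of `f̂` is the target of `f`. -/
noncomputable abbrev pathPairs (H : GrayCat.{u}) : GrayCat.{u} := fib H.d0 H.d1

end GrayCat

namespace GrayData

namespace Path

variable {G : GrayData.{u}} [G.IsGray]

/-- Vertical pasting of squares, `p` on top of `q`. -/
@[simps]
def vcomp1 (q p : G.Path1) (h : q.left = p.right) : G.Path1 where
  src := G.comp1 q.src p.src (by rw [← q.s0_left, h, p.s0_right])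
  tgt := G.comp1 q.tgt p.tgt (by rw [← q.t0_left, h, p.t0_right])
  left := p.left
  right := q.right
  sq := G.comp2
    (G.wl2 q.tgt p.sq (by rw [← q.t0_left, h, p.s1_sq, G.t0_comp1]))
    (G.wr2 q.sq p.src (by rw [q.s1_sq, G.s0_comp1, ← q.s0_left, h, p.s0_right]))
    (by simp [h])
  s0_left := by simp
  t0_left := by simp
  s0_right := by simp
  t0_right := by simp
  s1_sq := by simp
  t1_sq := by simp

lemma vside (b a : G.Path2) (h : b.left = a.right) : b.src.left = a.src.right := by
  rw [← b.s1_left, h, a.s1_right]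

lemma vside' (b a : G.Path2) (h : b.left = a.right) : b.tgt.left = a.tgt.right := by
  rw [← b.t1_left, h, a.t1_right]

lemma vs0 (b a : G.Path2) (h : b.left = a.right) : G.s0 b.src.src = G.t0 a.src.src := by
  rw [← b.src.s0_left, vside b a h, a.src.s0_right]

lemma vs0' (b a : G.Path2) (h : b.left = a.right) : G.s0 b.src.tgt = G.t0 a.src.tgt := by
  rw [← b.src.t0_left, vside b a h, a.src.t0_right]

/-- The vertical composite of 2-cells of the path space. -/
@[simps]
def vcomp2 (b a : G.Path2) (h : b.left = a.right) : G.Path2 where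
  src := vcomp1 b.src a.src (vside b a h)
  tgt := vcomp1 b.tgt a.tgt (vside' b a h)
  src_tgt := by simp
  tgt_tgt := by simp
  left := a.left
  right := b.right
  s1_left := by simp
  t1_left := by simp
  s1_right := by simp
  t1_right := by simp
  cell := G.comp3
    (G.vl3 (G.wl2 b.src.tgt a.tgt.sq (by simp [vs0' b a h]))
      (G.wr3 b.cell a.src.src (by simp [vs0 b a h])) (by simp [h, vside' b a h]))
    (G.vr3 (G.wl3 b.src.tgt a.cell (by simp [vs0' b a h]))
      (G.wr2 b.src.sq a.src.src (by simp [vs0 b a h])) (by simp [h, vside b a h]))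
    (by simp [h])
  s2_cell := by simp
  t2_cell := by simp

/-- The vertical composite of 3-cells of the path space. -/
@[simps]
def vcomp3 (B A : G.Path3) (h : B.left = A.right) : G.Path3 where
  src := vcomp2 B.src A.src (by rw [← B.s2_left, h, A.s2_right])
  tgt := vcomp2 B.tgt A.tgt (by rw [← B.t2_left, h, A.t2_right])
  src_tgt := by simp
  tgt_tgt := by simp
  left := A.left
  right := B.right
  s2_left := by simp
  t2_left := by simp
  s2_right := by simp
  t2_right := by simp
  comm := by
    have hs : B.src.left = A.src.right := by rw [← B.s2_left, h, A.s2_right]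
    have ht : B.tgt.left = A.tgt.right := by rw [← B.t2_left, h, A.t2_right]
    have e := vr3_congr (a := G.wr2 B.src.src.sq A.src.src.src (by simp [vs0 _ _ hs]))
      (h := by simp [vside _ _ hs, vs0' _ _ hs])
      (wl3_congr (g := B.src.src.tgt) (h := by simp [vs0' _ _ hs]) A.comm)
    have e' := vl3_congr (b := G.wl2 B.src.src.tgt A.src.tgt.sq (by simp [vs0' _ _ hs]))
      (h := by simp [vside' _ _ hs, vs0 _ _ hs, hs])
      (wr3_congr (f := A.src.src.src) (h := by simp [vs0 _ _ hs]) B.comm)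
    simp [h] at e e'
    have e'' := comp3_reassoc e'
    simp [h, e, e'']

end Path

end GrayData

namespace GrayData

namespace Path

variable {G : GrayData.{u}} [G.IsGray]

/-- The comparison 2-cell from the horizontal composite of two vertical composites to the vertical
composite of two horizontal composites, for a two-by-two array of squares with `q`, `q'` below
`p`, `p'`: its two 2-cells are identities and its 3-cell is a whiskered `q'.sq ⊗ p.sq`. -/
@[simps]
def vcompCocycle (q' p' q p : G.Path1) (hq : q'.src = q.tgt) (hp : p'.src = p.tgt)
    (h' : q'.left = p'.right) (h : q.left = p.right) : G.Path2 where
  src := comp1 (vcomp1 q' p' h') (vcomp1 q p h) (by simp [hq, hp])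
  tgt := vcomp1 (comp1 q' q hq) (comp1 p' p hp) (by simp [h, h'])
  src_tgt := by simp
  tgt_tgt := by simp
  left := G.id2 (G.comp1 p'.left p.left (by simp [hp]))
  right := G.id2 (G.comp1 q'.right q.right (by simp [hq]))
  s1_left := by simp
  t1_left := by simp
  s1_right := by simp
  t1_right := by simp
  cell := by
    have e : G.s0 q.src = G.t0 p.src := by rw [← q.s0_left, h, p.s0_right]
    have e' : G.s0 q.tgt = G.t0 p.tgt := by rw [← q.t0_left, h, p.t0_right]
    have f' : G.s0 q'.src = G.t0 p.tgt := by rw [hq, e']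
    have f : G.s0 q'.tgt = G.t0 p'.tgt := by rw [← q'.t0_left, h', p'.t0_right]
    exact G.vl3
      (G.wl2 q'.tgt (G.wr2 p'.sq p.left (by simp [hp])) (by simp [f]))
      (G.vr3 (G.tensor q'.sq p.sq (by simp [f']))
        (G.wl2 q'.right (G.wr2 q.sq p.src (by simp [e])) (by simp [hq]))
        (by simp [h, hq]))
      (by simp [h', hp])
  s2_cell := by simp [h, h', hp, hq]
  t2_cell := by simp [h, h', hp, hq]

end Path

variable {G : GrayData.{u}} (hG : G.IsGroupoid)

/-- The inverse of a 1-cell of a Gray-groupoid. -/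
noncomputable def inv1 (f : G.C1) : G.C1 := (hG.exists_inv1 f).choose

/-- The inverse of a 2-cell of a Gray-groupoid. -/
noncomputable def inv2 (a : G.C2) : G.C2 := (hG.exists_inv2 a).choose

/-- The inverse of a 3-cell of a Gray-groupoid. -/
noncomputable def inv3 (A : G.C3) : G.C3 := (hG.exists_inv3 A).choose

lemma inv1_spec (f : G.C1) : G.IsInv1 f (inv1 hG f) := (hG.exists_inv1 f).choose_spec

lemma inv2_spec (a : G.C2) : G.IsInv2 a (inv2 hG a) := (hG.exists_inv2 a).choose_spec

lemma inv3_spec (A : G.C3) : G.IsInv3 A (inv3 hG A) := (hG.exists_inv3 A).choose_spec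

@[simp] lemma s0_inv1 (f : G.C1) : G.s0 (inv1 hG f) = G.t0 f := (inv1_spec hG f).choose

@[simp] lemma t0_inv1 (f : G.C1) : G.t0 (inv1 hG f) = G.s0 f :=
  (inv1_spec hG f).choose_spec.choose.symm

@[simp] lemma s1_inv2 (a : G.C2) : G.s1 (inv2 hG a) = G.t1 a := (inv2_spec hG a).choose

@[simp] lemma t1_inv2 (a : G.C2) : G.t1 (inv2 hG a) = G.s1 a :=
  (inv2_spec hG a).choose_spec.choose.symm

@[simp] lemma s2_inv3 (A : G.C3) : G.s2 (inv3 hG A) = G.t2 A := (inv3_spec hG A).choose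

@[simp] lemma t2_inv3 (A : G.C3) : G.t2 (inv3 hG A) = G.s2 A :=
  (inv3_spec hG A).choose_spec.choose.symm

@[simp] lemma inv1_comp (f : G.C1) (h) : G.comp1 (inv1 hG f) f h = G.id1 (G.s0 f) :=
  (inv1_spec hG f).choose_spec.choose_spec.1

@[simp] lemma comp_inv1 (f : G.C1) (h) : G.comp1 f (inv1 hG f) h = G.id1 (G.t0 f) :=
  (inv1_spec hG f).choose_spec.choose_spec.2

@[simp] lemma inv2_comp (a : G.C2) (h) : G.comp2 (inv2 hG a) a h = G.id2 (G.s1 a) :=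
  (inv2_spec hG a).choose_spec.choose_spec.1

@[simp] lemma comp_inv2 (a : G.C2) (h) : G.comp2 a (inv2 hG a) h = G.id2 (G.t1 a) :=
  (inv2_spec hG a).choose_spec.choose_spec.2

variable [G.IsGray]

@[simp] lemma inv1_comp_assoc (f g : G.C1) (h : G.s0 f = G.t0 g) (h') :
    G.comp1 (inv1 hG f) (G.comp1 f g h) h' = g := by
  have e := IsGray.comp1_assoc (inv1 hG f) f g (by simp) (by simp [h])
  rw [← e]
  simp [h]

@[simp] lemma comp_inv1_assoc (f g : G.C1) (h : G.s0 (inv1 hG f) = G.t0 g) (h') :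
    G.comp1 f (G.comp1 (inv1 hG f) g h) h' = g := by
  have e := IsGray.comp1_assoc f (inv1 hG f) g (by simp) (by simpa using h)
  rw [← e]
  have h2 : G.t0 f = G.t0 g := by simpa using h
  simp [h2]

@[simp] lemma inv2_comp_assoc (a b : G.C2) (h : G.s1 a = G.t1 b) (h') :
    G.comp2 (inv2 hG a) (G.comp2 a b h) h' = b := by
  have e := IsGray.comp2_assoc (inv2 hG a) a b (by simp) (by simp [h])
  rw [← e]
  simp [h]

@[simp] lemma comp_inv2_assoc (a b : G.C2) (h : G.s1 (inv2 hG a) = G.t1 b) (h') :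
    G.comp2 a (G.comp2 (inv2 hG a) b h) h' = b := by
  have e := IsGray.comp2_assoc a (inv2 hG a) b (by simp) (by simpa using h)
  rw [← e]
  have h2 : G.t1 a = G.t1 b := by simpa using h
  simp [h2]

lemma IsInv2.unique {a b b' : G.C2} (h : G.IsInv2 a b) (h' : G.IsInv2 a b') : b = b' := by
  obtain ⟨h₁, h₂, e₁, e₂⟩ := h
  obtain ⟨h₁', h₂', e₁', e₂'⟩ := h'
  have e := IsGray.comp2_assoc (G := G) b a b' h₁ (by simpa using h₂')
  simpa [e₁, e₂', h₁, ← h₂'] using e.symm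

@[simp] lemma inv2_wl2 (g : G.C1) (a : G.C2) (h) :
    inv2 hG (G.wl2 g a h) = G.wl2 g (inv2 hG a) (by simpa using h) := by
  refine (inv2_spec hG _).unique ⟨by simp, by simp, ?_, ?_⟩
  · rw [← IsGray.wl2_comp2 (ba := by simp) (h := by simpa using h)]
    simp
  · rw [← IsGray.wl2_comp2 (ba := by simp) (h := by simpa using h)]
    simp

@[simp] lemma inv2_wr2 (a : G.C2) (f : G.C1) (h) :
    inv2 hG (G.wr2 a f h) = G.wr2 (inv2 hG a) f (by simpa using h) := by
  refine (inv2_spec hG _).unique ⟨by simp, by simp, ?_, ?_⟩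
  · rw [← IsGray.wr2_comp2 (ba := by simp) (h := by simpa using h)]
    simp
  · rw [← IsGray.wr2_comp2 (ba := by simp) (h := by simpa using h)]
    simp

@[simp] lemma inv2_comp2 (b a : G.C2) (h) :
    inv2 hG (G.comp2 b a h) = G.comp2 (inv2 hG a) (inv2 hG b) (by simp [h]) :=
  (inv2_spec hG _).unique ⟨by simp, by simp, by simp [h], by simp [← h]⟩

@[simp] lemma wl2_inv2_assoc (g : G.C1) (a b : G.C2) (h h' h'' h''') :
    G.comp2 (G.wl2 g (inv2 hG a) h) (G.comp2 (G.wl2 g a h') b h'') h''' = b := by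
  have e := inv2_comp_assoc hG (G.wl2 g a h') b h'' (by simp)
  simpa using e

@[simp] lemma wl2_inv2_assoc' (g : G.C1) (a b : G.C2) (h h' h'' h''') :
    G.comp2 (G.wl2 g a h) (G.comp2 (G.wl2 g (inv2 hG a) h') b h'') h''' = b := by
  have e := comp_inv2_assoc hG (G.wl2 g a h) b (by simpa using h'') (by simp)
  simpa using e

@[simp] lemma wlr2_inv2_assoc (g f : G.C1) (a b : G.C2) (h₁ h₂ h₃ h₄ h₅ h₆) :
    G.comp2 (G.wl2 g (G.wr2 (inv2 hG a) f h₁) h₂)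
      (G.comp2 (G.wl2 g (G.wr2 a f h₃) h₄) b h₅) h₆ = b := by
  have e := inv2_comp_assoc hG (G.wl2 g (G.wr2 a f h₃) h₄) b h₅ (by simp)
  simpa using e

@[simp] lemma wlr2_inv2 (g f : G.C1) (a : G.C2) (h₁ h₂ h₃ h₄ h₅) :
    G.comp2 (G.wl2 g (G.wr2 a f h₃) h₄) (G.wl2 g (G.wr2 (inv2 hG a) f h₁) h₂) h₅ =
      G.id2 (G.t1 (G.wl2 g (G.wr2 a f h₃) h₄)) := by
  have e := comp_inv2 hG (G.wl2 g (G.wr2 a f h₃) h₄) (by simp)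
  simpa using e

@[simp] lemma vl3_inv2 (b : G.C2) (A : G.C3) (h h') :
    G.vl3 (inv2 hG b) (G.vl3 b A h) h' = A := by
  rw [← IsGray.vl3_comp2 (cb := by simp) (hA := by simpa using h)]
  simp

@[simp] lemma inv2_vl3 (b : G.C2) (A : G.C3) (h h') :
    G.vl3 b (G.vl3 (inv2 hG b) A h) h' = A := by
  rw [← IsGray.vl3_comp2 (cb := by simp) (hA := by simpa using h)]
  simp

@[simp] lemma vr3_inv2 (A : G.C3) (b : G.C2) (h h') :
    G.vr3 (G.vr3 A b h) (inv2 hG b) h' = A := by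
  rw [← IsGray.vr3_comp2 (ba := by simp) (hA := by simpa using h)]
  simp

@[simp] lemma inv2_vr3 (A : G.C3) (b : G.C2) (h h') :
    G.vr3 (G.vr3 A (inv2 hG b) h) b h' = A := by
  rw [← IsGray.vr3_comp2 (ba := by simp) (hA := by simpa using h)]
  simp

@[simp] lemma inv1_wl3 (g : G.C1) (A : G.C3) (h h') :
    G.wl3 (inv1 hG g) (G.wl3 g A h) h' = A := by
  rw [← IsGray.wl3_comp1 (kg := by simp) (hA := by simpa using h)]
  simp

@[simp] lemma wr3_inv1 (g : G.C1) (A : G.C3) (h h') :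
    G.wr3 (G.wr3 A g h) (inv1 hG g) h' = A := by
  rw [← IsGray.wr3_comp1 (gf := by simp) (hA := by simpa using h)]
  simp

@[simp] lemma inv1_wl2 (g : G.C1) (a : G.C2) (h h') :
    G.wl2 (inv1 hG g) (G.wl2 g a h) h' = a := by
  rw [← IsGray.wl2_comp1 (kg := by simp) (ha := by simpa using h)]
  simp

@[simp] lemma wl2_inv1 (g : G.C1) (a : G.C2) (h h') :
    G.wl2 g (G.wl2 (inv1 hG g) a h) h' = a := by
  rw [← IsGray.wl2_comp1 (kg := by simp) (ha := by simpa using h)]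
  simp

@[simp] lemma wr2_inv1 (g : G.C1) (a : G.C2) (h h') :
    G.wr2 (G.wr2 a g h) (inv1 hG g) h' = a := by
  rw [← IsGray.wr2_comp1 (gf := by simp) (ha := by simpa using h)]
  simp

@[simp] lemma inv1_wr2 (g : G.C1) (a : G.C2) (h h') :
    G.wr2 (G.wr2 a (inv1 hG g) h) g h' = a := by
  rw [← IsGray.wr2_comp1 (gf := by simp) (ha := by simpa using h)]
  simp

namespace Path

/-- The vertical inverse of a square. -/
@[simps]
noncomputable def opp1 (g : G.Path1) : G.Path1 where
  src := inv1 hG g.src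
  tgt := inv1 hG g.tgt
  left := g.right
  right := g.left
  sq := G.wl2 (inv1 hG g.tgt) (G.wr2 (inv2 hG g.sq) (inv1 hG g.src) (by simp)) (by simp)
  s0_left := by simp
  t0_left := by simp
  s0_right := by simp
  t0_right := by simp
  s1_sq := by simp
  t1_sq := by simp

/-- The vertical inverse of a 2-cell of the path space. -/
@[simps]
noncomputable def opp2 (a : G.Path2) : G.Path2 where
  src := opp1 hG a.src
  tgt := opp1 hG a.tgt
  src_tgt := by simp
  tgt_tgt := by simp
  left := a.right
  right := a.left
  s1_left := by simp
  t1_left := by simp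
  s1_right := by simp
  t1_right := by simp
  cell := G.wl3 (inv1 hG a.src.tgt)
    (G.wr3
      (G.vl3 (inv2 hG a.tgt.sq) (G.vr3 (inv3 hG a.cell) (inv2 hG a.src.sq) (by simp)) (by simp))
      (inv1 hG a.src.src) (by simp))
    (by simp)
  s2_cell := by simp
  t2_cell := by simp

/-- The vertical inverse of a 3-cell of the path space. -/
@[simps]
noncomputable def opp3 (A : G.Path3) : G.Path3 where
  src := opp2 hG A.src
  tgt := opp2 hG A.tgt
  src_tgt := by simp
  tgt_tgt := by simp
  left := A.right
  right := A.left
  s2_left := by simp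
  t2_left := by simp
  s2_right := by simp
  t2_right := by simp
  comm := by
    have m := comp3_inv_move (inv3_spec hG A.tgt.cell) (inv3_spec hG A.src.cell) A.comm
      (by simp) (by simp)
    have m' := vl3_congr (b := inv2 hG A.src.tgt.sq) (h := by simp)
      (vr3_congr (a := inv2 hG A.src.src.sq) (h := by simp) m)
    simp at m'
    have m'' := wl3_congr (g := inv1 hG A.src.src.tgt) (h := by simp)
      (wr3_congr (f := inv1 hG A.src.src.src) (h := by simp) m'.symm)
    simp at m''
    simp [m'']

/-- The comparison 2-cell from the horizontal composite of two vertical inverses to the vertical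
inverse of the horizontal composite: its two 2-cells are identities and its 3-cell is
`f̄'' #₀ ((h̄₂ #₀ f̄') ⊗ ḡ₂) #₀ f̄`, for squares `k = (h₂; h₀, h₁, f', f'')`,
`g = (g₂; g₀, g₁, f, f')`. -/
@[simps]
noncomputable def oppCocycle (k g : G.Path1) (h : k.src = g.tgt) : G.Path2 where
  src := comp1 (opp1 hG k) (opp1 hG g) (by simp [h])
  tgt := opp1 hG (comp1 k g h)
  src_tgt := by simp
  tgt_tgt := by simp
  left := G.id2 (G.comp1 k.right g.right (by simp [h]))
  right := G.id2 (G.comp1 k.left g.left (by simp [h]))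
  s1_left := by simp
  t1_left := by simp
  s1_right := by simp
  t1_right := by simp
  cell := G.wl3 (inv1 hG k.tgt)
    (G.wr3
      (G.tensor (G.wr2 (inv2 hG k.sq) (inv1 hG g.tgt) (by simp [h])) (inv2 hG g.sq) (by simp))
      (inv1 hG g.src) (by simp))
    (by simp)
  s2_cell := by simp [h]
  t2_cell := by simp [h]

end Path

end GrayData

/-- An internal category with object of objects `X₀`, object of morphisms `X₁`, source `s`,
target `t`, identities `e`, and composition `m` on the object `X₂` of composable pairs, whose
projections are `p` (the map applied last) and `q` (the map applied first). -/
structure IsInternalCategory {C : Type*} [Category* C] {X₀ X₁ X₂ : C} (s t : X₁ ⟶ X₀)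
    (e : X₀ ⟶ X₁) (p q : X₂ ⟶ X₁) (m : X₂ ⟶ X₁) : Prop where
  isPullback : IsPullback p q s t
  ident_src : e ≫ s = 𝟙 X₀
  ident_tgt : e ≫ t = 𝟙 X₀
  comp_src : m ≫ s = q ≫ s
  comp_tgt : m ≫ t = p ≫ t
  ident_comp : isPullback.lift (t ≫ e) (𝟙 X₁) (by simp [ident_src]) ≫ m = 𝟙 X₁
  comp_ident : isPullback.lift (𝟙 X₁) (s ≫ e) (by simp [ident_tgt]) ≫ m = 𝟙 X₁
  assoc : ∀ {T : C} (c b a : T ⟶ X₁) (hcb : c ≫ s = b ≫ t) (hba : b ≫ s = a ≫ t),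
    isPullback.lift (isPullback.lift c b hcb ≫ m) a (by simp [comp_src, hba]) ≫ m =
      isPullback.lift c (isPullback.lift b a hba ≫ m) (by simp [comp_tgt, hcb]) ≫ m

/-- An internal groupoid: an internal category together with a map `o` that inverts morphisms. -/
structure IsInternalGroupoid {C : Type*} [Category* C] {X₀ X₁ X₂ : C} (s t : X₁ ⟶ X₀)
    (e : X₀ ⟶ X₁) (p q : X₂ ⟶ X₁) (m : X₂ ⟶ X₁) (o : X₁ ⟶ X₁) : Prop extends
    IsInternalCategory s t e p q m where
  inv_src : o ≫ s = t
  inv_tgt : o ≫ t = s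
  inv_comp : isPullback.lift o (𝟙 X₁) (by simp [inv_src]) ≫ m = s ≫ e
  comp_inv : isPullback.lift (𝟙 X₁) o (by simp [inv_tgt]) ≫ m = t ≫ e

namespace GrayCat

open GrayData

/-- A Gray-category as an object of the co-Kleisli category of `Q¹`. -/
noncomputable abbrev pseudo (A : GrayCat.{u}) : Cokleisli Q1.{u} := Cokleisli.mk Q1 A

/-- A strict Gray-functor as a `Q¹`-map. -/
noncomputable abbrev strict {A B : GrayCat.{u}} (F : A ⟶ B) : A.pseudo ⟶ B.pseudo :=
  (Cokleisli.Adjunction.toCokleisli Q1).map F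

/-- The Gray-functor `Q¹A ⟶ B` underlying a `Q¹`-map from `A` to `B`. -/
noncomputable abbrev under {A B : GrayCat.{u}} (F : A.pseudo ⟶ B.pseudo) :
    GrayFunctor A.Q1obj.toGrayData B.toGrayData := F.of

section

variable {A : GrayCat.{u}}

/-- The 2-cell `(a; [f], [g])` of `Q¹A` on a 2-cell `a : f ⟹ g` of `A`. -/
noncomputable def word2 (a : A.toGrayData.C2) : A.Q1obj.toGrayData.C2 where
  src := single (A.toGrayData.s1 a)
  tgt := single (A.toGrayData.t1 a)
  val := a
  s1_val := (ev_single _).symm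
  t1_val := (ev_single _).symm

/-- The 3-cell of `Q¹A` on a 3-cell of `A` between 2-cells from `f` to `g`, relative to the words
`[f]` and `[g]`. -/
noncomputable def word3 (Γ : A.toGrayData.C3) : A.Q1obj.toGrayData.C3 where
  src := single (A.toGrayData.s1 (A.toGrayData.s2 Γ))
  tgt := single (A.toGrayData.t1 (A.toGrayData.s2 Γ))
  val := Γ
  s1_val := (ev_single _).symm
  t1_val := (ev_single _).symm

/-- The 2-cell `κ = (id; [g, f], [g #₀ f])` of `Q¹A`; its image under a `Q¹`-map `F` is the
component of the 2-cocycle of `F` at `g`, `f`. -/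
noncomputable def kappa (g f : A.toGrayData.C1) (h : A.toGrayData.s0 g = A.toGrayData.t0 f) :
    A.Q1obj.toGrayData.C2 where
  src := A.Q1obj.toGrayData.comp1 (single g) (single f)
    ((src_single g).trans (h.trans (tgt_single f).symm))
  tgt := single (A.toGrayData.comp1 g f h)
  val := A.toGrayData.id2 (A.toGrayData.comp1 g f h)
  s1_val := by
    rw [A.toGrayData.s1_id2]
    refine Eq.trans ?_ ((GrayData.wordCat A.isGray).ev_comp1 (single g) (single f)
      ((src_single g).trans (h.trans (tgt_single f).symm))).symm
    have e : ∀ (g' f' : A.toGrayData.C1) (h' : A.toGrayData.s0 g' = A.toGrayData.t0 f'),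
        g' = g → f' = f → A.toGrayData.comp1 g f h = A.toGrayData.comp1 g' f' h' := by
      rintro _ _ _ rfl rfl
      rfl
    exact e _ _ _ (ev_single g) (ev_single f)
  t1_val := by
    rw [A.toGrayData.t1_id2]
    exact (ev_single _).symm

end

variable (H : GrayCat.{u})

/-- The `Q¹`-map `m : →H ×_H →H ⇸ →H` is vertical composition of paths, with 2-cocycle given by
`vcompCocycle`. -/
structure IsPathComp (m : H.pathPairs.pseudo ⟶ H.path.pseudo) : Prop where
  map0 : ∀ p : H.pathPairs.toGrayData.C0, (under m).map0 p = H.toGrayData.comp1 p.fst p.snd p.eq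
  map1 : ∀ p : H.pathPairs.toGrayData.C1, (under m).map1 (single p) = Path.vcomp1 p.fst p.snd p.eq
  map2 : ∀ p : H.pathPairs.toGrayData.C2, (under m).map2 (word2 p) = Path.vcomp2 p.fst p.snd p.eq
  map3 : ∀ p : H.pathPairs.toGrayData.C3, (under m).map3 (word3 p) = Path.vcomp3 p.fst p.snd p.eq
  cocycle : ∀ (p' p : H.pathPairs.toGrayData.C1)
    (h : H.pathPairs.toGrayData.s0 p' = H.pathPairs.toGrayData.t0 p),
    (under m).map2 (kappa p' p h) =
      Path.vcompCocycle p'.fst p'.snd p.fst p.snd (congrArg Fib.fst h) (congrArg Fib.snd h)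
        p'.eq p.eq

/-- The `Q¹`-map `o : →H ⇸ →H` is vertical inversion of paths, with 2-cocycle given by
`oppCocycle`. -/
structure IsPathOpp (hH : H.toGrayData.IsGroupoid) (o : H.path.pseudo ⟶ H.path.pseudo) :
    Prop where
  map0 : ∀ f : H.path.toGrayData.C0, (under o).map0 f = inv1 hH f
  map1 : ∀ g : H.path.toGrayData.C1, (under o).map1 (single g) = Path.opp1 hH g
  map2 : ∀ a : H.path.toGrayData.C2, (under o).map2 (word2 a) = Path.opp2 hH a
  map3 : ∀ A : H.path.toGrayData.C3, (under o).map3 (word3 A) = Path.opp3 hH A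
  cocycle : ∀ (k g : H.path.toGrayData.C1) (h : H.path.toGrayData.s0 k = H.path.toGrayData.t0 g),
    (under o).map2 (kappa k g h) = Path.oppCocycle hH k g h

end GrayCat

/-!
A `Q¹`-map `A ⇸ B` is a Gray-functor on the Gray-category `Q¹A`, whose 1-cells are words.  It is
determined by its values on the cells of `A` and by its 2-cocycle (`GrayCat.Q1_hom_ext`,
`GrayCat.pseudo_ext`): every 2-cell of `Q¹A` is a 2-cell of `A` conjugated by the canonical cells
from a word to the letter on its composite, and these are pasted from the cells `κ`.

Conversely, let values on the cells of `A` in the path space and a cocycle be given, such that the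
values lie over two strict Gray-functors `A ⟶ H`, the cocycle is unital, associative and natural,
and its components are globular, that is, have identities as sides (`GrayData.PathMap`).  A
functor on words is obtained by composing the values on the letters.  Pasting cocycles compares the
value on a word with the value on its composite; these comparisons are globular, hence invertible,
as the 3-cells of a Gray-groupoid are, and conjugation by them defines the functor on 2-cells.  All
equations between 3-cells hold automatically, since a 3-cell of the path space is determined by its
boundary and its sides.  This gives `GrayData.PathMap.toHom`.

For vertical composition and inversion the axioms of a `PathMap` are equations between 2-cells of
the path space, that is, between pastings of 3-cells of `H`.  After expanding the tensors of
composites, each follows from the interchange law for 3-cells, naturality of the tensor and cancellation of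
inverses (`Path.vcompCocycle_assoc`, `_wl2`, `_wr2` and `Path.oppCocycle_assoc`, `_wl2`, `_wr2`).

Strict Gray-functors form a right adjoint into the co-Kleisli category, so the componentwise fibre
product of path spaces is still a pullback there (`GrayCat.strict_fib_isPullback`).  The laws of an
internal groupoid are therefore equations between `Q¹`-maps, which are compared on values and
cocycles.  On values they express that vertical pasting of squares is associative, unital and has
inverses; on cocycles they are `Path.vcompCocycle_vassoc`, `Path.vcompCocycle_const`,
`Path.const_vcompCocycle`, `Path.oppCocycle_vcomp2` and `Path.vcomp2_oppCocycle`.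
-/

namespace GrayData

variable {G : GrayData.{u}} [G.IsGray]

/-! ### 2-cells of the path space with identity sides -/

/-- A 2-cell of the path space is *globular* if its two 2-cells are identities, so that it amounts
to a 3-cell between the fillers of its source and its target. -/
structure Path2.IsGlobular (a : G.Path2) : Prop where
  left_eq : a.left = G.id2 a.src.left
  right_eq : a.right = G.id2 a.src.right

namespace Path

lemma comp1_congr {k k' g g' : G.Path1} {h : k.src = g.tgt} (e : k = k') (e' : g = g') :
    comp1 k g h = comp1 k' g' (e ▸ e' ▸ h) := by
  subst e e'; rfl

lemma comp2_congr {b b' a a' : G.Path2} {h : b.src = a.tgt} (e : b = b') (e' : a = a') :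
    comp2 b a h = comp2 b' a' (e ▸ e' ▸ h) := by
  subst e e'; rfl

lemma wl2_congr {k : G.Path1} {a a' : G.Path2} {h : k.src = a.src.tgt} (e : a = a') :
    wl2 k a h = wl2 k a' (e ▸ h) := by
  subst e; rfl

lemma wr2_congr {n : G.Path1} {a a' : G.Path2} {h : a.src.src = n.tgt} (e : a = a') :
    wr2 a n h = wr2 a' n (e ▸ h) := by
  subst e; rfl

/-- Reassociated form of an equation between composites of two 2-cells. -/
lemma comp2_reassoc {a b c d : G.Path2} {h h'} (e : comp2 a b h = comp2 c d h') (X : G.Path2)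
    (hX : b.src = X.tgt) :
    comp2 a (comp2 b X hX) h =
      comp2 c (comp2 d X ((by simpa using congrArg Path2.src e : b.src = d.src).symm.trans hX))
        h' := by
  have := comp2_congr (h := by simpa using hX) e (rfl : X = X)
  simpa using this

end Path

namespace Path2.IsGlobular

variable {a b : G.Path2}

lemma tgt_left (ha : a.IsGlobular) : a.tgt.left = a.src.left := by
  rw [← a.t1_left, ha.left_eq, G.t1_id2]

lemma tgt_right (ha : a.IsGlobular) : a.tgt.right = a.src.right := by
  rw [← a.t1_right, ha.right_eq, G.t1_id2]

lemma id2 (g : G.Path1) : (Path.id2 g).IsGlobular := ⟨rfl, rfl⟩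

lemma comp2 (hb : b.IsGlobular) (ha : a.IsGlobular) (h : b.src = a.tgt) :
    (Path.comp2 b a h).IsGlobular where
  left_eq := by simp [hb.left_eq, ha.left_eq, h, ha.tgt_left]
  right_eq := by simp [hb.right_eq, ha.right_eq, h, ha.tgt_right]

lemma wl2 (ha : a.IsGlobular) (k : G.Path1) (h : k.src = a.src.tgt) :
    (Path.wl2 k a h).IsGlobular where
  left_eq := by simp [ha.left_eq]
  right_eq := by simp [ha.right_eq]

/-- A 3-cell of the path space with identity components forces its source and target to agree. -/
lemma _root_.GrayData.Path3.src_eq_tgt (A : G.Path3) (hl : A.left = G.id3 A.src.left)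
    (hr : A.right = G.id3 A.src.right) : A.src = A.tgt := by
  have el : A.tgt.left = A.src.left := by rw [← A.t2_left, hl, G.t2_id3]
  have er : A.tgt.right = A.src.right := by rw [← A.t2_right, hr, G.t2_id3]
  -- the cell equation needs the boundary 2-cells to agree
  have hs : A.src.src = A.tgt.src := A.src_tgt.symm
  have ht : A.src.tgt = A.tgt.tgt := A.tgt_tgt.symm
  refine Path2.ext hs ht el.symm er.symm ?_
  have c := A.comm
  simpa [hl, hr] using c.symm

/-- A globular 2-cell `b` interchanges with every 2-cell `a`: the tensor `b ⊗ a` of the path space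
has identity components. -/
lemma exchange_left (hb : b.IsGlobular) (h : b.src.src = a.src.tgt) :
    Path.comp2 (Path.wr2 b a.tgt (by simp [h])) (Path.wl2 b.src a h) (by simp) =
      Path.comp2 (Path.wl2 b.tgt a (by simp [h])) (Path.wr2 b a.src h) (by simp) :=
  (Path.tensor b a h).src_eq_tgt (by simp [hb.left_eq]) (by simp [hb.right_eq])

/-- A globular 2-cell `a` interchanges with every 2-cell `b`. -/
lemma exchange_right (ha : a.IsGlobular) (h : b.src.src = a.src.tgt) :
    Path.comp2 (Path.wr2 b a.tgt (by simp [h])) (Path.wl2 b.src a h) (by simp) =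
      Path.comp2 (Path.wl2 b.tgt a (by simp [h])) (Path.wr2 b a.src h) (by simp) :=
  (Path.tensor b a h).src_eq_tgt (by simp [ha.left_eq, ha.tgt_left])
    (by simp [ha.right_eq, ha.tgt_right])

end Path2.IsGlobular

/-- The inverse of a globular 2-cell of the path space of a Gray-groupoid, which exists since the
3-cells are invertible. -/
@[simps]
noncomputable def Path2.globInv (hG : G.IsGroupoid) (a : G.Path2) (ha : a.IsGlobular) :
    G.Path2 where
  src := a.tgt
  tgt := a.src
  src_tgt := by simp
  tgt_tgt := by simp
  left := G.id2 a.src.left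
  right := G.id2 a.src.right
  s1_left := by simp [ha.tgt_left]
  t1_left := by simp
  s1_right := by simp [ha.tgt_right]
  t1_right := by simp
  cell := inv3 hG a.cell
  s2_cell := by simp [ha.right_eq, ← ha.tgt_left]
  t2_cell := by simp [ha.left_eq]

namespace Path2

variable (hG : G.IsGroupoid) (a : G.Path2) (ha : a.IsGlobular)

lemma globInv_comp (h) : Path.comp2 (a.globInv hG ha) a h = Path.id2 a.src := by
  have e := (inv3_spec hG a.cell).eq₁ (by simp)
  apply Path2.ext
  · simp
  · simp
  · simp [ha.left_eq]
  · simp [ha.right_eq]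
  · simpa [ha.left_eq, ha.right_eq] using e

lemma comp_globInv (h) : Path.comp2 a (a.globInv hG ha) h = Path.id2 a.tgt := by
  have e := (inv3_spec hG a.cell).eq₂ (by simp)
  apply Path2.ext
  · simp
  · simp
  · simp [ha.left_eq, ha.tgt_left]
  · simp [ha.right_eq, ha.tgt_right]
  · simpa [ha.left_eq, ha.right_eq] using e

end Path2

/-- Globular 2-cells are left cancellable. -/
lemma Path2.IsGlobular.cancel {a X Y : G.Path2} (ha : a.IsGlobular) (hG : G.IsGroupoid)
    (hX : a.src = X.tgt) (hY : a.src = Y.tgt)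
    (e : Path.comp2 a X hX = Path.comp2 a Y hY) : X = Y := by
  have e' := Path.comp2_congr (b := a.globInv hG ha) (h := by simp) rfl e
  have k := Path.comp2_assoc (a.globInv hG ha) a X (by simp) (by simpa using hX)
  have k' := Path.comp2_assoc (a.globInv hG ha) a Y (by simp) (by simpa using hY)
  rw [← k, ← k', Path.comp2_congr (a.globInv_comp hG ha _) rfl,
    Path.comp2_congr (a.globInv_comp hG ha _) rfl, Path.id_comp2, Path.id_comp2] at e'
  exact e'

end GrayData

namespace GrayData

/-! ### Pseudofunctors into the path space -/

/-- A map `A ⇸ →G` presented on cells of `A`, lying over the strict Gray-functors `L` and `R` given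
by the left and right sides of its values.  It preserves identities and vertical composition
strictly and 0-composition up to the globular cocycle `coc`. -/
structure PathMap (A G : GrayData.{u}) [A.IsGray] [G.IsGray] (L R : GrayFunctor A G) where
  map0 : A.C0 → G.C1
  map1 : A.C1 → G.Path1
  src_map1 : ∀ f, (map1 f).src = map0 (A.s0 f)
  tgt_map1 : ∀ f, (map1 f).tgt = map0 (A.t0 f)
  map1_id1 : ∀ x, map1 (A.id1 x) = Path.id1 (map0 x)
  map2 : A.C2 → G.Path2
  src_map2 : ∀ a, (map2 a).src = map1 (A.s1 a)
  tgt_map2 : ∀ a, (map2 a).tgt = map1 (A.t1 a)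
  left_map2 : ∀ a, (map2 a).left = L.map2 a
  right_map2 : ∀ a, (map2 a).right = R.map2 a
  map2_id2 : ∀ f, map2 (A.id2 f) = Path.id2 (map1 f)
  map2_comp2 : ∀ b a h, map2 (A.comp2 b a h) =
    Path.comp2 (map2 b) (map2 a) (by rw [src_map2, tgt_map2, h])
  map3 : A.C3 → G.Path3
  src_map3 : ∀ X, (map3 X).src = map2 (A.s2 X)
  tgt_map3 : ∀ X, (map3 X).tgt = map2 (A.t2 X)
  left_map3 : ∀ X, (map3 X).left = L.map3 X
  right_map3 : ∀ X, (map3 X).right = R.map3 X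
  coc : ∀ g f, A.s0 g = A.t0 f → G.Path2
  src_coc : ∀ g f h, (coc g f h).src = Path.comp1 (map1 g) (map1 f) (by rw [src_map1, tgt_map1, h])
  tgt_coc : ∀ g f h, (coc g f h).tgt = map1 (A.comp1 g f h)
  coc_glob : ∀ g f h, (coc g f h).IsGlobular
  coc_id : ∀ f h, coc f (A.id1 (A.s0 f)) h = Path.id2 (map1 f)
  id_coc : ∀ f h, coc (A.id1 (A.t0 f)) f h = Path.id2 (map1 f)
  coc_assoc : ∀ k g f hkg hgf,
    Path.comp2 (coc (A.comp1 k g hkg) f (by simpa using hgf))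
      (Path.wr2 (coc k g hkg) (map1 f) (by simp [src_coc, src_map1, tgt_map1, hgf]))
      (by simp [src_coc, tgt_coc]) =
    Path.comp2 (coc k (A.comp1 g f hgf) (by simpa using hkg))
      (Path.wl2 (map1 k) (coc g f hgf) (by simp [src_coc, src_map1, tgt_map1, hkg]))
      (by simp [src_coc, tgt_coc])
  coc_wl2 : ∀ k a h,
    Path.comp2 (map2 (A.wl2 k a h)) (coc k (A.s1 a) h) (by simp [src_map2, tgt_coc]) =
    Path.comp2 (coc k (A.t1 a) (by simpa using h))
      (Path.wl2 (map1 k) (map2 a) (by simp [src_map2, src_map1, tgt_map1, h]))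
      (by simp [src_coc, tgt_map2])
  coc_wr2 : ∀ a f h,
    Path.comp2 (map2 (A.wr2 a f h)) (coc (A.s1 a) f h) (by simp [src_map2, tgt_coc]) =
    Path.comp2 (coc (A.t1 a) f (by simpa using h))
      (Path.wr2 (map2 a) (map1 f) (by simp [src_map2, src_map1, tgt_map1, h]))
      (by simp [src_coc, tgt_map2])

namespace PathMap

variable {A G : GrayData.{u}} [A.IsGray] [G.IsGray] {L R : GrayFunctor A G} (F : PathMap A G L R)

attribute [simp] src_map1 tgt_map1 src_map2 tgt_map2 left_map2 right_map2 src_map3 tgt_map3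
  left_map3 right_map3 src_coc tgt_coc

@[simp] lemma left_map1 (f : A.C1) : (F.map1 f).left = L.map1 f := by
  have e := congrArg G.s1 (congrArg Path2.left (F.map2_id2 f))
  simpa using e.symm

@[simp] lemma right_map1 (f : A.C1) : (F.map1 f).right = R.map1 f := by
  have e := congrArg G.s1 (congrArg Path2.right (F.map2_id2 f))
  simpa using e.symm

lemma isPath_map {x y : A.C0} {l : List A.C1} (h : A.IsPath x y l) :
    G.pathData.IsPath (F.map0 x) (F.map0 y) (l.map F.map1) := by
  induction l generalizing y with
  | nil => exact congrArg F.map0 h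
  | cons f l ih =>
    refine ⟨(F.tgt_map1 f).trans (congrArg F.map0 h.1), ?_⟩
    change G.pathData.IsPath _ (F.map1 f).src _
    rw [F.src_map1]
    exact ih h.2

/-- The value on a word: the horizontal composite of the squares assigned to its letters. -/
noncomputable def wordVal (x : A.C0) (l : List A.C1) (y : A.C0) (h : A.IsPath x y l) : G.Path1 :=
  (evList (G := G.pathData) (F.map0 x) (l.map F.map1) (F.map0 y) (F.isPath_map h)).1

@[simp] lemma src_wordVal (x : A.C0) (l : List A.C1) (y : A.C0) (h : A.IsPath x y l) :
    (F.wordVal x l y h).src = F.map0 x :=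
  (evList (G := G.pathData) (F.map0 x) (l.map F.map1) (F.map0 y) (F.isPath_map h)).2.1

@[simp] lemma tgt_wordVal (x : A.C0) (l : List A.C1) (y : A.C0) (h : A.IsPath x y l) :
    (F.wordVal x l y h).tgt = F.map0 y :=
  (evList (G := G.pathData) (F.map0 x) (l.map F.map1) (F.map0 y) (F.isPath_map h)).2.2

lemma wordVal_cons (x : A.C0) (f : A.C1) (l : List A.C1) (y : A.C0) (h : A.IsPath x y (f :: l)) :
    F.wordVal x (f :: l) y h =
      Path.comp1 (F.map1 f) (F.wordVal x l (A.s0 f) h.2) (by simp) := by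
  have e := evList_congr (G := G.pathData) (F.isPath_map h).2 rfl (F.isPath_map h.2) (F.src_map1 f)
  exact Path.comp1_congr
    (h := (evList (G := G.pathData) _ _ _ (F.isPath_map h).2).2.2.symm) rfl e

lemma wordVal_append {x y z : A.C0} {l m : List A.C1} (hl : A.IsPath y z l)
    (hm : A.IsPath x y m) :
    F.wordVal x (l ++ m) z (hl.append hm) =
      Path.comp1 (F.wordVal y l z hl) (F.wordVal x m y hm) (by simp) := by
  have e := evList_append G.pathData_isGray (F.isPath_map hl) (F.isPath_map hm)
  refine Eq.trans (evList_congr (G := G.pathData) _ ?_ _ rfl) e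
  simp

@[simp] lemma s0_evList {x y : A.C0} {l : List A.C1} (h : A.IsPath x y l) :
    A.s0 (evList x l y h).1 = x := (evList x l y h).2.1

@[simp] lemma t0_evList {x y : A.C0} {l : List A.C1} (h : A.IsPath x y l) :
    A.t0 (evList x l y h).1 = y := (evList x l y h).2.2

/-- The comparison from the value on a word to the value on its composite, a pasting of
cocycles. -/
noncomputable def comparison (x : A.C0) : ∀ (l : List A.C1) (y : A.C0) (h : A.IsPath x y l),
    {a : G.Path2 // a.src = F.wordVal x l y h ∧ a.tgt = F.map1 (evList x l y h).1 ∧ a.IsGlobular}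
  | [], _, h => ⟨Path.id2 (Path.id1 (F.map0 x)), by cases h; rfl, (F.map1_id1 x).symm, .id2 _⟩
  | f :: l, _, h => ⟨Path.comp2 (F.coc f (evList x l (A.s0 f) h.2).1 (by simp))
      (Path.wl2 (F.map1 f) (comparison x l (A.s0 f) h.2).1
        (by rw [(comparison x l (A.s0 f) h.2).2.1]; simp))
      (by simp [(comparison x l (A.s0 f) h.2).2.2.1]),
      by simp [wordVal_cons, (comparison x l (A.s0 f) h.2).2.1],
      by simp [evList],
      (F.coc_glob _ _ _).comp2 ((comparison x l (A.s0 f) h.2).2.2.2.wl2 _ _) _⟩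

/-- The comparison 2-cell on a composable list. -/
noncomputable def cmp (x : A.C0) (l : List A.C1) (y : A.C0) (h : A.IsPath x y l) : G.Path2 :=
  (F.comparison x l y h).1

section

variable {x y z : A.C0} {l m : List A.C1} (h : A.IsPath x y l)

@[simp] lemma src_cmp : (F.cmp x l y h).src = F.wordVal x l y h := (F.comparison x l y h).2.1

@[simp] lemma tgt_cmp : (F.cmp x l y h).tgt = F.map1 (evList x l y h).1 :=
  (F.comparison x l y h).2.2.1

lemma cmp_glob : (F.cmp x l y h).IsGlobular := (F.comparison x l y h).2.2.2

lemma cmp_cons (f : A.C1) (h : A.IsPath x y (f :: l)) : F.cmp x (f :: l) y h =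
    Path.comp2 (F.coc f (evList x l (A.s0 f) h.2).1 (by simp))
      (Path.wl2 (F.map1 f) (F.cmp x l (A.s0 f) h.2) (by simp)) (by simp) := rfl

/-- The comparison on a concatenation factors through the comparisons on the two parts.  This is
where associativity of the cocycle enters. -/
lemma cmp_append (hl : A.IsPath y z l) (hm : A.IsPath x y m) :
    F.cmp x (l ++ m) z (hl.append hm) =
      Path.comp2 (F.coc (evList y l z hl).1 (evList x m y hm).1 (by simp))
        (Path.comp2 (Path.wr2 (F.cmp y l z hl) (F.map1 (evList x m y hm).1) (by simp))
          (Path.wl2 (F.wordVal y l z hl) (F.cmp x m y hm) (by simp)) (by simp)) (by simp) := by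
  induction l generalizing z with
  | nil =>
    cases hl
    have e := F.id_coc (evList x m y hm).1 (by simp)
    have e' : F.cmp y [] y rfl = Path.id2 (Path.id1 (F.map0 y)) := rfl
    simp at e
    have e'' : F.wordVal y [] y rfl = Path.id1 (F.map0 y) := rfl
    simp [evList, e', e, e'']
  | cons f l ih =>
    have c := F.coc_assoc f (evList y l _ hl.2).1 (evList x m y hm).1 (by simp) (by simp)
    have c' := Path.comp2_reassoc c
    simp only [List.cons_append, cmp_cons, ih hl.2, evList_append _ hl.2 hm, evList, wordVal_cons]
    simp at c'
    simp [c']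

end

end PathMap

end GrayData

namespace GrayData

/-! ### Extension of a pseudofunctor along a category over `A` -/

namespace PathMap

/-- A functorial assignment of squares to the 1-cells of a category `P` over `A`, with globular
comparisons `cmp p` from the square at `p` to the value of `F` on `ev p`, compatible with the
cocycle of `F`. -/
structure Extension {A G : GrayData.{u}} [A.IsGray] [G.IsGray] {L R : GrayFunctor A G}
    (F : PathMap A G L R) (P : CatOver A) where
  val : P.C1 → G.Path1
  src_val : ∀ p, (val p).src = F.map0 (P.s0 p)
  tgt_val : ∀ p, (val p).tgt = F.map0 (P.t0 p)
  val_id1 : ∀ x, val (P.id1 x) = Path.id1 (F.map0 x)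
  val_comp1 : ∀ q p h, val (P.comp1 q p h) =
    Path.comp1 (val q) (val p) (by rw [src_val, tgt_val, h])
  cmp : P.C1 → G.Path2
  src_cmp : ∀ p, (cmp p).src = val p
  tgt_cmp : ∀ p, (cmp p).tgt = F.map1 (P.ev p)
  cmp_glob : ∀ p, (cmp p).IsGlobular
  cmp_comp1 : ∀ q p h, cmp (P.comp1 q p h) =
    Path.comp2 (F.coc (P.ev q) (P.ev p) (by simp [h]))
      (Path.comp2 (Path.wr2 (cmp q) (F.map1 (P.ev p)) (by simp [src_cmp, src_val, h]))
        (Path.wl2 (val q) (cmp p) (by simp [src_cmp, src_val, tgt_val, h]))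
        (by simp [src_cmp, tgt_cmp])) (by simp [src_cmp, tgt_cmp])

namespace Extension

variable {A G : GrayData.{u}} [A.IsGray] [G.IsGray] {L R : GrayFunctor A G}
  {F : PathMap A G L R} {P : CatOver A} (E : F.Extension P) (hG : G.IsGroupoid)

attribute [simp] src_val tgt_val src_cmp tgt_cmp val_id1 val_comp1

@[simp] lemma left_val (p : P.C1) : (E.val p).left = L.map1 (P.ev p) := by
  simpa using (E.cmp_glob p).tgt_left.symm

@[simp] lemma right_val (p : P.C1) : (E.val p).right = R.map1 (P.ev p) := by
  simpa using (E.cmp_glob p).tgt_right.symm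

/-- The value on a 2-cell of the Cartesian lift: the value on the underlying 2-cell of `A`,
conjugated by the comparisons. -/
noncomputable def map2 (a : P.Cell2) : G.Path2 :=
  Path.comp2 ((E.cmp a.tgt).globInv hG (E.cmp_glob _))
    (Path.comp2 (F.map2 a.val) (E.cmp a.src) (by simp)) (by simp)

@[simp] lemma src_map2 (a : P.Cell2) : (E.map2 hG a).src = E.val a.src := by simp [map2]

@[simp] lemma tgt_map2 (a : P.Cell2) : (E.map2 hG a).tgt = E.val a.tgt := by simp [map2]

@[simp] lemma left_map2 (a : P.Cell2) : (E.map2 hG a).left = L.map2 a.val := by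
  have h := (E.cmp_glob a.src).left_eq
  simp at h
  simp [map2, h]

@[simp] lemma right_map2 (a : P.Cell2) : (E.map2 hG a).right = R.map2 a.val := by
  have h := (E.cmp_glob a.src).right_eq
  simp at h
  simp [map2, h]

lemma map2_spec (a : P.Cell2) :
    Path.comp2 (E.cmp a.tgt) (E.map2 hG a) (by simp) =
      Path.comp2 (F.map2 a.val) (E.cmp a.src) (by simp) := by
  have e := Path.comp2_assoc (E.cmp a.tgt) ((E.cmp a.tgt).globInv hG (E.cmp_glob _))
    (Path.comp2 (F.map2 a.val) (E.cmp a.src) (by simp)) (by simp) (by simp)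
  rw [Path.comp2_congr (Path2.comp_globInv hG _ (E.cmp_glob _) _) rfl] at e
  simpa [map2] using e.symm

/-- The defining equation of the value on a 2-cell determines it. -/
lemma eq_map2 (a : P.Cell2) (X : G.Path2) (h)
    (e : Path.comp2 (E.cmp a.tgt) X h = Path.comp2 (F.map2 a.val) (E.cmp a.src) (by simp)) :
    E.map2 hG a = X :=
  (E.cmp_glob a.tgt).cancel hG (by simp) h ((E.map2_spec hG a).trans e.symm)

lemma map2_id2 (p : P.C1) : E.map2 hG (P.liftData.id2 p) = Path.id2 (E.val p) := by
  apply E.eq_map2 hG _ _ (by simp)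
  simp [F.map2_id2]

lemma map2_comp2 (b a : P.Cell2) (h : b.src = a.tgt) :
    E.map2 hG (P.liftData.comp2 b a h) =
      Path.comp2 (E.map2 hG b) (E.map2 hG a) (by simp [h]) := by
  have eb := Path.comp2_reassoc (E.map2_spec hG b) (E.map2 hG a) (by simp [h])
  have ea := E.map2_spec hG a
  apply E.eq_map2 hG _ _ (by simp)
  simp [F.map2_comp2, eb, h, ea]

/-- Whiskering of words is respected: the cocycle is natural, and the comparisons, being globular,
commute with the values on 2-cells. -/
lemma map2_wl2 (g : P.C1) (a : P.Cell2) (h : P.s0 g = P.t0 a.src) :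
    E.map2 hG (P.liftData.wl2 g a h) = Path.wl2 (E.val g) (E.map2 hG a) (by simp [h]) := by
  have ea := Path.wl2_congr (k := E.val g) (h := by simp [h]) (E.map2_spec hG a)
  have c := Path.comp2_reassoc (F.coc_wl2 (P.ev g) a.val (by simp [h]))
  have x := Path.comp2_reassoc ((E.cmp_glob g).exchange_left (a := F.map2 a.val) (by simp [h]))
  apply E.eq_map2 hG _ _ (by simp [h])
  simp at c x ea
  simp [cmp_comp1, c, ← x, h, ea]

lemma map2_wr2 (a : P.Cell2) (n : P.C1) (h : P.s0 a.src = P.t0 n) :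
    E.map2 hG (P.liftData.wr2 a n h) = Path.wr2 (E.map2 hG a) (E.val n) (by simp [h]) := by
  have ea := Path.comp2_reassoc (Path.wr2_congr (n := F.map1 (P.ev n)) (h := by simp [h])
    (E.map2_spec hG a) |>.trans (Path.wr2_comp2 _ _ _ _ _) |>.symm.trans (Path.wr2_comp2 _ _ _ _ _))
  have c := Path.comp2_reassoc (F.coc_wr2 a.val (P.ev n) (by simp [h]))
  have x := (E.cmp_glob n).exchange_right (b := E.map2 hG a) (by simp [h])
  apply E.eq_map2 hG _ _ (by simp [h])
  simp at c x ea
  simp [cmp_comp1, c, ← x, h, ea]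

/-- The value on a 3-cell of the Cartesian lift. -/
noncomputable def map3 (X : P.Cell3) : G.Path3 :=
  Path.vl3 ((E.cmp X.tgt).globInv hG (E.cmp_glob _))
    (Path.vr3 (F.map3 X.val) (E.cmp X.src) (by simp)) (by simp)

@[simp] lemma src_map3 (X : P.Cell3) : (E.map3 hG X).src = E.map2 hG (P.liftData.s2 X) := by
  simp [map3, map2]

@[simp] lemma tgt_map3 (X : P.Cell3) : (E.map3 hG X).tgt = E.map2 hG (P.liftData.t2 X) := by
  simp [map3, map2]

@[simp] lemma left_map3 (X : P.Cell3) : (E.map3 hG X).left = L.map3 X.val := by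
  have h := (E.cmp_glob X.src).left_eq
  simp at h
  simp [map3, h]

@[simp] lemma right_map3 (X : P.Cell3) : (E.map3 hG X).right = R.map3 X.val := by
  have h := (E.cmp_glob X.src).right_eq
  simp at h
  simp [map3, h]

/-- The strict Gray-functor on the Cartesian lift of `P`.  Its equations on 3-cells hold because
3-cells of the path space are determined by their boundary and their two sides. -/
noncomputable def functor : GrayFunctor P.liftData G.pathData where
  map0 := F.map0
  map1 := E.val
  map2 := E.map2 hG
  map3 := E.map3 hG
  s0_map1 := E.src_val
  t0_map1 := E.tgt_val
  s1_map2 := E.src_map2 hG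
  t1_map2 := E.tgt_map2 hG
  s2_map3 := E.src_map3 hG
  t2_map3 := E.tgt_map3 hG
  map1_id1 := E.val_id1
  map2_id2 := E.map2_id2 hG
  map3_id3 a := by
    apply Path3.ext
    · simp
    · simp
    · simp
    · simp
  map1_comp1 := E.val_comp1
  map2_comp2 := E.map2_comp2 hG
  map3_comp3 Y X h := by
    have h' := congrArg CatOver.Cell2.val h
    apply Path3.ext
    · simp
    · refine (E.tgt_map3 hG _).trans (congrArg (E.map2 hG) (P.liftData.t2_comp3 Y X h)) |>.trans ?_
      exact (E.tgt_map3 hG Y).symm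
    · simp
    · simp
  map2_wl2 := E.map2_wl2 hG
  map2_wr2 := E.map2_wr2 hG
  map3_wl3 g X h := by
    apply Path3.ext
    · refine (E.src_map3 hG _).trans
        ((congrArg (E.map2 hG) (P.liftData.s2_wl3 g X h)).trans (E.map2_wl2 hG _ _ _) |>.trans ?_)
      simp
    · refine (E.tgt_map3 hG _).trans
        ((congrArg (E.map2 hG) (P.liftData.t2_wl3 g X h)).trans (E.map2_wl2 hG _ _ _) |>.trans ?_)
      simp
    · simp
    · simp
  map3_wr3 X f h := by
    apply Path3.ext
    · refine (E.src_map3 hG _).trans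
        ((congrArg (E.map2 hG) (P.liftData.s2_wr3 X f h)).trans (E.map2_wr2 hG _ _ _) |>.trans ?_)
      simp
    · refine (E.tgt_map3 hG _).trans
        ((congrArg (E.map2 hG) (P.liftData.t2_wr3 X f h)).trans (E.map2_wr2 hG _ _ _) |>.trans ?_)
      simp
    · simp
    · simp
  map3_vl3 b X h := by
    apply Path3.ext
    · refine (E.src_map3 hG _).trans
        ((congrArg (E.map2 hG) (P.liftData.s2_vl3 b X h)).trans (E.map2_comp2 hG _ _ _) |>.trans ?_)
      simp
    · refine (E.tgt_map3 hG _).trans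
        ((congrArg (E.map2 hG) (P.liftData.t2_vl3 b X h)).trans (E.map2_comp2 hG _ _ _) |>.trans ?_)
      simp
    · simp
    · simp
  map3_vr3 X a h := by
    apply Path3.ext
    · refine (E.src_map3 hG _).trans
        ((congrArg (E.map2 hG) (P.liftData.s2_vr3 X a h)).trans (E.map2_comp2 hG _ _ _) |>.trans ?_)
      simp
    · refine (E.tgt_map3 hG _).trans
        ((congrArg (E.map2 hG) (P.liftData.t2_vr3 X a h)).trans (E.map2_comp2 hG _ _ _) |>.trans ?_)
      simp
    · simp
    · simp
  map3_tensor b a h := by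
    apply Path3.ext
    · refine (E.src_map3 hG _).trans
        ((congrArg (E.map2 hG) (P.liftData.s2_tensor b a h)).trans (E.map2_comp2 hG _ _ _) |>.trans
          ((Path.comp2_congr (E.map2_wr2 hG _ _ _) (E.map2_wl2 hG _ _ _)).trans ?_))
      simp
    · refine (E.tgt_map3 hG _).trans
        ((congrArg (E.map2 hG) (P.liftData.t2_tensor b a h)).trans (E.map2_comp2 hG _ _ _) |>.trans
          ((Path.comp2_congr (E.map2_wl2 hG _ _ _) (E.map2_wr2 hG _ _ _)).trans ?_))
      simp
    · simp
    · simp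

end Extension

end PathMap

end GrayData

namespace GrayData

/-! ### The `Q¹`-map presented by a pseudofunctor -/

namespace PathMap

/-- The extension of a `PathMap` to words. -/
noncomputable def wordExtension {A G : GrayData.{u}} (hA : A.IsGray) [G.IsGray]
    {L R : GrayFunctor A G} (F : PathMap A G L R) : F.Extension (wordCat hA) where
  val w := F.wordVal w.src w.cells w.tgt w.isPath
  src_val _ := F.src_wordVal _ _ _ _
  tgt_val _ := F.tgt_wordVal _ _ _ _
  val_id1 _ := rfl
  val_comp1 v w h := by
    obtain ⟨y, z, l, hl, hl'⟩ := v
    obtain ⟨x, y', m, hm, hm'⟩ := w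
    obtain rfl : y = y' := h
    exact F.wordVal_append hl hm
  cmp w := F.cmp w.src w.cells w.tgt w.isPath
  src_cmp _ := F.src_cmp _
  tgt_cmp _ := F.tgt_cmp _
  cmp_glob _ := F.cmp_glob _
  cmp_comp1 v w h := by
    obtain ⟨y, z, l, hl, hl'⟩ := v
    obtain ⟨x, y', m, hm, hm'⟩ := w
    obtain rfl : y = y' := h
    exact F.cmp_append hl hm

section

variable {A H : GrayCat.{u}} {L R : GrayFunctor A.toGrayData H.toGrayData}
  (F : PathMap A.toGrayData H.toGrayData L R) (hH : H.toGrayData.IsGroupoid)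

lemma wordExtension_val_single (f : A.toGrayData.C1) :
    (F.wordExtension A.isGray).val (single f) = F.map1 f := by
  by_cases h : A.toGrayData.IsId1 f
  · rw [GrayCat.single_of_id f h]
    conv_rhs => rw [h]
    exact (F.map1_id1 _).symm
  · rw [GrayCat.single_of_not_id f h]
    refine (F.wordVal_cons (A.toGrayData.s0 f) f [] (A.toGrayData.t0 f) ⟨rfl, rfl⟩).trans ?_
    exact Path.comp1_id _ _ _

/-- The comparison on a letter is an identity, by the unit law of the cocycle; hence the extension
has the prescribed values on letters. -/
lemma wordExtension_cmp_single (f : A.toGrayData.C1) :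
    (F.wordExtension A.isGray).cmp (single f) = Path.id2 (F.map1 f) := by
  by_cases h : A.toGrayData.IsId1 f
  · rw [GrayCat.single_of_id f h]
    conv_rhs => rw [h, F.map1_id1]
    rfl
  · rw [GrayCat.single_of_not_id f h]
    refine (F.cmp_cons (x := A.toGrayData.s0 f) (l := []) f ⟨rfl, rfl⟩).trans ?_
    have e : F.cmp (A.toGrayData.s0 f) [] (A.toGrayData.s0 f) rfl =
      Path.id2 (Path.id1 (F.map0 (A.toGrayData.s0 f))) := rfl
    have c := F.coc_id f (by simp)
    simp [evList, c, e]

/-- The `Q¹`-map presented by a `PathMap`. -/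
noncomputable def toHom : A.pseudo ⟶ H.path.pseudo :=
  ⟨(F.wordExtension A.isGray).functor hH⟩

lemma toHom_map0 (x : A.toGrayData.C0) : (GrayCat.under (F.toHom hH)).map0 x = F.map0 x := rfl

lemma toHom_map1 (f : A.toGrayData.C1) :
    (GrayCat.under (F.toHom hH)).map1 (single f) = F.map1 f :=
  F.wordExtension_val_single f

lemma toHom_map2 (a : A.toGrayData.C2) :
    (GrayCat.under (F.toHom hH)).map2 (GrayCat.word2 a) = F.map2 a := by
  have e := F.wordExtension_cmp_single (A.toGrayData.s1 a)
  have e' := F.wordExtension_cmp_single (A.toGrayData.t1 a)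
  refine (F.wordExtension A.isGray).eq_map2 hH (GrayCat.word2 a) (F.map2 a) ?_ ?_
  · simp [GrayCat.word2, wordExtension_val_single]
  · simp [GrayCat.word2, e, e']

lemma toHom_map3 (X : A.toGrayData.C3) :
    (GrayCat.under (F.toHom hH)).map3 (GrayCat.word3 X) = F.map3 X := by
  have e := F.toHom_map2 hH (A.toGrayData.s2 X)
  have e' := F.toHom_map2 hH (A.toGrayData.t2 X)
  apply Path3.ext
  · refine ((F.wordExtension A.isGray).src_map3 hH _).trans (Eq.trans ?_ e |>.trans (by simp))
    rfl
  · refine ((F.wordExtension A.isGray).tgt_map3 hH _).trans (Eq.trans ?_ e' |>.trans (by simp))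
    refine congrArg ((F.wordExtension A.isGray).map2 hH) ?_
    apply CatOver.Cell2.ext
    · exact congrArg single (A.toGrayData.s1_t2 X).symm
    · exact congrArg single (A.toGrayData.t1_t2 X).symm
    · rfl
  · exact ((F.wordExtension A.isGray).left_map3 hH _).trans (by simp [GrayCat.word3])
  · exact ((F.wordExtension A.isGray).right_map3 hH _).trans (by simp [GrayCat.word3])

/-- The 2-cocycle of the `Q¹`-map is the cocycle of its presentation: the defining equation of the
value at `κ` compares the composites over the words `[g, f]` and `[g #₀ f]`. -/
lemma toHom_kappa (g f : A.toGrayData.C1) (h) :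
    (GrayCat.under (F.toHom hH)).map2 (GrayCat.kappa g f h) = F.coc g f h := by
  have h' : (wordCat A.isGray).s0 (single g) = (wordCat A.isGray).t0 (single f) :=
    (GrayCat.src_single g).trans (h.trans (GrayCat.tgt_single f).symm)
  have ef := F.wordExtension_cmp_single f
  have eg := F.wordExtension_cmp_single g
  have e := F.wordExtension_cmp_single (A.toGrayData.comp1 g f h)
  have vg := F.wordExtension_val_single g
  have E := (F.wordExtension A.isGray).cmp_comp1 (single g) (single f) h'
  have c := fun (g' f' : A.toGrayData.C1) h' (e : g' = g) (e' : f' = f) =>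
    (by subst e e'; rfl : F.coc g' f' h' = F.coc g f h)
  have c' := c _ _ (by rw [GrayCat.ev_single, GrayCat.ev_single, h]) (GrayCat.ev_single g)
    (GrayCat.ev_single f)
  have vf : F.map1 ((wordCat A.isGray).ev (single f)) = F.map1 f :=
    congrArg F.map1 (GrayCat.ev_single f)
  refine (F.wordExtension A.isGray).eq_map2 hH (GrayCat.kappa g f h) (F.coc g f h) ?_ ?_
  · simp [GrayCat.kappa, wordExtension_val_single]
  · refine Eq.trans (Path.comp2_congr e rfl) ?_
    refine Eq.trans ?_ (Path.comp2_congr (F.map2_id2 _) E).symm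
    simp only [c', ef, eg, vg, vf]
    simp

end

end PathMap

end GrayData

namespace GrayData

namespace Path

variable {G : GrayData.{u}} [G.IsGray]

/-! ### Vertical pasting -/

lemma vcomp1_id1 (g f : G.C1) (h : G.s0 g = G.t0 f) (h') :
    vcomp1 (id1 g) (id1 f) h' = id1 (G.comp1 g f h) := by
  apply Path1.ext <;> simp

lemma vcomp2_id2 (q p : G.Path1) (h : q.left = p.right) (h') :
    vcomp2 (id2 q) (id2 p) h' = id2 (vcomp1 q p h) := by
  apply Path2.ext <;> simp

lemma vcomp2_comp2 (b' b a' a : G.Path2) (hb : b'.src = b.tgt) (ha : a'.src = a.tgt)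
    (h' : b'.left = a'.right) (h : b.left = a.right) (h'') :
    vcomp2 (comp2 b' b hb) (comp2 a' a ha) h'' =
      comp2 (vcomp2 b' a' h') (vcomp2 b a h) (by simp [ha, hb]) := by
  apply Path2.ext
  · simp
  · simp
  · simp
  · simp
  · simp [hb, ha]
    -- the 3-cells of `a'` and `b` have to change places
    have i := IsGray.interchange (G.wl3 b.src.tgt a'.cell (by simp [vs0' b a h, ha]))
      (G.wr3 b.cell a.src.src (by simp [vs0 b a h])) (by simp [h, ha, vside' b a h])
    simp [ha] at i
    have i' := comp3_reassoc i
    simp [i', h, h']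

lemma vcompCocycle_glob (q' p' q p : G.Path1) (hq hp h' h) :
    (vcompCocycle q' p' q p hq hp h' h).IsGlobular := ⟨rfl, rfl⟩

lemma vcompCocycle_id (q' p' : G.Path1) (g f : G.C1) (hq hp h' h) :
    vcompCocycle q' p' (id1 g) (id1 f) hq hp h' h = id2 (vcomp1 q' p' h') := by
  have e : q'.src = g := hq
  have e' : p'.src = f := hp
  have k : G.s0 q'.src = G.t0 p'.src := by rw [← q'.s0_left, h', p'.s0_right]
  apply Path2.ext
  · simp [← e, ← e', vcomp1_id1, k]
  · simp [← e, ← e']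
  · simp [← e, ← e']
  · simp [← e, ← e']
  · simp [← e, ← e']

lemma id_vcompCocycle (q p : G.Path1) (g f : G.C1) (hq hp h' h) :
    vcompCocycle (id1 g) (id1 f) q p hq hp h' h = id2 (vcomp1 q p h) := by
  have e : g = q.tgt := hq
  have e' : f = p.tgt := hp
  have k : G.s0 q.tgt = G.t0 p.tgt := by rw [← q.t0_left, h, p.t0_right]
  apply Path2.ext
  · simp [e, e', vcomp1_id1, k]
  · simp [e, e']
  · simp [e, e']
  · simp [e, e']
  · simp [e, e']

/-- The cocycle condition for vertical pasting.  Once tensors of composites are expanded, the two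
sides differ by one interchange of the tensors `q'' ⊗ p'` and `q' ⊗ p`. -/
lemma vcompCocycle_assoc (q'' p'' q' p' q p : G.Path1) (hq' hp' hq hp) (h'' : q''.left = p''.right)
    (h' : q'.left = p'.right) (h : q.left = p.right) (h1 h2 h3 h4 h5 h6 h7 h8 h9 h10) :
    comp2 (vcompCocycle (comp1 q'' q' hq') (comp1 p'' p' hp') q p h1 h2 h3 h)
      (wr2 (vcompCocycle q'' p'' q' p' hq' hp' h'' h') (vcomp1 q p h) h4) h5 =
    comp2 (vcompCocycle q'' p'' (comp1 q' q hq) (comp1 p' p hp) h6 h7 h'' h8)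
      (wl2 (vcomp1 q'' p'' h'') (vcompCocycle q' p' q p hq hp h' h) h9) h10 := by
  have e : G.s0 q.src = G.t0 p.src := by rw [← q.s0_left, h, p.s0_right]
  have e' : G.s0 q.tgt = G.t0 p.tgt := by rw [← q.t0_left, h, p.t0_right]
  have f' : G.s0 q'.tgt = G.t0 p'.tgt := by rw [← q'.t0_left, h', p'.t0_right]
  have f'' : G.s0 q''.tgt = G.t0 p''.tgt := by rw [← q''.t0_left, h'', p''.t0_right]
  apply Path2.ext
  · simp [h, h', h'']
  · simp [h, h', h'']
  · simp [hp, hp', hq, hq']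
  · simp [hp, hp', hq, hq']
  · simp [hq, hp, hq', hp', h, h', h'', IsGray.comp2_tensor, IsGray.tensor_comp2]
    -- incidence proofs are sealed as auxiliary lemmas, which keeps the terms small
    have i := IsGray.interchange
        (G.wr3 (G.tensor q''.sq p'.sq (by as_aux_lemma => simp [hq', f'])) p.left
          (by as_aux_lemma => simp [hp]))
        (G.wl3 q''.right (G.tensor q'.sq p.sq (by as_aux_lemma => simp [hq, e']))
          (by as_aux_lemma => simp [hq']))
        (by as_aux_lemma => simp [hq, hq', hp, hp', h, h', h''])
    replace i := vr3_congr (a := G.wl2 q''.right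
      (G.wl2 q'.right (G.wr2 q.sq p.src (by as_aux_lemma => simp [e]))
        (by as_aux_lemma => simp [hq])) (by as_aux_lemma => simp [hq']))
          (h := by as_aux_lemma => simp [h'', h', h, hq', hp', hq, hp]) i
    replace i := vl3_congr (b := G.wl2 q''.tgt
      (G.wr2 (G.wr2 p''.sq p'.left (by as_aux_lemma => simp [hp'])) p.left
        (by as_aux_lemma => simp [hp])) (by as_aux_lemma => simp [f'']))
          (h := by as_aux_lemma => simp [h'', h', h, hq', hp', hq, hp]) i
    simp [hq, hp, hq', hp', h, h', h''] at i
    simp [i]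

end Path

end GrayData

namespace GrayData

namespace Path

variable {G : GrayData.{u}} [G.IsGray]

/-- Naturality of `c ⊗ -` at the 3-cell filling a 2-cell `a` of the path space, with the tensors of
`c` and the two sides of `a` moved across the equation as inverses. -/
lemma tensor_natural_cell (c : G.C2) (a : G.Path2) (h : G.s0 (G.s1 c) = G.t0 a.src.tgt) :
    G.comp3 (G.vr3 (G.tensor c a.tgt.sq (by as_aux_lemma => simp [h]))
        (G.wl2 (G.s1 c) (G.wr2 a.right a.src.src (by as_aux_lemma => simp))
          (by as_aux_lemma => simp [h])) (by as_aux_lemma => simp))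
      (G.comp3 (G.vl3 (G.wr2 c (G.comp1 a.src.tgt a.tgt.left (by as_aux_lemma => simp))
        (by as_aux_lemma => simp [h]))
          (G.wl3 (G.s1 c) a.cell (by as_aux_lemma => simp [h])) (by as_aux_lemma => simp))
        (G.vr3 (tinv c (G.wl2 a.src.tgt a.left (by as_aux_lemma => simp))
          (by as_aux_lemma => simp [h]))
          (G.wl2 (G.s1 c) a.src.sq (by as_aux_lemma => simp [h])) (by as_aux_lemma => simp))
            (by as_aux_lemma => simp)) (by as_aux_lemma => simp) =
    G.comp3 (G.vl3 (G.wl2 (G.t1 c) a.tgt.sq (by as_aux_lemma => simp [h]))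
        (tinv c (G.wr2 a.right a.src.src (by as_aux_lemma => simp)) (by as_aux_lemma => simp [h]))
          (by as_aux_lemma => simp))
      (G.comp3 (G.vr3 (G.wl3 (G.t1 c) a.cell (by as_aux_lemma => simp [h]))
          (G.wr2 c (G.comp1 a.src.right a.src.src (by as_aux_lemma => simp))
            (by as_aux_lemma => simp [h])) (by as_aux_lemma => simp))
        (G.vl3 (G.wl2 (G.t1 c) (G.wl2 a.src.tgt a.left (by as_aux_lemma => simp))
          (by as_aux_lemma => simp [h]))
          (G.tensor c a.src.sq (by as_aux_lemma => simp [h])) (by as_aux_lemma => simp))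
            (by as_aux_lemma => simp)) (by as_aux_lemma => simp) := by
  have N := IsGray.tensor_natural_right c a.cell (by as_aux_lemma => simp [h])
  have m := comp3_inv_move
    (X := G.comp3 (G.vr3 (G.tensor c a.tgt.sq (by as_aux_lemma => simp [h]))
        (G.wl2 (G.s1 c) (G.wr2 a.right a.src.src (by as_aux_lemma => simp))
          (by as_aux_lemma => simp [h])) (by as_aux_lemma => simp))
      (G.vl3 (G.wr2 c (G.comp1 a.src.tgt a.tgt.left (by as_aux_lemma => simp))
        (by as_aux_lemma => simp [h]))
          (G.wl3 (G.s1 c) a.cell (by as_aux_lemma => simp [h])) (by as_aux_lemma => simp))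
            (by as_aux_lemma => simp))
    (Y := G.comp3 (G.vr3 (G.wl3 (G.t1 c) a.cell (by as_aux_lemma => simp [h]))
          (G.wr2 c (G.comp1 a.src.right a.src.src (by as_aux_lemma => simp))
            (by as_aux_lemma => simp [h])) (by as_aux_lemma => simp))
        (G.vl3 (G.wl2 (G.t1 c) (G.wl2 a.src.tgt a.left (by as_aux_lemma => simp))
          (by as_aux_lemma => simp [h]))
          (G.tensor c a.src.sq (by as_aux_lemma => simp [h])) (by as_aux_lemma => simp))
            (by as_aux_lemma => simp))
    ((tinv_spec c (G.wr2 a.right a.src.src (by as_aux_lemma => simp))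
      (by as_aux_lemma => simp [h])).vl3
      (G.wl2 (G.t1 c) a.tgt.sq (by as_aux_lemma => simp [h])) (by as_aux_lemma => simp)
        (by as_aux_lemma => simp))
    ((tinv_spec c (G.wl2 a.src.tgt a.left (by as_aux_lemma => simp))
      (by as_aux_lemma => simp [h])).vr3
      (G.wl2 (G.s1 c) a.src.sq (by as_aux_lemma => simp [h])) (by as_aux_lemma => simp)
        (by as_aux_lemma => simp))
    (h := by as_aux_lemma => simp) (h' := by as_aux_lemma => simp)
    (by simpa [IsGray.tensor_comp2] using N) (by as_aux_lemma => simp) (by as_aux_lemma => simp)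
  simpa using m

/-- Naturality of the cocycle of vertical pasting with respect to whiskering on the left. -/
lemma vcompCocycle_wl2 (q p : G.Path1) (b a : G.Path2) (hq : q.src = b.src.tgt)
    (hp : p.src = a.src.tgt) (h' : q.left = p.right) (h : b.left = a.right) (h1 h2 h3 h4 h5 h6
    h8 h9) :
    comp2 (vcomp2 (wl2 q b hq) (wl2 p a hp) h1) (vcompCocycle q p b.src a.src hq hp h' h2) h3 =
      comp2 (vcompCocycle q p b.tgt a.tgt h4 h5 h' h6)
        (wl2 (vcomp1 q p h') (vcomp2 b a h) h8) h9 := by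
  have e := vs0 b a h
  have e' := vs0' b a h
  have k := vside b a h
  have k' := vside' b a h
  have f : G.s0 q.src = G.t0 p.src := by rw [← q.s0_left, h', p.s0_right]
  have f' : G.s0 q.tgt = G.t0 p.tgt := by rw [← q.t0_left, h', p.t0_right]
  apply Path2.ext
  · simp [hq, hp, h', h, k, k']
  · simp [hq, hp, h', h, k, k']
  · simp [hq, hp, h', h, k, k']
  · simp [hq, hp, h', h, k, k']
  · simp [hq, hp, h', h, k, k', comp2_tinv, tinv_comp2]
    -- the three relations: two interchanges, and naturality of `q.sq ⊗ -` at the 3-cell of `a`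
    have i := IsGray.interchange (G.tensor q.sq a.tgt.sq (by as_aux_lemma => simp [hq, e']))
      (G.wl3 q.right (G.wr3 b.cell a.src.src (by as_aux_lemma => simp [e]))
        (by as_aux_lemma => simp [hq]))
      (by as_aux_lemma => simp [hq, h, k'])
    replace i := vl3_congr (b := G.wl2 q.tgt (G.wr2 p.sq a.tgt.left (by as_aux_lemma => simp [hp]))
      (by as_aux_lemma => simp [f']))
      (h := by as_aux_lemma => simp [hq, hp, h', h, k, k']) i
    have j := IsGray.interchange (G.wl3 q.tgt (tinv p.sq a.left (by as_aux_lemma => simp [hp]))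
      (by as_aux_lemma => simp [f']))
      (G.vr3 (G.tensor q.sq a.src.sq (by as_aux_lemma => simp [hq, e']))
        (G.wl2 q.right (G.wr2 b.src.sq a.src.src (by as_aux_lemma => simp [e]))
          (by as_aux_lemma => simp [hq]))
        (by as_aux_lemma => simp [hq, k])) (by as_aux_lemma => simp [hq, hp, h'])
    have n := tensor_natural_cell q.sq a (by as_aux_lemma => simp [hq, e'])
    replace n := vr3_congr (a := G.wl2 q.right
      (G.wr2 b.src.sq a.src.src (by as_aux_lemma => simp [e]))
      (by as_aux_lemma => simp [hq])) (h := by as_aux_lemma => simp [hq, h', h, k]) n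
    replace n := vl3_congr (b := G.wl2 q.tgt (G.wr2 p.sq a.tgt.left (by as_aux_lemma => simp [hp]))
      (by as_aux_lemma => simp [f']))
      (h := by as_aux_lemma => simp [hq, hp, h', h, k, k']) n
    simp [hq, hp, h', h, k, k'] at i j n
    have i' := comp3_reassoc i
    have n' := comp3_reassoc n
    simp at n'
    simp [hq, hp, h', h, k, k', j, i', n']

end Path

end GrayData

namespace GrayData

namespace Path

variable {G : GrayData.{u}} [G.IsGray]

/-- Naturality of the cocycle of vertical pasting with respect to whiskering on the right. -/
lemma vcompCocycle_wr2 (b a : G.Path2) (q p : G.Path1) (hq : b.src.src = q.tgt)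
    (hp : a.src.src = p.tgt) (h' : b.left = a.right) (h : q.left = p.right) (h1 h2 h3 h4 h5 h6
    h7 h8 h9) :
    comp2 (vcomp2 (wr2 b q hq) (wr2 a p hp) h1) (vcompCocycle b.src a.src q p h2 h3 h4 h) h5 =
      comp2 (vcompCocycle b.tgt a.tgt q p h6 h7 h8 h)
        (wr2 (vcomp2 b a h') (vcomp1 q p h) (by simp [hq, hp])) h9 := by
  have e : G.s0 q.src = G.t0 p.src := by rw [← q.s0_left, h, p.s0_right]
  have e' : G.s0 q.tgt = G.t0 p.tgt := by rw [← q.t0_left, h, p.t0_right]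
  have k := vside b a h'
  have k' := vside' b a h'
  have f := vs0 b a h'
  have f' := vs0' b a h'
  apply Path2.ext
  · simp [hq, hp, h', h, k, k']
  · simp [hq, hp, h', h, k, k']
  · simp [hq, hp, h', h, k, k']
  · simp [hq, hp, h', h, k, k']
  · simp [hq, hp, h', h, k, k', IsGray.comp2_tensor, IsGray.tensor_comp2]
    -- the three relations: two interchanges, and naturality of `- ⊗ p.sq` at the 3-cell of `b`
    have i := IsGray.interchange (G.tensor b.tgt.sq p.sq (by as_aux_lemma => simp [hq, e']))
      (G.wr3 (G.tensor b.right q.sq (by as_aux_lemma => simp [hq])) p.src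
        (by as_aux_lemma => simp [e])) (by as_aux_lemma => simp [hq, h])
    replace i := vl3_congr (b := G.wl2 b.src.tgt (G.wr2 a.tgt.sq p.left
      (by as_aux_lemma => simp [hp])) (by as_aux_lemma => simp [f']))
      (h := by as_aux_lemma => simp [hq, hp, h', h, k, k']) i
    have j := IsGray.interchange (G.wl3 b.src.tgt (G.wr3 a.cell p.left
        (by as_aux_lemma => simp [hp])) (by as_aux_lemma => simp [f']))
      (G.vr3 (G.tensor b.src.sq p.sq (by as_aux_lemma => simp [hq, e']))
        (G.wl2 b.src.right (G.wr2 q.sq p.src (by as_aux_lemma => simp [e]))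
          (by as_aux_lemma => simp [hq])) (by as_aux_lemma => simp [hq, h]))
      (by as_aux_lemma => simp [hq, hp, h', k])
    have n := IsGray.tensor_natural_left b.cell p.sq (by as_aux_lemma => simp [hq, e'])
    simp only [Path2.s2_cell, Path2.t2_cell, IsGray.comp2_tensor] at n
    replace n := vr3_congr (a := G.wl2 b.src.right (G.wr2 q.sq p.src (by as_aux_lemma => simp [e]))
      (by as_aux_lemma => simp [hq])) (h := by as_aux_lemma => simp [hq, h', h, k]) n
    replace n := vl3_congr (b := G.wl2 b.src.tgt (G.wr2 a.tgt.sq p.left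
      (by as_aux_lemma => simp [hp])) (by as_aux_lemma => simp [f']))
      (h := by as_aux_lemma => simp [hq, hp, h', h, k, k']) n
    simp [hq, hp, h', h, k, k'] at i j n
    have i' := comp3_reassoc i
    have n' := comp3_reassoc n
    simp at n'
    simp [hq, hp, h', h, k, k', j, i', n']

end Path

end GrayData

namespace GrayData

/-! ### Vertical inversion -/

section

variable {G : GrayData.{u}} (hG : G.IsGroupoid) [G.IsGray]

@[simp] lemma inv2_id2 (f : G.C1) : inv2 hG (G.id2 f) = G.id2 f :=
  (inv2_spec hG _).unique ⟨by simp, by simp, by simp, by simp⟩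

@[simp] lemma inv3_vl3 (b : G.C2) (A : G.C3) (h) :
    inv3 hG (G.vl3 b A h) = G.vl3 b (inv3 hG A) (by simpa using h) :=
  (inv3_spec hG _).unique ((inv3_spec hG A).vl3 b h _)

@[simp] lemma inv3_vr3 (A : G.C3) (a : G.C2) (h) :
    inv3 hG (G.vr3 A a h) = G.vr3 (inv3 hG A) a (by simpa using h) :=
  (inv3_spec hG _).unique ((inv3_spec hG A).vr3 a h _)

@[simp] lemma inv3_wl3 (g : G.C1) (A : G.C3) (h) :
    inv3 hG (G.wl3 g A h) = G.wl3 g (inv3 hG A) (by simpa using h) :=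
  (inv3_spec hG _).unique ((inv3_spec hG A).wl3 g h _)

@[simp] lemma inv3_wr3 (A : G.C3) (f : G.C1) (h) :
    inv3 hG (G.wr3 A f h) = G.wr3 (inv3 hG A) f (by simpa using h) :=
  (inv3_spec hG _).unique ((inv3_spec hG A).wr3 f h _)

@[simp] lemma inv3_comp3 (B A : G.C3) (h) :
    inv3 hG (G.comp3 B A h) = G.comp3 (inv3 hG A) (inv3 hG B) (by simp [h]) :=
  (inv3_spec hG _).unique ((inv3_spec hG A).comp3 (inv3_spec hG B) h _)

@[simp] lemma inv3_id3 (a : G.C2) : inv3 hG (G.id3 a) = G.id3 a :=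
  (inv3_spec hG _).unique (isInv3_id3 a)

@[simp] lemma inv3_tensor (b a : G.C2) (h) : inv3 hG (G.tensor b a h) = tinv b a h :=
  (inv3_spec hG _).unique (tinv_spec b a h)

@[simp] lemma inv3_tinv (b a : G.C2) (h) : inv3 hG (tinv b a h) = G.tensor b a h :=
  (inv3_spec hG _).unique (tinv_spec b a h).symm

@[simp] lemma wl3_inv1 (g : G.C1) (A : G.C3) (h h') :
    G.wl3 g (G.wl3 (inv1 hG g) A h) h' = A := by
  rw [← IsGray.wl3_comp1 (kg := by simp) (hA := by simpa using h)]
  simp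

@[simp] lemma inv1_wr3 (g : G.C1) (A : G.C3) (h h') :
    G.wr3 (G.wr3 A (inv1 hG g) h) g h' = A := by
  rw [← IsGray.wr3_comp1 (gf := by simp) (hA := by simpa using h)]
  simp

lemma isInv2_inv2 (a : G.C2) : G.IsInv2 (inv2 hG a) a :=
  have ⟨h₁, h₂, _, _⟩ := inv2_spec hG a
  ⟨h₂, h₁, by simp, by simp⟩

end

section

variable {G : GrayData.{u}} [G.IsGray]

@[simp] lemma tensor_wl2_wr2 (b : G.C2) (k : G.C1) (a : G.C2) (f : G.C1) (h h' h'') :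
    G.tensor b (G.wl2 k (G.wr2 a f h) h') h'' =
      G.wr3 (G.tensor b (G.wl2 k a (by simpa using h')) (by simpa using h'')) f
        (by simpa using h) := by
  rw [← IsGray.tensor_wr2 (af := by simpa using h) (h := by simpa using h'')]
  simp

lemma IsInv2.wl2 {a b : G.C2} (H : G.IsInv2 a b) (g : G.C1) (h h') :
    G.IsInv2 (G.wl2 g a h) (G.wl2 g b h') := by
  obtain ⟨h₁, h₂, e₁, e₂⟩ := H
  refine ⟨by simp [h₁], by simp [h₂], ?_, ?_⟩
  · rw [← IsGray.wl2_comp2 (ba := h₁) (h := by simpa [h₂] using h)]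
    simp [e₁]
  · rw [← IsGray.wl2_comp2 (ba := h₂) (h := by simpa [h₂] using h')]
    simp [e₂]

lemma IsInv2.wr2 {a b : G.C2} (H : G.IsInv2 a b) (f : G.C1) (h h') :
    G.IsInv2 (G.wr2 a f h) (G.wr2 b f h') := by
  obtain ⟨h₁, h₂, e₁, e₂⟩ := H
  refine ⟨by simp [h₁], by simp [h₂], ?_, ?_⟩
  · rw [← IsGray.wr2_comp2 (ba := h₁) (h := by simpa [h₂] using h)]
    simp [e₁]
  · rw [← IsGray.wr2_comp2 (ba := h₂) (h := by simpa [h₂] using h')]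
    simp [e₂]

lemma IsInv2.comp2_cancel {a b : G.C2} (H : G.IsInv2 b a) (c : G.C2) (h h') :
    G.comp2 a (G.comp2 b c h) h' = c := by
  obtain ⟨h₁, h₂, e₁, e₂⟩ := H
  rw [← IsGray.comp2_assoc (cb := h₁) (ha := by simpa using h)]
  simp [e₁]

lemma IsInv2.vl3_cancel {a b : G.C2} (H : G.IsInv2 b a) (A : G.C3) (h h') :
    G.vl3 a (G.vl3 b A h) h' = A := by
  obtain ⟨h₁, h₂, e₁, e₂⟩ := H
  rw [← IsGray.vl3_comp2 (cb := h₁) (hA := by simpa using h)]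
  simp [e₁]

lemma IsInv2.vr3_cancel {a b : G.C2} (H : G.IsInv2 b a) (A : G.C3) (h h') :
    G.vr3 (G.vr3 A a h) b h' = A := by
  obtain ⟨h₁, h₂, e₁, e₂⟩ := H
  rw [← IsGray.vr3_comp2 (ba := h₁) (hA := by simpa using h)]
  simp [e₁]

lemma IsInv3.eq_of_comp3_left {A B X : G.C3} (H : G.IsInv3 A B) (h) {x : G.C2}
    (e : G.comp3 A X h = G.id3 x) : X = B := by
  obtain ⟨h₁, h₂, e₁, e₂⟩ := H
  have hx : G.s2 X = x := by simpa using congrArg G.s2 e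
  have hy : G.t2 A = x := by simpa using congrArg G.t2 e
  have m := comp3_congr (A := B) (B := G.comp3 A X h) (h := by simp [h₁]) rfl e
  rw [← IsGray.comp3_assoc (CB := h₁) (hA := by simpa using h), comp3_congr e₁ rfl] at m
  simpa [h, ← hy, ← h₁] using m

/-- Tensoring with the inverse of a 2-cell inverts the tensor, up to whiskering: first variable. -/
lemma vl3_tensor_inv2 (hG : G.IsGroupoid) (c a : G.C2) (h h1 h2 h3 h4 h5) :
    G.vl3 (G.wr2 (inv2 hG c) (G.t1 a) h1)
      (G.vr3 (G.tensor c a h) (G.wr2 (inv2 hG c) (G.s1 a) h2) h3) h4 = tinv (inv2 hG c) a h5 := by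
  have e := IsGray.comp2_tensor (inv2 hG c) c a (by as_aux_lemma => simp)
    (by as_aux_lemma => simpa using h)
  have e' := vr3_congr (a := G.wr2 (inv2 hG c) (G.s1 a) h2) (h := by as_aux_lemma => simp) e
  -- the side conditions of the cancellation lemmas nest deeper than the default bound
  simp (maxDischargeDepth := 6) [IsInv2.vr3_cancel, IsInv2.wr2, inv2_spec, isInv2_inv2] at e'
  exact (tinv_spec (inv2 hG c) a h5).eq_of_comp3_left _ e'.symm

/-- Tensoring with the inverse of a 2-cell inverts the tensor, up to whiskering: second
variable. -/
lemma vl3_tinv_inv2 (hG : G.IsGroupoid) (b c : G.C2) (h h1 h2 h3 h4 h5) :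
    G.vl3 (G.wl2 (G.t1 b) (inv2 hG c) h1)
      (G.vr3 (tinv b c h) (G.wl2 (G.s1 b) (inv2 hG c) h2) h3) h4 = G.tensor b (inv2 hG c) h5 := by
  have e := IsGray.tensor_comp2 b (inv2 hG c) c (by as_aux_lemma => simp)
    (by as_aux_lemma => simpa using h)
  have e' := vr3_congr (a := G.wl2 (G.s1 b) (inv2 hG c) h2) (h := by as_aux_lemma => simp) e
  simp (maxDischargeDepth := 6) [IsInv2.vr3_cancel, IsInv2.wl2, inv2_spec, isInv2_inv2] at e'
  have H := (((tinv_spec b c h).vr3 _ (by simp) h3).vl3 _ (by simp) h4)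
  exact (H.eq_of_comp3_left _ e'.symm).symm

end

namespace Path

variable {G : GrayData.{u}} (hG : G.IsGroupoid) [G.IsGray]

lemma opp1_id1 (f : G.C1) : opp1 hG (id1 f) = id1 (inv1 hG f) := by
  apply Path1.ext <;> simp

lemma opp2_id2 (g : G.Path1) : opp2 hG (id2 g) = id2 (opp1 hG g) := by
  apply Path2.ext <;> simp

/-- Vertical inversion preserves composition of 2-cells: after cancelling the inverse squares
between the two 3-cells, an interchange remains. -/
lemma opp2_comp2 (b a : G.Path2) (h : b.src = a.tgt) :
    opp2 hG (comp2 b a h) = comp2 (opp2 hG b) (opp2 hG a) (by simp [h]) := by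
  apply Path2.ext
  · simp
  · simp
  · simp
  · simp
  · have i := IsGray.interchange
      (G.wl3 (inv1 hG b.src.tgt) (G.wr3 (G.vl3 (inv2 hG b.tgt.sq) (inv3 hG b.cell)
        (by as_aux_lemma => simp)) (inv1 hG b.src.src) (by as_aux_lemma => simp))
        (by as_aux_lemma => simp))
      (G.wl3 (inv1 hG a.src.tgt) (G.wr3 (G.vl3 (inv2 hG a.tgt.sq) (G.vr3 (inv3 hG a.cell)
        (inv2 hG a.src.sq) (by as_aux_lemma => simp)) (by as_aux_lemma => simp))
        (inv1 hG a.src.src) (by as_aux_lemma => simp)) (by as_aux_lemma => simp))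
      (by as_aux_lemma => simp [h])
    simp (maxDischargeDepth := 6) [h, IsInv2.vl3_cancel, IsInv2.vr3_cancel, IsInv2.wl2,
      IsInv2.wr2, inv2_spec, isInv2_inv2] at i
    simp [h, i]

lemma oppCocycle_glob (k g : G.Path1) (h : k.src = g.tgt) :
    (oppCocycle hG k g h).IsGlobular := ⟨rfl, rfl⟩

lemma oppCocycle_id (k : G.Path1) (f : G.C1) (h) :
    oppCocycle hG k (id1 f) h = id2 (opp1 hG k) := by
  have e : k.src = f := h
  apply Path2.ext <;> simp [← e, opp1_id1]

lemma id_oppCocycle (g : G.Path1) (f : G.C1) (h) :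
    oppCocycle hG (id1 f) g h = id2 (opp1 hG g) := by
  have e : f = g.tgt := h
  apply Path2.ext <;> simp [e, opp1_id1]

/-- The cocycle condition for vertical inversion is naturality of `k₂⁻¹ ⊗ -` at the 3-cell
`g₂⁻¹ ⊗ f₂⁻¹`. -/
lemma oppCocycle_assoc (k g f : G.Path1) (hkg : k.src = g.tgt) (hgf : g.src = f.tgt) (h1 h2 h3 h4
    h5 h6) :
    comp2 (oppCocycle hG (comp1 k g hkg) f h1) (wr2 (oppCocycle hG k g hkg) (opp1 hG f) h2) h3 =
      comp2 (oppCocycle hG k (comp1 g f hgf) h4) (wl2 (opp1 hG k) (oppCocycle hG g f hgf) h5)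
        h6 := by
  apply Path2.ext
  · simp
  · simp
  · simp [hkg, hgf]
  · simp [hkg, hgf]
  · have n := IsGray.tensor_natural_right (inv2 hG k.sq)
      (G.wl3 (inv1 hG g.tgt) (G.tensor (inv2 hG g.sq) (G.wl2 (inv1 hG f.tgt) (inv2 hG f.sq)
        (by as_aux_lemma => simp)) (by as_aux_lemma => simp [hgf]))
        (by as_aux_lemma => simp)) (by as_aux_lemma => simp [hkg])
    have m := wl3_congr (g := inv1 hG k.tgt) (h := by as_aux_lemma => simp [hkg])
      (wr3_congr (f := inv1 hG f.src) (h := by as_aux_lemma => simp [hkg]) n)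
    simp [hkg, hgf, IsGray.comp2_tensor, IsGray.tensor_comp2, IsGray.tensor_wr2] at m
    simp [hkg, hgf, IsGray.comp2_tensor, IsGray.tensor_comp2]
    exact m.symm

/-- Naturality of the cocycle of vertical inversion with respect to whiskering on the left. -/
lemma oppCocycle_wl2 (k : G.Path1) (a : G.Path2) (h : k.src = a.src.tgt) (h1 h2 h4 h5) :
    comp2 (opp2 hG (wl2 k a h)) (oppCocycle hG k a.src h) h1 =
      comp2 (oppCocycle hG k a.tgt h2) (wl2 (opp1 hG k) (opp2 hG a) h4) h5 := by
  apply Path2.ext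
  · simp
  · simp
  · simp [h]
  · simp [h]
  · have n := tensor_natural_cell (G.wl2 (inv1 hG k.tgt) (inv2 hG k.sq)
      (by as_aux_lemma => simp)) (opp2 hG a) (by as_aux_lemma => simp [h])
    have t := wl3_congr (g := inv1 hG k.tgt) (h := by as_aux_lemma => simp [h])
      (wr3_congr (f := inv1 hG a.src.src) (h := by as_aux_lemma => simp [h])
        (vl3_tensor_inv2 hG k.sq a.left (by simp [h]) (by simp [h]) (by simp [h]) (by simp [h])
          (by simp [h]) (by simp [h])))
    simp [h] at n t
    simp (maxDischargeDepth := 6) [h, n, t, IsInv2.vl3_cancel, IsInv2.vr3_cancel, IsInv2.wl2,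
      IsInv2.wr2, inv2_spec, isInv2_inv2]

/-- Naturality of the cocycle of vertical inversion with respect to whiskering on the right. -/
lemma oppCocycle_wr2 (b : G.Path2) (n : G.Path1) (h : b.src.src = n.tgt) (h1 h2 h4 h5) :
    comp2 (opp2 hG (wr2 b n h)) (oppCocycle hG b.src n h) h1 =
      comp2 (oppCocycle hG b.tgt n h2) (wr2 (opp2 hG b) (opp1 hG n) h4) h5 := by
  apply Path2.ext
  · simp
  · simp
  · simp [h]
  · simp [h]
  · have m := IsGray.tensor_natural_left (opp2 hG b).cell (G.wr2 (inv2 hG n.sq) (inv1 hG n.src)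
      (by simp)) (by simp [h])
    have t := wl3_congr (g := inv1 hG b.src.tgt) (h := by simp [h])
      (wr3_congr (f := inv1 hG n.src) (h := by simp [h])
        (vl3_tinv_inv2 hG b.right n.sq (by simp [h]) (by simp [h]) (by simp [h]) (by simp [h])
          (by simp [h]) (by simp [h])))
    simp [h, IsGray.comp2_tensor, IsGray.tensor_comp2] at m t
    simp (maxDischargeDepth := 6) [h, m, IsInv2.vl3_cancel, IsInv2.vr3_cancel, IsInv2.wl2,
      IsInv2.wr2, inv2_spec, isInv2_inv2]
    simp [← t]

end Path

end GrayData

namespace GrayCat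

open GrayData

/-! ### Vertical composition and inversion as pseudofunctors -/

instance (H : GrayCat.{u}) : H.path.toGrayData.IsGray := H.path.isGray

instance (H : GrayCat.{u}) : H.pathPairs.toGrayData.IsGray := H.pathPairs.isGray

/-- Vertical pasting, as a map into the path space over the outer sides of composable pairs. -/
noncomputable def vcompMap (H : GrayCat.{u}) : PathMap H.pathPairs.toGrayData H.toGrayData
    (GrayFunctor.comp (fibSnd H.d0 H.d1) H.d0) (GrayFunctor.comp (fibFst H.d0 H.d1) H.d1) where
  map0 p := H.toGrayData.comp1 p.fst p.snd p.eq
  map1 p := Path.vcomp1 p.fst p.snd p.eq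
  src_map1 _ := rfl
  tgt_map1 _ := rfl
  map1_id1 _ := Path.vcomp1_id1 _ _ _ _
  map2 p := Path.vcomp2 p.fst p.snd p.eq
  src_map2 _ := rfl
  tgt_map2 _ := rfl
  left_map2 _ := rfl
  right_map2 _ := rfl
  map2_id2 p := Path.vcomp2_id2 _ _ p.eq _
  map2_comp2 b a h := Path.vcomp2_comp2 _ _ _ _ (congrArg Fib.fst h) (congrArg Fib.snd h)
    b.eq a.eq _
  map3 p := Path.vcomp3 p.fst p.snd p.eq
  src_map3 _ := rfl
  tgt_map3 _ := rfl
  left_map3 _ := rfl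
  right_map3 _ := rfl
  coc g f h := Path.vcompCocycle g.fst g.snd f.fst f.snd (congrArg Fib.fst h) (congrArg Fib.snd h)
    g.eq f.eq
  src_coc _ _ _ := rfl
  tgt_coc _ _ _ := rfl
  coc_glob _ _ _ := Path.vcompCocycle_glob _ _ _ _ _ _ _ _
  coc_id _ _ := Path.vcompCocycle_id _ _ _ _ _ _ _ _
  id_coc _ _ := Path.id_vcompCocycle _ _ _ _ _ _ _ _
  coc_assoc k g f hkg hgf := Path.vcompCocycle_assoc _ _ _ _ _ _ (congrArg Fib.fst hkg)
    (congrArg Fib.snd hkg) (congrArg Fib.fst hgf) (congrArg Fib.snd hgf) k.eq g.eq f.eq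
    _ _ _ _ _ _ _ _ _ _
  coc_wl2 k a _ := Path.vcompCocycle_wl2 _ _ _ _ _ _ k.eq a.eq _ _ _ _ _ _ _ _
  coc_wr2 a f h := Path.vcompCocycle_wr2 _ _ _ _ (congrArg Fib.fst h) (congrArg Fib.snd h)
    a.eq f.eq _ _ _ _ _ _ _ _ _

/-- Vertical inversion, as a map into the path space that exchanges the vertical sides. -/
noncomputable def oppMap {H : GrayCat.{u}} (hH : H.toGrayData.IsGroupoid) :
    PathMap H.path.toGrayData H.toGrayData H.d1 H.d0 where
  map0 := inv1 hH
  map1 := Path.opp1 hH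
  src_map1 _ := rfl
  tgt_map1 _ := rfl
  map1_id1 := Path.opp1_id1 hH
  map2 := Path.opp2 hH
  src_map2 _ := rfl
  tgt_map2 _ := rfl
  left_map2 _ := rfl
  right_map2 _ := rfl
  map2_id2 := Path.opp2_id2 hH
  map2_comp2 := Path.opp2_comp2 hH
  map3 := Path.opp3 hH
  src_map3 _ := rfl
  tgt_map3 _ := rfl
  left_map3 _ := rfl
  right_map3 _ := rfl
  coc := Path.oppCocycle hH
  src_coc _ _ _ := rfl
  tgt_coc _ _ _ := rfl
  coc_glob := Path.oppCocycle_glob hH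
  coc_id k _ := Path.oppCocycle_id hH k _ _
  id_coc g _ := Path.id_oppCocycle hH g _ _
  coc_assoc k g f hkg hgf := Path.oppCocycle_assoc hH k g f hkg hgf _ _ _ _ _ _
  coc_wl2 k a h := Path.oppCocycle_wl2 hH k a h _ _ _ _
  coc_wr2 a f h := Path.oppCocycle_wr2 hH a f h _ _ _ _

end GrayCat

/-! ### Generation of `Q¹` by letters and cocycles -/

namespace GrayData

section

variable {G : GrayData.{u}}

lemma comp1_congr {g g' f f' : G.C1} (e : g = g') (e' : f = f') (h h') :
    G.comp1 g f h = G.comp1 g' f' h' := by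
  subst e e'
  rfl

lemma comp2_congr {b b' a a' : G.C2} (e : b = b') (e' : a = a') (h h') :
    G.comp2 b a h = G.comp2 b' a' h' := by
  subst e e'
  rfl

lemma wl2_congr {g g' : G.C1} {a a' : G.C2} (e : g = g') (e' : a = a') (h h') :
    G.wl2 g a h = G.wl2 g' a' h' := by
  subst e e'
  rfl

lemma vl3_congr₂ {b b' : G.C2} {A A' : G.C3} (e : b = b') (e' : A = A') (h h') :
    G.vl3 b A h = G.vl3 b' A' h' := by
  subst e e'
  rfl

lemma vr3_congr₂ {A A' : G.C3} {a a' : G.C2} (e : A = A') (e' : a = a') (h h') :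
    G.vr3 A a h = G.vr3 A' a' h' := by
  subst e e'
  rfl

end

lemma IsInv2.map {G H : GrayData.{u}} (F : GrayFunctor G H) {a b : G.C2} (h : G.IsInv2 a b) :
    H.IsInv2 (F.map2 a) (F.map2 b) := by
  obtain ⟨h₁, h₂, e₁, e₂⟩ := h
  refine ⟨by simp [h₁], by simp [h₂], ?_, ?_⟩
  · rw [← F.map2_comp2 (h := h₁), e₁]
    simp
  · rw [← F.map2_comp2 (h := h₂), e₂]
    simp

end GrayData

namespace CatOver

variable {G : GrayData.{u}} (P : CatOver G)

/-- The 2-cell of the Cartesian lift, given by an identity of the base, between two 1-cells over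
the same 1-cell. -/
def linkCell (p q : P.C1) (h : P.ev p = P.ev q) : P.Cell2 where
  src := p
  tgt := q
  val := G.id2 (P.ev p)
  s1_val := by simp
  t1_val := by simpa using h

lemma linkCell_isInv2 [G.IsGray] (p q : P.C1) (h) :
    P.liftData.IsInv2 (P.linkCell p q h) (P.linkCell q p h.symm) := by
  refine ⟨rfl, rfl, ?_, ?_⟩
  · apply CatOver.Cell2.ext <;> simp [linkCell, h]
  · apply CatOver.Cell2.ext <;> simp [linkCell, h]

/-- A link cell out of a composite, factored through a link cell whiskered from the second
factor. -/
lemma linkCell_comp1 [G.IsGray] (g w v r : P.C1) (h : P.s0 g = P.t0 w) (h' : P.s0 g = P.t0 v)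
    (e : P.ev (P.comp1 g w h) = P.ev r) (e' : P.ev (P.comp1 g v h') = P.ev r)
    (e'' : P.ev w = P.ev v) :
    P.linkCell (P.comp1 g w h) r e =
      P.liftData.comp2 (P.linkCell (P.comp1 g v h') r e')
        (P.liftData.wl2 g (P.linkCell w v e'') h) rfl := by
  apply Cell2.ext
  · rfl
  · rfl
  · simp [linkCell, e'']

/-- A 2-cell of the lift is any 2-cell with the same underlying 2-cell, conjugated by link
cells. -/
lemma cell2_eq [G.IsGray] (a b : P.Cell2) (h : a.val = b.val) (e e' h1 h2) :
    a = P.liftData.comp2 (P.linkCell b.tgt a.tgt e)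
      (P.liftData.comp2 b (P.linkCell a.src b.src e') h1) h2 := by
  apply Cell2.ext
  · rfl
  · rfl
  · simp [linkCell, h]

/-- A 3-cell of the lift is any 3-cell with the same underlying 3-cell, conjugated by link
cells. -/
lemma cell3_eq [G.IsGray] (A B : P.Cell3) (h : A.val = B.val) (e e' h1 h2) :
    A = P.liftData.vl3 (P.linkCell B.tgt A.tgt e)
      (P.liftData.vr3 B (P.linkCell A.src B.src e') h1) h2 := by
  apply Cell3.ext
  · rfl
  · rfl
  · simp [linkCell, h]

end CatOver

namespace GrayCat

open GrayData

variable {A : GrayCat.{u}}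

section

variable {B : GrayData.{u}} [B.IsGray] {F E : GrayFunctor A.Q1obj.toGrayData B}

lemma Word.cons_eq (x y : A.toGrayData.C0) (f : A.toGrayData.C1) (l : List A.toGrayData.C1)
    (h : A.toGrayData.IsPath x y (f :: l)) (h' : ∀ g ∈ f :: l, ¬ A.toGrayData.IsId1 g) :
    (⟨x, y, f :: l, h, h'⟩ : A.toGrayData.Word) =
      A.Q1obj.toGrayData.comp1 (single f) ⟨x, A.toGrayData.s0 f, l, h.2,
        fun g hg => h' g (List.mem_cons_of_mem _ hg)⟩ (src_single f) := by
  have hs := single_of_not_id f (h' f List.mem_cons_self)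
  apply Word.ext
  · rfl
  · exact h.1.symm.trans (tgt_single f).symm
  · change f :: l = (single f).cells ++ l
    rw [hs]
    rfl

/-- A property of words that holds for empty words and is closed under adding a letter in front
holds for all words. -/
lemma Word.induction_on {motive : A.Q1obj.toGrayData.C1 → Prop} (w : A.Q1obj.toGrayData.C1)
    (nil : ∀ x, motive (A.Q1obj.toGrayData.id1 x))
    (cons : ∀ f w h, motive w → motive (A.Q1obj.toGrayData.comp1 (single f) w h)) : motive w := by
  obtain ⟨x, y, l, h, h'⟩ := w
  induction l generalizing y with
  | nil =>
    obtain rfl : x = y := h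
    exact nil x
  | cons f l ih =>
    rw [Word.cons_eq]
    exact cons _ _ _ (ih _ _ _)

lemma map1_eq_of_single (h0 : F.map0 = E.map0) (h1 : ∀ f, F.map1 (single f) = E.map1 (single f))
    (w : A.Q1obj.toGrayData.C1) : F.map1 w = E.map1 w := by
  induction w using Word.induction_on with
  | nil x => rw [F.map1_id1, E.map1_id1, h0]
  | cons f w h ih =>
    rw [F.map1_comp1, E.map1_comp1]
    simp only [h1, ih]

lemma linkCell_single (g f : A.toGrayData.C1) (h h' e) :
    (wordCat A.isGray).linkCell (A.Q1obj.toGrayData.comp1 (single g) (single f) h')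
      (single (A.toGrayData.comp1 g f h)) e = kappa g f h := by
  apply CatOver.Cell2.ext
  · rfl
  · rfl
  · exact congrArg A.toGrayData.id2 (e.trans (ev_single _))

/-- Gray-functors that agree on letters and on the cells `κ` agree on the link cell from a word to
the letter on its composite, by induction on the word. -/
lemma map2_linkCell_eq (h0 : F.map0 = E.map0) (h1 : ∀ f, F.map1 (single f) = E.map1 (single f))
    (hκ : ∀ g f h, F.map2 (kappa g f h) = E.map2 (kappa g f h)) (w : A.Q1obj.toGrayData.C1)
    (f : A.toGrayData.C1) (h : (wordCat A.isGray).ev w = f) (e) :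
    F.map2 ((wordCat A.isGray).linkCell w (single f) e) =
      E.map2 ((wordCat A.isGray).linkCell w (single f) e) := by
  induction w using Word.induction_on generalizing f with
  | nil x =>
    subst h
    have : (wordCat A.isGray).linkCell (A.Q1obj.toGrayData.id1 x)
        (single (A.toGrayData.id1 x)) e =
        A.Q1obj.toGrayData.id2 (A.Q1obj.toGrayData.id1 x) := by
      apply CatOver.Cell2.ext
      · rfl
      · change single (A.toGrayData.id1 x) = _
        rw [single_of_id _ (by simp [IsId1])]
        apply Word.ext <;> simp
      · rfl
    refine (congrArg F.map2 this).trans (Eq.trans ?_ (congrArg E.map2 this).symm)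
    rw [F.map2_id2, E.map2_id2, map1_eq_of_single h0 h1]
  | cons g w k ih =>
    have k' : A.toGrayData.s0 g = A.toGrayData.t0 ((wordCat A.isGray).ev w) := by
      rw [(wordCat A.isGray).t0_ev]
      exact (src_single g).symm.trans k
    have c : f = A.toGrayData.comp1 g ((wordCat A.isGray).ev w) k' := by
      rw [← h]
      refine ((wordCat A.isGray).ev_comp1 (single g) w k).trans ?_
      exact comp1_congr (ev_single g) rfl _ _
    subst c
    have t : (wordCat A.isGray).s0 (single g) =
        (wordCat A.isGray).t0 (single ((wordCat A.isGray).ev w)) := by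
      refine (src_single g).trans (k'.trans (tgt_single _).symm)
    have t' : (wordCat A.isGray).ev (A.Q1obj.toGrayData.comp1 (single g)
        (single ((wordCat A.isGray).ev w)) t) =
        (wordCat A.isGray).ev (single (A.toGrayData.comp1 g ((wordCat A.isGray).ev w) k')) := by
      rw [ev_single]
      refine ((wordCat A.isGray).ev_comp1 (single g) (single ((wordCat A.isGray).ev w)) t).trans ?_
      exact comp1_congr (ev_single g) (ev_single _) _ _
    have L := (wordCat A.isGray).linkCell_comp1 (single g) w (single ((wordCat A.isGray).ev w))
      (single (A.toGrayData.comp1 g ((wordCat A.isGray).ev w) k')) k t e t'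
      (ev_single _).symm
    have K := linkCell_single g ((wordCat A.isGray).ev w) k' t t'
    refine (congrArg F.map2 L).trans (Eq.trans ?_ (congrArg E.map2 L).symm)
    refine (F.map2_comp2 _ _ _).trans (Eq.trans ?_ (E.map2_comp2 _ _ _).symm)
    have u1 := ih _ rfl (ev_single _).symm
    have u2 := hκ g _ k'
    rw [← K] at u2
    exact comp2_congr u2 ((F.map2_wl2 _ _ _).trans
      ((wl2_congr (h1 g) u1 _ _).trans (E.map2_wl2 _ _ _).symm)) _ _

/-- The link cells into a word are handled by uniqueness of inverses. -/
lemma map2_linkCell_eq' (h0 : F.map0 = E.map0) (h1 : ∀ f, F.map1 (single f) = E.map1 (single f))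
    (hκ : ∀ g f h, F.map2 (kappa g f h) = E.map2 (kappa g f h)) (w : A.Q1obj.toGrayData.C1)
    (f : A.toGrayData.C1) (h : (wordCat A.isGray).ev w = f) (e) :
    F.map2 ((wordCat A.isGray).linkCell (single f) w e) =
      E.map2 ((wordCat A.isGray).linkCell (single f) w e) := by
  have i := ((wordCat A.isGray).linkCell_isInv2 w (single f) e.symm)
  have j := i.map E
  rw [← map2_linkCell_eq h0 h1 hκ w f h] at j
  exact (i.map F).unique j

/-- A Gray-functor out of `Q¹A` is determined by its values on the cells of `A` and by its
2-cocycle. -/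
lemma Q1_hom_ext (h0 : F.map0 = E.map0) (h1 : ∀ f, F.map1 (single f) = E.map1 (single f))
    (h2 : ∀ a, F.map2 (word2 a) = E.map2 (word2 a))
    (h3 : ∀ Γ, F.map3 (word3 Γ) = E.map3 (word3 Γ))
    (hκ : ∀ g f h, F.map2 (kappa g f h) = E.map2 (kappa g f h)) : F = E := by
  have m1 := map1_eq_of_single h0 h1
  apply GrayFunctor.ext
  · exact h0
  · exact funext m1
  · funext a
    have L := (wordCat A.isGray).cell2_eq a (word2 a.val) rfl ((ev_single _).trans a.t1_val)
      (a.s1_val.symm.trans (ev_single _).symm) rfl rfl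
    have e1 := map2_linkCell_eq h0 h1 hκ a.src _ a.s1_val.symm
      (a.s1_val.symm.trans (ev_single _).symm)
    have e2 := map2_linkCell_eq' h0 h1 hκ a.tgt _ a.t1_val.symm
      ((ev_single _).trans a.t1_val)
    rw [L]
    refine (F.map2_comp2 _ _ _).trans (Eq.trans ?_ (E.map2_comp2 _ _ _).symm)
    exact comp2_congr e2 ((F.map2_comp2 _ _ _).trans
      ((comp2_congr (h2 a.val) e1 _ _).trans (E.map2_comp2 _ _ _).symm)) _ _
  · funext Γ
    have e1 := map2_linkCell_eq h0 h1 hκ Γ.src _ Γ.s1_val.symm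
      (Γ.s1_val.symm.trans (ev_single _).symm)
    have e2 := map2_linkCell_eq' h0 h1 hκ Γ.tgt _ Γ.t1_val.symm
      ((ev_single _).trans Γ.t1_val)
    rw [(wordCat A.isGray).cell3_eq Γ (word3 Γ.val) rfl ((ev_single _).trans Γ.t1_val)
      (Γ.s1_val.symm.trans (ev_single _).symm) rfl rfl]
    refine (F.map3_vl3 _ _ _).trans (Eq.trans ?_ (E.map3_vl3 _ _ _).symm)
    exact vl3_congr₂ e2 ((F.map3_vr3 _ _ _).trans
      ((vr3_congr₂ (h3 Γ.val) e1 _ _).trans (E.map3_vr3 _ _ _).symm)) _ _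

end

end GrayCat

namespace GrayData

/-! ### Associativity, unit and inverse laws of vertical pasting -/

namespace Path

section

variable {G : GrayData.{u}} [G.IsGray]

lemma _root_.GrayData.IsInv2.comp2_eq {a b : G.C2} (H : G.IsInv2 a b) (h) :
    G.comp2 b a h = G.id2 (G.s1 a) := by
  obtain ⟨h₁, h₂, e₁, e₂⟩ := H
  exact e₁

lemma vs0₁ {q p : G.Path1} (h : q.left = p.right) : G.s0 q.src = G.t0 p.src := by
  rw [← q.s0_left, h, p.s0_right]

lemma vs0₁' {q p : G.Path1} (h : q.left = p.right) : G.s0 q.tgt = G.t0 p.tgt := by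
  rw [← q.t0_left, h, p.t0_right]

lemma vcomp1_assoc (r q p : G.Path1) (hrq : r.left = q.right) (hqp : q.left = p.right) (h h') :
    vcomp1 (vcomp1 r q hrq) p h = vcomp1 r (vcomp1 q p hqp) h' := by
  have e1 := vs0₁ hrq
  have e2 := vs0₁ hqp
  have e3 := vs0₁' hrq
  have e4 := vs0₁' hqp
  apply Path1.ext <;> simp [e1, e2, e3, e4, hrq, hqp]

lemma vcomp2_assoc (c b a : G.Path2) (hcb : c.left = b.right) (hba : b.left = a.right) (h h') :
    vcomp2 (vcomp2 c b hcb) a h = vcomp2 c (vcomp2 b a hba) h' := by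
  have e1 := vs0₁ (vside _ _ hcb)
  have e2 := vs0₁ (vside _ _ hba)
  have e3 := vs0₁' (vside _ _ hcb)
  have e4 := vs0₁' (vside _ _ hba)
  have e5 := vside _ _ hcb
  have e6 := vside _ _ hba
  have e7 := vside' _ _ hcb
  have e8 := vside' _ _ hba
  apply Path2.ext
  · simp [vcomp1_assoc, e5, e6]
  · simp [vcomp1_assoc, e7, e8]
  · simp
  · simp
  · simp [e1, e2, e3, e4, e5, e6, e7, e8, hcb, hba]

lemma vcomp3_assoc (c b a : G.Path3) (hcb : c.left = b.right) (hba : b.left = a.right) (h h') :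
    vcomp3 (vcomp3 c b hcb) a h = vcomp3 c (vcomp3 b a hba) h' := by
  apply Path3.ext
  · refine vcomp2_assoc _ _ _ ?_ ?_ ?_ ?_
    · rw [← c.s2_left, hcb, b.s2_right]
    · rw [← b.s2_left, hba, a.s2_right]
    · exact (vcomp3 c b hcb).s2_left.symm.trans (by rw [h, a.s2_right])
    · exact c.s2_left.symm.trans (by rw [h', (vcomp3 b a hba).s2_right]; rfl)
  · refine vcomp2_assoc _ _ _ ?_ ?_ ?_ ?_
    · rw [← c.t2_left, hcb, b.t2_right]
    · rw [← b.t2_left, hba, a.t2_right]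
    · exact (vcomp3 c b hcb).t2_left.symm.trans (by rw [h, a.t2_right])
    · exact c.t2_left.symm.trans (by rw [h', (vcomp3 b a hba).t2_right]; rfl)
  · rfl
  · rfl

/-- The two ways of composing the cocycles of vertical pasting for three layers agree.  They differ
by one interchange of the tensors `r' ⊗ q` and `q' ⊗ p`. -/
lemma vcompCocycle_vassoc (r' q' p' r q p : G.Path1) (hr : r'.src = r.tgt) (hq : q'.src = q.tgt)
    (hp : p'.src = p.tgt) (h1' : r'.left = q'.right) (h2' : q'.left = p'.right)
    (h1 : r.left = q.right) (h2 : q.left = p.right) (k1 k2 k3 k4 k5 k6 k7 k8 k9 l1 l2) :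
    comp2 (vcomp2 (vcompCocycle r' q' r q hr hq h1' h1) (id2 (comp1 p' p hp)) k1)
        (vcompCocycle (vcomp1 r' q' h1') p' (vcomp1 r q h1) p k2 hp k3 k4) k5 =
      comp2 (vcomp2 (id2 (comp1 r' r hr)) (vcompCocycle q' p' q p hq hp h2' h2) k6)
        (vcompCocycle r' (vcomp1 q' p' h2') r (vcomp1 q p h2) k7 k8 k9 l1) l2 := by
  have e1 := vs0₁ h1
  have e2 := vs0₁ h2
  have e3 := vs0₁' h1
  have e4 := vs0₁' h2
  have e5 := vs0₁' h1'
  have e6 := vs0₁' h2'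
  apply Path2.ext
  · simp [vcomp1_assoc, h1', h2', h1, h2]
  · simp [vcomp1_assoc, h1', h2', h1, h2]
  · simp
  · simp
  · have i := IsGray.interchange (G.wl3 r'.tgt (G.tensor q'.sq p.sq (by simp [hq, e4]))
      (by simp [e5]))
      (G.wr3 (G.tensor r'.sq q.sq (by simp [hr, e3])) p.src (by simp [e2]))
      (by simp [hq, h1', h2])
    have m := vl3_congr
      (b := G.wl2 r'.tgt (G.wl2 q'.tgt (G.wr2 p'.sq p.left (by simp [hp])) (by simp [e6]))
        (by simp [e5])) (h := by simp [hp, hq, e4, h2'])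
      (vr3_congr (a := G.wl2 r'.right (G.wr2 (G.wr2 r.sq q.src (by simp [e1])) p.src
        (by simp [e2])) (by simp [hr])) (h := by simp [hq, hr, h1, h1', h2]) i)
    simp [e1, e2, e3, e4, e5, e6, h1, h2, h1', h2', hp, hq, hr] at m
    have m' := comp3_reassoc m
    simp [e1, e2, e3, e4, e5, e6, h1, h2, h1', h2', hp, hq, hr, IsGray.comp2_tensor,
      IsGray.tensor_comp2, m']

lemma vcomp1_const1 (g : G.Path1) (f : G.C1) (h) : vcomp1 g (const1 f) h = g := by
  have e : g.left = f := h
  subst e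
  apply Path1.ext <;> simp

lemma const1_vcomp1 (g : G.Path1) (f : G.C1) (h) : vcomp1 (const1 f) g h = g := by
  have e : f = g.right := h
  subst e
  apply Path1.ext <;> simp

lemma vcomp2_const2 (a : G.Path2) (b : G.C2) (h) : vcomp2 a (const2 b) h = a := by
  have e : a.left = b := h
  subst e
  apply Path2.ext <;> simp [vcomp1_const1]

lemma const2_vcomp2 (a : G.Path2) (b : G.C2) (h) : vcomp2 (const2 b) a h = a := by
  have e : b = a.right := h
  subst e
  apply Path2.ext <;> simp [const1_vcomp1]

lemma vcomp3_const3 (a : G.Path3) (b : G.C3) (h) : vcomp3 a (const3 b) h = a := by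
  have e : a.left = b := h
  subst e
  apply Path3.ext <;> simp [vcomp2_const2]

lemma const3_vcomp3 (a : G.Path3) (b : G.C3) (h) : vcomp3 (const3 b) a h = a := by
  have e : b = a.right := h
  subst e
  apply Path3.ext <;> simp [const2_vcomp2]

/-- The cocycle against constant paths is trivial since tensors with identities are. -/
lemma vcompCocycle_const (k g : G.Path1) (h : k.src = g.tgt) (h' h1 h2) :
    vcompCocycle k (const1 k.left) g (const1 g.left) h h' h1 h2 = id2 (comp1 k g h) := by
  apply Path2.ext
  · simp [vcomp1_const1]
  · have e := const1_comp1 k.left g.left (by simp [h])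
    simp [← e, vcomp1_const1]
  · simp
  · simp
  · simp

lemma const_vcompCocycle (k g : G.Path1) (h : k.src = g.tgt) (h' h1 h2) :
    vcompCocycle (const1 k.right) k (const1 g.right) g h' h h1 h2 = id2 (comp1 k g h) := by
  apply Path2.ext
  · simp [const1_vcomp1]
  · have e := const1_comp1 k.right g.right (by simp [h])
    simp [← e, const1_vcomp1]
  · simp
  · simp
  · simp

end

section

variable {G : GrayData.{u}} (hG : G.IsGroupoid) [G.IsGray]

lemma opp1_vcomp1 (g : G.Path1) (h) : vcomp1 (opp1 hG g) g h = const1 g.left := by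
  apply Path1.ext <;>
    simp (maxDischargeDepth := 6) [IsInv2.comp2_eq, IsInv2.wl2, IsInv2.wr2, inv2_spec, isInv2_inv2]

lemma vcomp1_opp1 (g : G.Path1) (h) : vcomp1 g (opp1 hG g) h = const1 g.right := by
  apply Path1.ext <;>
    simp (maxDischargeDepth := 6) [IsInv2.comp2_eq, IsInv2.wl2, IsInv2.wr2, inv2_spec, isInv2_inv2]

lemma opp2_vcomp2 (a : G.Path2) (h) : vcomp2 (opp2 hG a) a h = const2 a.left := by
  apply Path2.ext
  · simp [opp1_vcomp1]
  · simp [opp1_vcomp1]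
  · simp
  · simp
  · have e := (((inv3_spec hG a.cell).wl3 (inv1 hG a.src.tgt) (by simp) (by simp)).vr3
      (G.wl2 (inv1 hG a.src.tgt) (inv2 hG a.src.sq) (by simp)) (by simp) (by simp)).eq₁ (by simp)
    simp (maxDischargeDepth := 6) [IsInv2.comp2_eq, IsInv2.wl2, inv2_spec, isInv2_inv2] at e
    simp (maxDischargeDepth := 6) [IsInv2.vl3_cancel, IsInv2.wl2, inv2_spec, isInv2_inv2, e]

lemma vcomp2_opp2 (a : G.Path2) (h) : vcomp2 a (opp2 hG a) h = const2 a.right := by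
  apply Path2.ext
  · simp [vcomp1_opp1]
  · simp [vcomp1_opp1]
  · simp
  · simp
  · have e := (((inv3_spec hG a.cell).wr3 (inv1 hG a.src.src) (by simp) (by simp)).vl3
      (G.wr2 (inv2 hG a.tgt.sq) (inv1 hG a.src.src) (by simp)) (by simp) (by simp)).eq₂ (by simp)
    simp (maxDischargeDepth := 6) [IsInv2.comp2_eq, IsInv2.comp2_cancel, IsInv2.wr2, inv2_spec,
      isInv2_inv2] at e
    simp (maxDischargeDepth := 6) [IsInv2.vr3_cancel, IsInv2.wr2, inv2_spec, isInv2_inv2, e]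

/-- The cocycles of `o` and `m` cancel: the tensor `k₂⁻¹ ⊗ g₂⁻¹`, followed by `k₂⁻¹ ⊗ g₂`, is the
tensor of `k₂⁻¹` with an identity. -/
lemma oppCocycle_vcomp2 (k g : G.Path1) (h : k.src = g.tgt) (h1 h2 h3 h4 h5) :
    comp2 (vcomp2 (oppCocycle hG k g h) (id2 (comp1 k g h)) h1)
        (vcompCocycle (opp1 hG k) k (opp1 hG g) g h2 h h3 h4) h5 =
      id2 (const1 (G.comp1 k.left g.left (by simp [h]))) := by
  apply Path2.ext
  · simp [opp1_vcomp1, const1_comp1]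
  · simp [opp1_vcomp1]
  · simp
  · simp
  · have e := IsGray.tensor_comp2 (inv2 hG k.sq) (G.wl2 (inv1 hG k.src) g.sq (by simp [h]))
      (G.wl2 (inv1 hG g.tgt) (inv2 hG g.sq) (by simp)) (by simp [h]) (by simp [h])
    have m := vl3_congr (b := G.wl2 (inv1 hG k.tgt) (G.wr2 k.sq g.left (by simp [h])) (by simp))
      (h := by simp [h]) (wl3_congr (g := inv1 hG k.tgt) (h := by simp [h]) e)
    simp (maxDischargeDepth := 6) [h, IsInv2.comp2_eq, IsInv2.comp2_cancel, IsInv2.wl2,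
      IsInv2.wr2, inv2_spec, isInv2_inv2] at m
    simp [h, ← m]

/-- The cocycles of `m` and `o` cancel: the tensor `k₂⁻¹ ⊗ g₂⁻¹`, composed with `k₂ ⊗ g₂⁻¹`, is the
tensor of an identity with `g₂⁻¹`. -/
lemma vcomp2_oppCocycle (k g : G.Path1) (h : k.src = g.tgt) (h1 h2 h3 h4 h5) :
    comp2 (vcomp2 (id2 (comp1 k g h)) (oppCocycle hG k g h) h1)
        (vcompCocycle k (opp1 hG k) g (opp1 hG g) h h2 h3 h4) h5 =
      id2 (const1 (G.comp1 k.right g.right (by simp [h]))) := by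
  apply Path2.ext
  · simp [vcomp1_opp1, const1_comp1]
  · simp [vcomp1_opp1]
  · simp
  · simp
  · have e := IsGray.comp2_tensor (inv2 hG k.sq) k.sq
      (G.wl2 (inv1 hG g.tgt) (inv2 hG g.sq) (by simp)) (by simp) (by simp [h])
    have m := vr3_congr (a := G.wl2 k.right (G.wr2 g.sq (inv1 hG g.src) (by simp)) (by simp [h]))
      (h := by simp [h]) (wr3_congr (f := inv1 hG g.src) (h := by simp [h]) e)
    simp (maxDischargeDepth := 6) [h, IsInv2.comp2_eq, IsInv2.comp2_cancel, IsInv2.wl2,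
      IsInv2.wr2, inv2_spec, isInv2_inv2] at m
    simp [h, ← m]

end

end Path

end GrayData

/-! ### Values and cocycles of `Q¹`-maps -/

namespace GrayCat

open GrayData

variable {A B C : GrayCat.{u}}

/-- The value of a `Q¹`-map at a 0-cell. -/
noncomputable def val0 (F : A.pseudo ⟶ B.pseudo) (x : A.toGrayData.C0) : B.toGrayData.C0 :=
  (under F).map0 x

/-- The value of a `Q¹`-map at a 1-cell. -/
noncomputable def val1 (F : A.pseudo ⟶ B.pseudo) (f : A.toGrayData.C1) : B.toGrayData.C1 :=
  (under F).map1 (single f)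

/-- The value of a `Q¹`-map at a 2-cell. -/
noncomputable def val2 (F : A.pseudo ⟶ B.pseudo) (a : A.toGrayData.C2) : B.toGrayData.C2 :=
  (under F).map2 (word2 a)

/-- The value of a `Q¹`-map at a 3-cell. -/
noncomputable def val3 (F : A.pseudo ⟶ B.pseudo) (X : A.toGrayData.C3) : B.toGrayData.C3 :=
  (under F).map3 (word3 X)

/-- The 2-cocycle of a `Q¹`-map. -/
noncomputable def cocycle (F : A.pseudo ⟶ B.pseudo) (g f : A.toGrayData.C1)
    (h : A.toGrayData.s0 g = A.toGrayData.t0 f) : B.toGrayData.C2 :=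
  (under F).map2 (kappa g f h)

lemma s0_val1 (F : A.pseudo ⟶ B.pseudo) (f : A.toGrayData.C1) :
    B.toGrayData.s0 (val1 F f) = val0 F (A.toGrayData.s0 f) :=
  ((under F).s0_map1 _).trans (congrArg (under F).map0 (src_single f))

lemma t0_val1 (F : A.pseudo ⟶ B.pseudo) (f : A.toGrayData.C1) :
    B.toGrayData.t0 (val1 F f) = val0 F (A.toGrayData.t0 f) :=
  ((under F).t0_map1 _).trans (congrArg (under F).map0 (tgt_single f))

lemma s0_val1_eq (F : A.pseudo ⟶ B.pseudo) (g f : A.toGrayData.C1)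
    (h : A.toGrayData.s0 g = A.toGrayData.t0 f) :
    B.toGrayData.s0 (val1 F g) = B.toGrayData.t0 (val1 F f) := by
  rw [s0_val1, t0_val1, h]

lemma s1_val2 (F : A.pseudo ⟶ B.pseudo) (a : A.toGrayData.C2) :
    B.toGrayData.s1 (val2 F a) = val1 F (A.toGrayData.s1 a) :=
  (under F).s1_map2 _

lemma t1_val2 (F : A.pseudo ⟶ B.pseudo) (a : A.toGrayData.C2) :
    B.toGrayData.t1 (val2 F a) = val1 F (A.toGrayData.t1 a) :=
  (under F).t1_map2 _

lemma s1_cocycle (F : A.pseudo ⟶ B.pseudo) (g f : A.toGrayData.C1) (h) :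
    B.toGrayData.s1 (cocycle F g f h) =
      B.toGrayData.comp1 (val1 F g) (val1 F f) (s0_val1_eq F g f h) :=
  ((under F).s1_map2 _).trans ((under F).map1_comp1 (single g) (single f)
    ((src_single g).trans (h.trans (tgt_single f).symm)))

lemma t1_cocycle (F : A.pseudo ⟶ B.pseudo) (g f : A.toGrayData.C1) (h) :
    B.toGrayData.t1 (cocycle F g f h) = val1 F (A.toGrayData.comp1 g f h) :=
  (under F).t1_map2 _

/-- A `Q¹`-map is determined by its values and its 2-cocycle. -/
lemma pseudo_ext {F E : A.pseudo ⟶ B.pseudo} (h0 : ∀ x, val0 F x = val0 E x)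
    (h1 : ∀ f, val1 F f = val1 E f) (h2 : ∀ a, val2 F a = val2 E a)
    (h3 : ∀ X, val3 F X = val3 E X) (hκ : ∀ g f h, cocycle F g f h = cocycle E g f h) : F = E :=
  Cokleisli.hom_ext _ (Q1_hom_ext (funext h0) h1 h2 h3 hκ)

section

lemma wordDelta_single (f : A.toGrayData.C1) :
    wordDelta (single f) = single (G := A.Q1obj.toGrayData) (single f) := by
  by_cases h : A.toGrayData.IsId1 f
  · have h' : A.Q1obj.toGrayData.IsId1 (single f) := by
      rw [Q1obj_isId1, single_of_id f h]
    rw [single_of_id (G := A.Q1obj) _ h']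
    apply Word.ext
    · rfl
    · change (single f).tgt = (single f).src
      rw [single_of_id f h]
    · change (single f).cells.map single = []
      rw [single_of_id f h]
      rfl
  · rw [single_of_not_id (G := A.Q1obj) _ (not_isId1_single f h)]
    apply Word.ext
    · rfl
    · rfl
    · exact congrArg (fun v : A.toGrayData.Word => v.cells.map single) (single_of_not_id f h)

variable (F : A.pseudo ⟶ B.pseudo) (E : B.pseudo ⟶ C.pseudo)

/-- The word assigned by the co-Kleisli extension of a `Q¹`-map to a one-letter word. -/
lemma map_wordDelta_single (f : A.toGrayData.C1) :
    Word.map (under F) (wordDelta (single f)) = single (val1 F f) :=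
  (congrArg _ (wordDelta_single f)).trans (wordMap_single (G := A.Q1obj) (H := B) F.of (single f))

lemma val1_comp (f : A.toGrayData.C1) : val1 (F ≫ E) f = val1 E (val1 F f) :=
  congrArg (under E).map1 (map_wordDelta_single F f)

lemma val2_comp (a : A.toGrayData.C2) : val2 (F ≫ E) a = val2 E (val2 F a) := by
  refine congrArg (under E).map2 (CatOver.Cell2.ext ?_ ?_ rfl)
  · exact (map_wordDelta_single F _).trans (congrArg single (s1_val2 F a).symm)
  · exact (map_wordDelta_single F _).trans (congrArg single (t1_val2 F a).symm)

lemma val3_comp (X : A.toGrayData.C3) : val3 (F ≫ E) X = val3 E (val3 F X) := by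
  refine congrArg (under E).map3 (CatOver.Cell3.ext ?_ ?_ rfl)
  · refine (map_wordDelta_single F _).trans (congrArg single ?_)
    exact (((under F).s1_map2 _).symm.trans (congrArg B.toGrayData.s1
      ((under F).s2_map3 (word3 X)).symm))
  · refine (map_wordDelta_single F _).trans (congrArg single ?_)
    exact (((under F).t1_map2 _).symm.trans (congrArg B.toGrayData.t1
      ((under F).s2_map3 (word3 X)).symm))

/-- The 2-cocycle of a co-Kleisli composite. -/
lemma cocycle_comp (g f : A.toGrayData.C1) (h h' h'') :
    cocycle (F ≫ E) g f h =
      C.toGrayData.comp2 (val2 E (cocycle F g f h))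
        (cocycle E (val1 F g) (val1 F f) h') h'' := by
  have e : B.Q1obj.toGrayData.s1 (word2 (cocycle F g f h)) =
      B.Q1obj.toGrayData.t1 (kappa (val1 F g) (val1 F f) h') :=
    congrArg single (s1_cocycle F g f h)
  refine Eq.trans ?_ ((under E).map2_comp2 _ _ e)
  refine congrArg (under E).map2 (CatOver.Cell2.ext ?_ ?_ ?_)
  · let D : A.Q1obj ⟶ B.Q1obj := Q1delta A ≫ Q1map F.of
    refine (D.map1_comp1 (single g) (single f)
      ((src_single g).trans (h.trans (tgt_single f).symm))).trans ?_
    exact comp1_congr (map_wordDelta_single F g) (map_wordDelta_single F f) _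
      ((src_single _).trans (h'.trans (tgt_single _).symm))
  · exact (map_wordDelta_single F _).trans (congrArg single (t1_cocycle F g f h).symm)
  · exact (IsGray.comp2_id _ _ _).symm

end

section

variable (F : A ⟶ B)

lemma val1_strict (f : A.toGrayData.C1) : val1 (strict F) f = F.map1 f :=
  congrArg F.map1 (ev_single f)

lemma val2_strict (a : A.toGrayData.C2) : val2 (strict F) a = F.map2 a := rfl

lemma val3_strict (X : A.toGrayData.C3) : val3 (strict F) X = F.map3 X := rfl

lemma cocycle_strict (g f : A.toGrayData.C1) (h) :
    cocycle (strict F) g f h = B.toGrayData.id2 (F.map1 (A.toGrayData.comp1 g f h)) :=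
  F.map2_id2 _

lemma val1_id (f : A.toGrayData.C1) : val1 (𝟙 A.pseudo) f = f := ev_single f

end

end GrayCat

/-! ### The object of composable pairs -/

namespace GrayCat

open GrayData

section

variable {A B C K : GrayCat.{u}} {F : A ⟶ C} {E : B ⟶ C}

/-- The Gray-functor into the fibre product with given components. -/
def fibLift (P : K ⟶ A) (Q : K ⟶ B) (w : P ≫ F = Q ≫ E) : K ⟶ fib F E where
  map0 x := ⟨P.map0 x, Q.map0 x, congrFun (congrArg GrayFunctor.map0 w) x⟩
  map1 x := ⟨P.map1 x, Q.map1 x, congrFun (congrArg GrayFunctor.map1 w) x⟩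
  map2 x := ⟨P.map2 x, Q.map2 x, congrFun (congrArg GrayFunctor.map2 w) x⟩
  map3 x := ⟨P.map3 x, Q.map3 x, congrFun (congrArg GrayFunctor.map3 w) x⟩
  s0_map1 _ := Fib.ext (P.s0_map1 _) (Q.s0_map1 _)
  t0_map1 _ := Fib.ext (P.t0_map1 _) (Q.t0_map1 _)
  s1_map2 _ := Fib.ext (P.s1_map2 _) (Q.s1_map2 _)
  t1_map2 _ := Fib.ext (P.t1_map2 _) (Q.t1_map2 _)
  s2_map3 _ := Fib.ext (P.s2_map3 _) (Q.s2_map3 _)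
  t2_map3 _ := Fib.ext (P.t2_map3 _) (Q.t2_map3 _)
  map1_id1 _ := Fib.ext (P.map1_id1 _) (Q.map1_id1 _)
  map2_id2 _ := Fib.ext (P.map2_id2 _) (Q.map2_id2 _)
  map3_id3 _ := Fib.ext (P.map3_id3 _) (Q.map3_id3 _)
  map1_comp1 _ _ _ := Fib.ext (P.map1_comp1 _ _ _) (Q.map1_comp1 _ _ _)
  map2_comp2 _ _ _ := Fib.ext (P.map2_comp2 _ _ _) (Q.map2_comp2 _ _ _)
  map3_comp3 _ _ _ := Fib.ext (P.map3_comp3 _ _ _) (Q.map3_comp3 _ _ _)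
  map2_wl2 _ _ _ := Fib.ext (P.map2_wl2 _ _ _) (Q.map2_wl2 _ _ _)
  map2_wr2 _ _ _ := Fib.ext (P.map2_wr2 _ _ _) (Q.map2_wr2 _ _ _)
  map3_wl3 _ _ _ := Fib.ext (P.map3_wl3 _ _ _) (Q.map3_wl3 _ _ _)
  map3_wr3 _ _ _ := Fib.ext (P.map3_wr3 _ _ _) (Q.map3_wr3 _ _ _)
  map3_vl3 _ _ _ := Fib.ext (P.map3_vl3 _ _ _) (Q.map3_vl3 _ _ _)
  map3_vr3 _ _ _ := Fib.ext (P.map3_vr3 _ _ _) (Q.map3_vr3 _ _ _)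
  map3_tensor _ _ _ := Fib.ext (P.map3_tensor _ _ _) (Q.map3_tensor _ _ _)

lemma fib_isPullback (F : A ⟶ C) (E : B ⟶ C) : IsPullback (fibFst F E) (fibSnd F E) F E where
  w := by
    apply hom_ext
    · funext p; exact p.eq
    · funext p; exact p.eq
    · funext p; exact p.eq
    · funext p; exact p.eq
  isLimit' := ⟨Limits.PullbackCone.IsLimit.mk _ (fun s => fibLift s.fst s.snd s.condition)
    (fun _ => rfl) (fun _ => rfl) (fun s m h h' => by
      apply hom_ext
      · funext x
        exact Fib.ext (congrFun (congrArg GrayFunctor.map0 h) x)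
          (congrFun (congrArg GrayFunctor.map0 h') x)
      · funext x
        exact Fib.ext (congrFun (congrArg GrayFunctor.map1 h) x)
          (congrFun (congrArg GrayFunctor.map1 h') x)
      · funext x
        exact Fib.ext (congrFun (congrArg GrayFunctor.map2 h) x)
          (congrFun (congrArg GrayFunctor.map2 h') x)
      · funext x
        exact Fib.ext (congrFun (congrArg GrayFunctor.map3 h) x)
          (congrFun (congrArg GrayFunctor.map3 h') x))⟩

/-- Strict Gray-functors form a right adjoint into the co-Kleisli category, so that the
componentwise fibre product remains a pullback there. -/
lemma strict_fib_isPullback (F : A ⟶ C) (E : B ⟶ C) :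
    IsPullback (strict (fibFst F E)) (strict (fibSnd F E)) (strict F) (strict E) :=
  haveI := (Cokleisli.Adjunction.adj Q1.{u}).rightAdjoint_preservesLimits
  (fib_isPullback F E).map (Cokleisli.Adjunction.toCokleisli Q1)

end

section

variable {H : GrayCat.{u}} {T : GrayCat.{u}}

/-- The pairing of two `Q¹`-maps into the path space. -/
noncomputable def pair (b a : T.pseudo ⟶ H.path.pseudo) (w : b ≫ strict H.d0 = a ≫ strict H.d1) :
    T.pseudo ⟶ H.pathPairs.pseudo :=
  (strict_fib_isPullback H.d0 H.d1).lift b a w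

variable (b a : T.pseudo ⟶ H.path.pseudo) (w : b ≫ strict H.d0 = a ≫ strict H.d1)

lemma pair_fst : pair b a w ≫ strict (fibFst H.d0 H.d1) = b := IsPullback.lift_fst _ _ _ _

lemma pair_snd : pair b a w ≫ strict (fibSnd H.d0 H.d1) = a := IsPullback.lift_snd _ _ _ _

lemma val0_pair_fst (x) : (val0 (pair b a w) x).fst = val0 b x :=
  congrArg (val0 · x) (pair_fst b a w)

lemma val0_pair_snd (x) : (val0 (pair b a w) x).snd = val0 a x :=
  congrArg (val0 · x) (pair_snd b a w)

lemma val1_pair_fst (f) : (val1 (pair b a w) f).fst = val1 b f :=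
  ((val1_strict _ _).symm.trans (val1_comp _ _ f).symm).trans
    (congrArg (val1 · f) (pair_fst b a w))

lemma val1_pair_snd (f) : (val1 (pair b a w) f).snd = val1 a f :=
  ((val1_strict _ _).symm.trans (val1_comp _ _ f).symm).trans
    (congrArg (val1 · f) (pair_snd b a w))

lemma val2_pair_fst (f) : (val2 (pair b a w) f).fst = val2 b f :=
  (val2_comp _ (strict (fibFst H.d0 H.d1)) f).symm.trans (congrArg (val2 · f) (pair_fst b a w))

lemma val2_pair_snd (f) : (val2 (pair b a w) f).snd = val2 a f :=
  (val2_comp _ (strict (fibSnd H.d0 H.d1)) f).symm.trans (congrArg (val2 · f) (pair_snd b a w))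

lemma val3_pair_fst (f) : (val3 (pair b a w) f).fst = val3 b f :=
  (val3_comp _ (strict (fibFst H.d0 H.d1)) f).symm.trans (congrArg (val3 · f) (pair_fst b a w))

lemma val3_pair_snd (f) : (val3 (pair b a w) f).snd = val3 a f :=
  (val3_comp _ (strict (fibSnd H.d0 H.d1)) f).symm.trans (congrArg (val3 · f) (pair_snd b a w))

end

end GrayCat

/-! ### Pointwise vertical composition of `Q¹`-maps into the path space -/

namespace GrayData

namespace Path

variable {G : GrayData.{u}} [G.IsGray]

lemma vcomp1_congr {q q' p p' : G.Path1} (e : q = q') (e' : p = p') (h h') :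
    vcomp1 q p h = vcomp1 q' p' h' := by
  subst e e'
  rfl

lemma vcomp2_congr {b b' a a' : G.Path2} (e : b = b') (e' : a = a') (h h') :
    vcomp2 b a h = vcomp2 b' a' h' := by
  subst e e'
  rfl

lemma vcomp3_congr {b b' a a' : G.Path3} (e : b = b') (e' : a = a') (h h') :
    vcomp3 b a h = vcomp3 b' a' h' := by
  subst e e'
  rfl

lemma vcompCocycle_congr {q' p' q p r' s' r s : G.Path1} (e1 : q' = r') (e2 : p' = s')
    (e3 : q = r) (e4 : p = s) (h1 h2 h3 h4 h1' h2' h3' h4') :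
    vcompCocycle q' p' q p h1 h2 h3 h4 = vcompCocycle r' s' r s h1' h2' h3' h4' := by
  subst e1 e2 e3 e4
  rfl

end Path

end GrayData

namespace GrayCat

open GrayData

variable {H : GrayCat.{u}} {T : GrayCat.{u}}

/-- Composition with a strict Gray-functor applies it to the 2-cocycle. -/
lemma cocycle_comp_strict {A B C : GrayCat.{u}} (F : A.pseudo ⟶ B.pseudo) (E : B ⟶ C)
    (g f : A.toGrayData.C1) (h) :
    cocycle (F ≫ strict E) g f h = E.map2 (cocycle F g f h) := by
  have k := s0_val1_eq F g f h
  refine (cocycle_comp F (strict E) g f h k ?_).trans ?_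
  · rw [cocycle_strict, val2_strict, E.s1_map2, s1_cocycle, C.toGrayData.t1_id2]
  · have h' : C.toGrayData.s1 (val2 (strict E) (cocycle F g f h)) = C.toGrayData.t1
        (C.toGrayData.id2 (E.map1 (B.toGrayData.comp1 (val1 F g) (val1 F f) k))) := by
      rw [val2_strict, E.s1_map2, s1_cocycle]
      exact (C.toGrayData.t1_id2 _).symm
    exact (comp2_congr rfl (cocycle_strict E _ _ _) _ h').trans (IsGray.comp2_id _ _ h')

section

variable {b a : T.pseudo ⟶ H.path.pseudo}

lemma side0 (w : b ≫ strict H.d0 = a ≫ strict H.d1) (x) :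
    H.toGrayData.s0 (val0 b x) = H.toGrayData.t0 (val0 a x) :=
  congrArg (val0 · x) w

lemma side1 (w : b ≫ strict H.d0 = a ≫ strict H.d1) (f) :
    Path1.left (val1 b f) = Path1.right (val1 a f) :=
  ((val1_comp b _ f).trans (val1_strict H.d0 _)).symm.trans ((congrArg (val1 · f) w).trans
    ((val1_comp a _ f).trans (val1_strict H.d1 _)))

lemma side2 (w : b ≫ strict H.d0 = a ≫ strict H.d1) (f) :
    Path2.left (val2 b f) = Path2.right (val2 a f) :=
  (val2_comp b (strict H.d0) f).symm.trans ((congrArg (val2 · f) w).trans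
    (val2_comp a (strict H.d1) f))

lemma side3 (w : b ≫ strict H.d0 = a ≫ strict H.d1) (f) :
    Path3.left (val3 b f) = Path3.right (val3 a f) :=
  (val3_comp b (strict H.d0) f).symm.trans ((congrArg (val3 · f) w).trans
    (val3_comp a (strict H.d1) f))

lemma sideκ (w : b ≫ strict H.d0 = a ≫ strict H.d1) (g f h) :
    Path2.left (cocycle b g f h) = Path2.right (cocycle a g f h) :=
  (cocycle_comp_strict b H.d0 g f h).symm.trans ((congrArg (cocycle · g f h) w).trans
    (cocycle_comp_strict a H.d1 g f h))

end

section

variable (b a : T.pseudo ⟶ H.path.pseudo) (w : b ≫ strict H.d0 = a ≫ strict H.d1)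

lemma cocycle_pair_fst (g f h) : (cocycle (pair b a w) g f h).fst = cocycle b g f h :=
  (cocycle_comp_strict _ (fibFst H.d0 H.d1) g f h).symm.trans
    (congrArg (cocycle · g f h) (pair_fst b a w))

lemma cocycle_pair_snd (g f h) : (cocycle (pair b a w) g f h).snd = cocycle a g f h :=
  (cocycle_comp_strict _ (fibSnd H.d0 H.d1) g f h).symm.trans
    (congrArg (cocycle · g f h) (pair_snd b a w))

variable {m : H.pathPairs.pseudo ⟶ H.path.pseudo} 

lemma val0_paste (hm : H.IsPathComp m) (x) : val0 (pair b a w ≫ m) x =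
    H.toGrayData.comp1 (val0 b x) (val0 a x) (side0 w x) :=
  (hm.map0 _).trans (comp1_congr (val0_pair_fst b a w x) (val0_pair_snd b a w x) _ _)

lemma val1_paste (hm : H.IsPathComp m) (f) :
    val1 (pair b a w ≫ m) f = Path.vcomp1 (val1 b f) (val1 a f) (side1 w f) :=
  (val1_comp _ m f).trans ((hm.map1 _).trans
    (Path.vcomp1_congr (val1_pair_fst b a w f) (val1_pair_snd b a w f) _ _))

lemma val2_paste (hm : H.IsPathComp m) (f) :
    val2 (pair b a w ≫ m) f = Path.vcomp2 (val2 b f) (val2 a f) (side2 w f) :=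
  (val2_comp _ m f).trans ((hm.map2 _).trans
    (Path.vcomp2_congr (val2_pair_fst b a w f) (val2_pair_snd b a w f) _ _))

lemma val3_paste (hm : H.IsPathComp m) (f) :
    val3 (pair b a w ≫ m) f = Path.vcomp3 (val3 b f) (val3 a f) (side3 w f) :=
  (val3_comp _ m f).trans ((hm.map3 _).trans
    (Path.vcomp3_congr (val3_pair_fst b a w f) (val3_pair_snd b a w f) _ _))

lemma paste_src_eq (g f h) :
    (Path.vcomp2 (cocycle b g f h) (cocycle a g f h) (sideκ w g f h)).src =
      (Path.vcompCocycle (val1 b g) (val1 a g) (val1 b f) (val1 a f) (s0_val1_eq b g f h)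
        (s0_val1_eq a g f h) (side1 w g) (side1 w f)).tgt :=
  Path.vcomp1_congr (s1_cocycle b g f h) (s1_cocycle a g f h) (Path.vside _ _ (sideκ w g f h))
    (comp1_congr (side1 w g) (side1 w f) _ _)

/-- The cocycle of the pointwise vertical composite of `b` and `a` combines the cocycles of `b` and
`a` with that of vertical composition itself. -/
lemma cocycle_paste (hm : H.IsPathComp m) (g f h) : cocycle (pair b a w ≫ m) g f h =
    Path.comp2 (Path.vcomp2 (cocycle b g f h) (cocycle a g f h) (sideκ w g f h))
      (Path.vcompCocycle (val1 b g) (val1 a g) (val1 b f) (val1 a f) (s0_val1_eq b g f h)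
        (s0_val1_eq a g f h) (side1 w g) (side1 w f)) (paste_src_eq b a w g f h) := by
  have k := s0_val1_eq (pair b a w) g f h
  have e1 : val2 m (cocycle (pair b a w) g f h) = Path.vcomp2 (cocycle b g f h)
      (cocycle a g f h) (sideκ w g f h) := (hm.map2 _).trans
    (Path.vcomp2_congr (cocycle_pair_fst b a w g f h) (cocycle_pair_snd b a w g f h) _ _)
  have e2 : cocycle m (val1 (pair b a w) g) (val1 (pair b a w) f) k =
      Path.vcompCocycle (val1 b g) (val1 a g) (val1 b f) (val1 a f) (s0_val1_eq b g f h)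
        (s0_val1_eq a g f h) (side1 w g) (side1 w f) :=
    (hm.cocycle _ _ _).trans (Path.vcompCocycle_congr (val1_pair_fst b a w g)
      (val1_pair_snd b a w g) (val1_pair_fst b a w f) (val1_pair_snd b a w f) _ _ _ _ _ _ _ _)
  have k' : H.path.toGrayData.s1 (val2 m (cocycle (pair b a w) g f h)) =
      H.path.toGrayData.t1 (cocycle m (val1 (pair b a w) g) (val1 (pair b a w) f) k) := by
    rw [e1, e2]
    exact paste_src_eq b a w g f h
  exact (cocycle_comp (pair b a w) m g f h k k').trans
    (comp2_congr (G := H.path.toGrayData) e1 e2 k' (paste_src_eq b a w g f h))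

end

end GrayCat

namespace GrayData

namespace Path

variable {G : GrayData.{u}} [G.IsGray]

/-- Associativity of vertical composition at the level of cocycles: `C`, `B`, `A` stand for the
cocycles of three composable `Q¹`-maps at a fixed pair of 1-cells. -/
lemma vcomp2_vcompCocycle_assoc (r' q' p' r q p : G.Path1) (C B A : G.Path2) (hr : r'.src = r.tgt)
    (hq : q'.src = q.tgt) (hp : p'.src = p.tgt) (h1' : r'.left = q'.right)
    (h2' : q'.left = p'.right) (h1 : r.left = q.right) (h2 : q.left = p.right)
    (hC : C.src = comp1 r' r hr) (hA : A.src = comp1 p' p hp)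
    (hCB : C.left = B.right) (hBA : B.left = A.right) (k1 k2 k3 k4 k5 k6 k7 l1 l2 l3 l4 l5 l6 l7) :
    comp2 (vcomp2 (comp2 (vcomp2 C B hCB) (vcompCocycle r' q' r q hr hq h1' h1) k1) A k2)
        (vcompCocycle (vcomp1 r' q' h1') p' (vcomp1 r q h1) p k3 k4 k5 k6) k7 =
      comp2 (vcomp2 C (comp2 (vcomp2 B A hBA) (vcompCocycle q' p' q p hq hp h2' h2) l1) l2)
        (vcompCocycle r' (vcomp1 q' p' h2') r (vcomp1 q p h2) l3 l4 l5 l6) l7 := by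
  have eA : A = comp2 A (id2 (comp1 p' p hp)) hA := (comp2_id _ _ _).symm
  have eC : C = comp2 C (id2 (comp1 r' r hr)) hC := (comp2_id _ _ _).symm
  have hL : (vcomp2 C B hCB).left = A.right := hBA
  have hR : C.left = (vcomp2 B A hBA).right := hCB
  have s : (vcompCocycle r' q' r q hr hq h1' h1).left = (id2 (comp1 p' p hp)).right := by
    simp [h2, h2']
  have s' : (id2 (comp1 r' r hr)).left = (vcompCocycle q' p' q p hq hp h2' h2).right := by
    simp [h1, h1']
  have k2' := k2.trans (congrArg Path2.right eA)
  have l2' := (congrArg Path2.left eC).symm.trans l2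
  have e1 := (vcomp2_congr rfl eA k2 k2').trans
    (vcomp2_comp2 (vcomp2 C B hCB) (vcompCocycle r' q' r q hr hq h1' h1) A
      (id2 (comp1 p' p hp)) k1 hA hL s k2')
  have e2 := (vcomp2_congr eC rfl l2 l2').trans
    (vcomp2_comp2 C (id2 (comp1 r' r hr)) (vcomp2 B A hBA)
      (vcompCocycle q' p' q p hq hp h2' h2) hC l1 hR s' l2')
  have m1 : (vcomp2 (vcomp2 C B hCB) A hL).src =
      (vcomp2 (vcompCocycle r' q' r q hr hq h1' h1) (id2 (comp1 p' p hp)) s).tgt :=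
    vcomp1_congr k1 hA (vside _ _ hL) (vside' _ _ s)
  have m2 : (vcomp2 C (vcomp2 B A hBA) hR).src =
      (vcomp2 (id2 (comp1 r' r hr)) (vcompCocycle q' p' q p hq hp h2' h2) s').tgt :=
    vcomp1_congr hC l1 (vside _ _ hR) (vside' _ _ s')
  have n1 : (vcomp2 (vcompCocycle r' q' r q hr hq h1' h1) (id2 (comp1 p' p hp)) s).src =
      (vcompCocycle (vcomp1 r' q' h1') p' (vcomp1 r q h1) p k3 k4 k5 k6).tgt :=
    (congrArg Path2.src e1).symm.trans k7
  have n2 : (vcomp2 (id2 (comp1 r' r hr)) (vcompCocycle q' p' q p hq hp h2' h2) s').src =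
      (vcompCocycle r' (vcomp1 q' p' h2') r (vcomp1 q p h2) l3 l4 l5 l6).tgt :=
    (congrArg Path2.src e2).symm.trans l7
  refine (GrayData.comp2_congr (G := G.pathData) e1 rfl k7 (by exact n1)).trans
    ((comp2_assoc _ _ _ m1 n1).trans ?_)
  refine Eq.trans ?_ ((GrayData.comp2_congr (G := G.pathData) e2 rfl l7 (by exact n2)).trans
    (comp2_assoc _ _ _ m2 n2)).symm
  exact GrayData.comp2_congr (G := G.pathData) (vcomp2_assoc C B A hCB hBA hL hR)
    (vcompCocycle_vassoc r' q' p' r q p hr hq hp h1' h2' h1 h2 s k3 k5 k6 n1 s' l3 l4 l5 l6 n2)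
    m1 m2

section

variable (hG : G.IsGroupoid)

lemma opp3_vcomp3 (A : G.Path3) (h) : vcomp3 (opp3 hG A) A h = const3 A.left :=
  Path3.ext ((opp2_vcomp2 hG A.src rfl).trans (congrArg const2 A.s2_left.symm))
    ((opp2_vcomp2 hG A.tgt rfl).trans (congrArg const2 A.t2_left.symm)) rfl rfl

lemma vcomp3_opp3 (A : G.Path3) (h) : vcomp3 A (opp3 hG A) h = const3 A.right :=
  Path3.ext ((vcomp2_opp2 hG A.src rfl).trans (congrArg const2 A.s2_right.symm))
    ((vcomp2_opp2 hG A.tgt rfl).trans (congrArg const2 A.t2_right.symm)) rfl rfl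

end

end Path

end GrayData

/-! ### The laws of an internal groupoid -/

namespace GrayCat

open GrayData

variable {H : GrayCat.{u}}

lemma strict_comp {A B C : GrayCat.{u}} (F : A ⟶ B) (E : B ⟶ C) :
    strict F ≫ strict E = strict (F ≫ E) :=
  ((Cokleisli.Adjunction.toCokleisli Q1).map_comp F E).symm

lemma strict_i_comp_d0 : strict H.i ≫ strict H.d0 = 𝟙 H.pseudo := by
  have e : H.i ≫ H.d0 = 𝟙 H := hom_ext (funext H.toGrayData.s0_id1) rfl rfl rfl
  rw [strict_comp, e]
  exact (Cokleisli.Adjunction.toCokleisli Q1).map_id H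

lemma strict_i_comp_d1 : strict H.i ≫ strict H.d1 = 𝟙 H.pseudo := by
  have e : H.i ≫ H.d1 = 𝟙 H := hom_ext (funext H.toGrayData.t0_id1) rfl rfl rfl
  rw [strict_comp, e]
  exact (Cokleisli.Adjunction.toCokleisli Q1).map_id H

namespace IsPathComp

variable {m : H.pathPairs.pseudo ⟶ H.path.pseudo}

lemma comp_d0 (hm : H.IsPathComp m) : m ≫ strict H.d0 = strict
  (fibSnd H.d0 H.d1) ≫ strict H.d0 := by
  rw [strict_comp]
  refine pseudo_ext (fun p => ?_) (fun p => ?_) (fun p => ?_) (fun p => ?_) (fun g f h => ?_)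
  · exact (congrArg H.toGrayData.s0 (hm.map0 p)).trans (H.toGrayData.s0_comp1 _ _ _)
  · exact (val1_comp m _ p).trans ((val1_strict H.d0 _).trans
      ((congrArg Path1.left (hm.map1 p)).trans (val1_strict (fibSnd H.d0 H.d1 ≫ H.d0) p).symm))
  · exact (val2_comp m (strict H.d0) p).trans ((congrArg Path2.left (hm.map2 p)).trans
      (val2_strict (fibSnd H.d0 H.d1 ≫ H.d0) p).symm)
  · exact (val3_comp m (strict H.d0) p).trans ((congrArg Path3.left (hm.map3 p)).trans
      (val3_strict (fibSnd H.d0 H.d1 ≫ H.d0) p).symm)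
  · exact (cocycle_comp_strict m H.d0 g f h).trans ((congrArg Path2.left (hm.cocycle g f h)).trans
      (cocycle_strict (fibSnd H.d0 H.d1 ≫ H.d0) g f h).symm)

lemma comp_d1 (hm : H.IsPathComp m) : m ≫ strict H.d1 = strict
  (fibFst H.d0 H.d1) ≫ strict H.d1 := by
  rw [strict_comp]
  refine pseudo_ext (fun p => ?_) (fun p => ?_) (fun p => ?_) (fun p => ?_) (fun g f h => ?_)
  · exact (congrArg H.toGrayData.t0 (hm.map0 p)).trans (H.toGrayData.t0_comp1 _ _ _)
  · exact (val1_comp m _ p).trans ((val1_strict H.d1 _).trans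
      ((congrArg Path1.right (hm.map1 p)).trans (val1_strict (fibFst H.d0 H.d1 ≫ H.d1) p).symm))
  · exact (val2_comp m (strict H.d1) p).trans ((congrArg Path2.right (hm.map2 p)).trans
      (val2_strict (fibFst H.d0 H.d1 ≫ H.d1) p).symm)
  · exact (val3_comp m (strict H.d1) p).trans ((congrArg Path3.right (hm.map3 p)).trans
      (val3_strict (fibFst H.d0 H.d1 ≫ H.d1) p).symm)
  · exact (cocycle_comp_strict m H.d1 g f h).trans ((congrArg Path2.right (hm.cocycle g f h)).trans
      (cocycle_strict (fibFst H.d0 H.d1 ≫ H.d1) g f h).symm)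

/-- Pasting a constant path on the target side changes nothing. -/
lemma const_paste (hm : H.IsPathComp m) (b : H.path.pseudo ⟶ H.path.pseudo)
    (hb : b = strict (H.d1 ≫ H.i)) (w) : pair b (𝟙 H.path.pseudo) w ≫ m = 𝟙 H.path.pseudo := by
  subst hb
  refine pseudo_ext (fun x => ?_) (fun f => ?_) (fun α => ?_) (fun Γ => ?_) (fun g f h => ?_)
  · exact (val0_paste _ _ w hm x).trans (IsGray.id_comp1 _ _ (side0 w x))
  · exact (val1_paste _ _ w hm f).trans ((Path.vcomp1_congr (val1_strict (H.d1 ≫ H.i) f) (val1_id f)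
      _ rfl).trans ((Path.const1_vcomp1 f _ rfl).trans (val1_id f).symm))
  · exact (val2_paste _ _ w hm α).trans (Path.const2_vcomp2 α _ rfl)
  · exact (val3_paste _ _ w hm Γ).trans (Path.const3_vcomp3 Γ _ rfl)
  · have k : ((H.d1 ≫ H.i).map1 g).src = ((H.d1 ≫ H.i).map1 f).tgt := by
      rw [← val1_strict, ← val1_strict]
      exact s0_val1_eq (strict (H.d1 ≫ H.i)) g f h
    have e := Path.vcompCocycle_congr (val1_strict (H.d1 ≫ H.i) g) (val1_id g)
      (val1_strict (H.d1 ≫ H.i) f) (val1_id f) (s0_val1_eq (strict (H.d1 ≫ H.i)) g f h)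
      (s0_val1_eq (𝟙 H.path.pseudo) g f h)
      (side1 w g) (side1 w f) k h rfl rfl
    exact (cocycle_paste _ _ w hm g f h).trans ((comp2_congr (G := H.path.toGrayData)
      (Path.const2_vcomp2 (Path.id2 (Path.comp1 g f h)) _ rfl)
      (e.trans (Path.const_vcompCocycle g f h _ rfl rfl))
      (paste_src_eq (strict (H.d1 ≫ H.i)) (𝟙 H.path.pseudo) w g f h) rfl).trans
      (Path.comp2_id (Path.id2 (Path.comp1 g f h)) (Path.comp1 g f h) rfl))

/-- Pasting a constant path on the source side changes nothing. -/
lemma paste_const (hm : H.IsPathComp m) (a : H.path.pseudo ⟶ H.path.pseudo)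
    (ha : a = strict (H.d0 ≫ H.i)) (w) : pair (𝟙 H.path.pseudo) a w ≫ m = 𝟙 H.path.pseudo := by
  subst ha
  refine pseudo_ext (fun x => ?_) (fun f => ?_) (fun α => ?_) (fun Γ => ?_) (fun g f h => ?_)
  · exact (val0_paste _ _ w hm x).trans (IsGray.comp1_id _ _ (side0 w x))
  · exact (val1_paste _ _ w hm f).trans ((Path.vcomp1_congr (val1_id f) (val1_strict (H.d0 ≫ H.i) f)
      _ rfl).trans ((Path.vcomp1_const1 f _ rfl).trans (val1_id f).symm))
  · exact (val2_paste _ _ w hm α).trans (Path.vcomp2_const2 α _ rfl)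
  · exact (val3_paste _ _ w hm Γ).trans (Path.vcomp3_const3 Γ _ rfl)
  · have k : ((H.d0 ≫ H.i).map1 g).src = ((H.d0 ≫ H.i).map1 f).tgt := by
      rw [← val1_strict, ← val1_strict]
      exact s0_val1_eq (strict (H.d0 ≫ H.i)) g f h
    have e := Path.vcompCocycle_congr (val1_id g) (val1_strict (H.d0 ≫ H.i) g)
      (val1_id f) (val1_strict (H.d0 ≫ H.i) f) (s0_val1_eq (𝟙 H.path.pseudo) g f h)
      (s0_val1_eq (strict (H.d0 ≫ H.i)) g f h)
      (side1 w g) (side1 w f) h k rfl rfl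
    exact (cocycle_paste _ _ w hm g f h).trans ((comp2_congr (G := H.path.toGrayData)
      (Path.vcomp2_const2 (Path.id2 (Path.comp1 g f h)) _ rfl)
      (e.trans (Path.vcompCocycle_const g f h _ rfl rfl))
      (paste_src_eq (𝟙 H.path.pseudo) (strict (H.d0 ≫ H.i)) w g f h) rfl).trans
      (Path.comp2_id (Path.id2 (Path.comp1 g f h)) (Path.comp1 g f h) rfl))

/-- Associativity of `m`, tested on triples of composable `Q¹`-maps. -/
lemma paste_assoc (hm : H.IsPathComp m) {T : GrayCat.{u}} (c b a : T.pseudo ⟶ H.path.pseudo)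
    (hcb : c ≫ strict H.d0 = b ≫ strict H.d1) (hba : b ≫ strict H.d0 = a ≫ strict H.d1) (w w') :
    pair (pair c b hcb ≫ m) a w ≫ m = pair c (pair b a hba ≫ m) w' ≫ m := by
  have v1 (f) := val1_paste c b hcb hm f
  have v1' (f) := val1_paste b a hba hm f
  have v2 (f) := val2_paste c b hcb hm f
  have v2' (f) := val2_paste b a hba hm f
  have v3 (f) := val3_paste c b hcb hm f
  have v3' (f) := val3_paste b a hba hm f
  have v0 (f) := val0_paste c b hcb hm f
  have v0' (f) := val0_paste b a hba hm f
  refine pseudo_ext (fun x => ?_) (fun f => ?_) (fun f => ?_) (fun f => ?_) (fun g f h => ?_)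
  · refine (val0_paste _ _ w hm x).trans
      (Eq.trans ?_ (val0_paste _ _ w' hm x).symm)
    refine (comp1_congr (v0 x) rfl _ ((congrArg H.toGrayData.s0 (v0 x)).symm.trans
      (side0 w x))).trans (Eq.trans ?_ (comp1_congr rfl (v0' x) _ ((side0 w' x).trans
      (congrArg H.toGrayData.t0 (v0' x)))).symm)
    exact IsGray.comp1_assoc _ _ _ _ _
  · refine (val1_paste _ _ w hm f).trans
      (Eq.trans ?_ (val1_paste _ _ w' hm f).symm)
    refine (Path.vcomp1_congr (v1 f) rfl _ (side1 hba f)).trans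
      (Eq.trans ?_ (Path.vcomp1_congr rfl (v1' f) _ (side1 hcb f)).symm)
    exact Path.vcomp1_assoc _ _ _ (side1 hcb f) (side1 hba f) _ _
  · refine (val2_paste _ _ w hm f).trans
      (Eq.trans ?_ (val2_paste _ _ w' hm f).symm)
    refine (Path.vcomp2_congr (v2 f) rfl _ (side2 hba f)).trans
      (Eq.trans ?_ (Path.vcomp2_congr rfl (v2' f) _ (side2 hcb f)).symm)
    exact Path.vcomp2_assoc _ _ _ (side2 hcb f) (side2 hba f) _ _
  · refine (val3_paste _ _ w hm f).trans
      (Eq.trans ?_ (val3_paste _ _ w' hm f).symm)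
    refine (Path.vcomp3_congr (v3 f) rfl _ (side3 hba f)).trans
      (Eq.trans ?_ (Path.vcomp3_congr rfl (v3' f) _ (side3 hcb f)).symm)
    exact Path.vcomp3_assoc _ _ _ (side3 hcb f) (side3 hba f) _ _
  · have κ := cocycle_paste c b hcb hm g f h
    have κ' := cocycle_paste b a hba hm g f h
    have u := sideκ w g f h
    have u' := sideκ w' g f h
    rw [κ] at u
    rw [κ'] at u'
    have p := s0_val1_eq (pair c b hcb ≫ m) g f h
    have p' := s0_val1_eq (pair b a hba ≫ m) g f h
    rw [v1, v1] at p
    rw [v1', v1'] at p'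
    refine (cocycle_paste _ _ w hm g f h).trans
      (Eq.trans ?_ (cocycle_paste _ _ w' hm g f h).symm)
    have e1 := Path.vcomp2_congr κ (Eq.refl (GrayCat.cocycle a g f h)) (sideκ w g f h) u
    have e2 := Path.vcomp2_congr (Eq.refl (GrayCat.cocycle c g f h)) κ' (sideκ w' g f h) u'
    have e3 := Path.vcompCocycle_congr (v1 g) (Eq.refl (val1 a g)) (v1 f) (Eq.refl (val1 a f))
      (s0_val1_eq (pair c b hcb ≫ m) g f h) (s0_val1_eq a g f h) (side1 w g) (side1 w f)
      p (s0_val1_eq a g f h) (side1 hba g) (side1 hba f)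
    have e4 := Path.vcompCocycle_congr (Eq.refl (val1 c g)) (v1' g) (Eq.refl (val1 c f)) (v1' f)
      (s0_val1_eq c g f h) (s0_val1_eq (pair b a hba ≫ m) g f h) (side1 w' g) (side1 w' f)
      (s0_val1_eq c g f h) p' (side1 hcb g) (side1 hcb f)
    have q := paste_src_eq (pair c b hcb ≫ m) a w g f h
    have q' := paste_src_eq c (pair b a hba ≫ m) w' g f h
    have r := q
    have r' := q'
    rw [e1, e3] at r
    rw [e2, e4] at r'
    refine (comp2_congr (G := H.path.toGrayData) e1 e3 q r).trans
      (Eq.trans ?_ (comp2_congr (G := H.path.toGrayData) e2 e4 q' r').symm)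
    exact Path.vcomp2_vcompCocycle_assoc _ _ _ _ _ _ _ _ _ (s0_val1_eq c g f h)
      (s0_val1_eq b g f h) (s0_val1_eq a g f h) (side1 hcb g) (side1 hba g) (side1 hcb f)
      (side1 hba f) (s1_cocycle c g f h) (s1_cocycle a g f h)
      (sideκ hcb g f h) (sideκ hba g f h) _ _ _ _ _ _ r _ _ _ _ _ _ r'

end IsPathComp

namespace IsPathOpp

variable {m : H.pathPairs.pseudo ⟶ H.path.pseudo} {o : H.path.pseudo ⟶ H.path.pseudo}
  {hH : H.toGrayData.IsGroupoid}

lemma opp_d0 (ho : H.IsPathOpp hH o) : o ≫ strict H.d0 = strict H.d1 :=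
  pseudo_ext (fun x => (congrArg H.toGrayData.s0 (ho.map0 x)).trans (s0_inv1 hH x))
    (fun f => (val1_comp o _ f).trans ((val1_strict H.d0 _).trans
      ((congrArg Path1.left (ho.map1 f)).trans (val1_strict H.d1 f).symm)))
    (fun α => (val2_comp o _ α).trans ((val2_strict H.d0 _).trans
      ((congrArg Path2.left (ho.map2 α)).trans (val2_strict H.d1 α).symm)))
    (fun Γ => (val3_comp o _ Γ).trans ((val3_strict H.d0 _).trans
      ((congrArg Path3.left (ho.map3 Γ)).trans (val3_strict H.d1 Γ).symm)))
    (fun g f h => (cocycle_comp_strict o H.d0 g f h).trans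
      ((congrArg Path2.left (ho.cocycle g f h)).trans (cocycle_strict H.d1 g f h).symm))

lemma opp_d1 (ho : H.IsPathOpp hH o) : o ≫ strict H.d1 = strict H.d0 :=
  pseudo_ext (fun x => (congrArg H.toGrayData.t0 (ho.map0 x)).trans (t0_inv1 hH x))
    (fun f => (val1_comp o _ f).trans ((val1_strict H.d1 _).trans
      ((congrArg Path1.right (ho.map1 f)).trans (val1_strict H.d0 f).symm)))
    (fun α => (val2_comp o _ α).trans ((val2_strict H.d1 _).trans
      ((congrArg Path2.right (ho.map2 α)).trans (val2_strict H.d0 α).symm)))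
    (fun Γ => (val3_comp o _ Γ).trans ((val3_strict H.d1 _).trans
      ((congrArg Path3.right (ho.map3 Γ)).trans (val3_strict H.d0 Γ).symm)))
    (fun g f h => (cocycle_comp_strict o H.d1 g f h).trans
      ((congrArg Path2.right (ho.cocycle g f h)).trans (cocycle_strict H.d0 g f h).symm))

lemma opp_paste (ho : H.IsPathOpp hH o) (hm : H.IsPathComp m) (w) :
    pair o (𝟙 H.path.pseudo) w ≫ m = strict (H.d0 ≫ H.i) := by
  refine pseudo_ext (fun x => ?_) (fun f => ?_) (fun α => ?_) (fun Γ => ?_) (fun g f h => ?_)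
  · exact (val0_paste _ _ w hm x).trans ((comp1_congr (ho.map0 x) rfl _ (s0_inv1 hH x)).trans
      (inv1_comp hH x _))
  · exact (val1_paste _ _ w hm f).trans ((Path.vcomp1_congr (ho.map1 f) (val1_id f) _ rfl).trans
      ((Path.opp1_vcomp1 hH f rfl).trans (val1_strict (H.d0 ≫ H.i) f).symm))
  · exact (val2_paste _ _ w hm α).trans ((Path.vcomp2_congr (ho.map2 α) rfl _ rfl).trans
      (Path.opp2_vcomp2 hH α rfl))
  · exact (val3_paste _ _ w hm Γ).trans ((Path.vcomp3_congr (ho.map3 Γ) rfl _ rfl).trans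
      (Path.opp3_vcomp3 hH Γ rfl))
  · have k : (Path.opp1 hH g).src = (Path.opp1 hH f).tgt := congrArg (inv1 hH) h
    have e := Path.vcompCocycle_congr (ho.map1 g) (val1_id g)
      (ho.map1 f) (val1_id f) (s0_val1_eq o g f h) (s0_val1_eq (𝟙 H.path.pseudo) g f h)
      (side1 w g) (side1 w f) k h rfl rfl
    have e' := Path.vcomp2_congr (ho.cocycle g f h) rfl (sideκ w g f h) rfl
    have q := paste_src_eq o (𝟙 H.path.pseudo) w g f h
    have r := (congrArg Path2.src e').symm.trans (q.trans (congrArg Path2.tgt e))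
    exact (cocycle_paste _ _ w hm g f h).trans
      ((comp2_congr (G := H.path.toGrayData) e' e q r).trans
      ((Path.oppCocycle_vcomp2 hH g f h rfl k rfl rfl r).trans
        (cocycle_strict (H.d0 ≫ H.i) g f h).symm))

lemma paste_opp (ho : H.IsPathOpp hH o) (hm : H.IsPathComp m) (w) :
    pair (𝟙 H.path.pseudo) o w ≫ m = strict (H.d1 ≫ H.i) := by
  refine pseudo_ext (fun x => ?_) (fun f => ?_) (fun α => ?_) (fun Γ => ?_) (fun g f h => ?_)
  · exact (val0_paste _ _ w hm x).trans ((comp1_congr rfl (ho.map0 x) _ (t0_inv1 hH x).symm).trans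
      (comp_inv1 hH x _))
  · exact (val1_paste _ _ w hm f).trans ((Path.vcomp1_congr (val1_id f) (ho.map1 f) _ rfl).trans
      ((Path.vcomp1_opp1 hH f rfl).trans (val1_strict (H.d1 ≫ H.i) f).symm))
  · exact (val2_paste _ _ w hm α).trans ((Path.vcomp2_congr rfl (ho.map2 α) _ rfl).trans
      (Path.vcomp2_opp2 hH α rfl))
  · exact (val3_paste _ _ w hm Γ).trans ((Path.vcomp3_congr rfl (ho.map3 Γ) _ rfl).trans
      (Path.vcomp3_opp3 hH Γ rfl))
  · have k : (Path.opp1 hH g).src = (Path.opp1 hH f).tgt := congrArg (inv1 hH) h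
    have e := Path.vcompCocycle_congr (val1_id g) (ho.map1 g)
      (val1_id f) (ho.map1 f) (s0_val1_eq (𝟙 H.path.pseudo) g f h) (s0_val1_eq o g f h)
      (side1 w g) (side1 w f) h k rfl rfl
    have e' := Path.vcomp2_congr rfl (ho.cocycle g f h) (sideκ w g f h) rfl
    have q := paste_src_eq (𝟙 H.path.pseudo) o w g f h
    have r := (congrArg Path2.src e').symm.trans (q.trans (congrArg Path2.tgt e))
    exact (cocycle_paste _ _ w hm g f h).trans
      ((comp2_congr (G := H.path.toGrayData) e' e q r).trans
      ((Path.vcomp2_oppCocycle hH g f h rfl k rfl rfl r).trans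
        (cocycle_strict (H.d1 ≫ H.i) g f h).symm))

end IsPathOpp

end GrayCat

theorem mainTheorem6 (H : GrayCat.{u}) (hH : H.toGrayData.IsGroupoid) :
    ∃ (m : H.pathPairs.pseudo ⟶ H.path.pseudo) (o : H.path.pseudo ⟶ H.path.pseudo),
      H.IsPathComp m ∧ H.IsPathOpp hH o ∧
      IsInternalGroupoid (GrayCat.strict H.d0) (GrayCat.strict H.d1) (GrayCat.strict H.i)
        (GrayCat.strict (GrayCat.fibFst H.d0 H.d1)) (GrayCat.strict (GrayCat.fibSnd H.d0 H.d1))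
        m o := by
  let M := GrayCat.vcompMap H
  let O := GrayCat.oppMap hH
  have hm : H.IsPathComp (M.toHom hH) :=
    ⟨M.toHom_map0 hH, M.toHom_map1 hH, M.toHom_map2 hH, M.toHom_map3 hH, M.toHom_kappa hH⟩
  have ho : H.IsPathOpp hH (O.toHom hH) :=
    ⟨O.toHom_map0 hH, O.toHom_map1 hH, O.toHom_map2 hH, O.toHom_map3 hH, O.toHom_kappa hH⟩
  exact ⟨M.toHom hH, O.toHom hH, hm, ho,
    { isPullback := GrayCat.strict_fib_isPullback H.d0 H.d1
      ident_src := GrayCat.strict_i_comp_d0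
      ident_tgt := GrayCat.strict_i_comp_d1
      comp_src := hm.comp_d0
      comp_tgt := hm.comp_d1
      ident_comp := hm.const_paste _ (GrayCat.strict_comp _ _) _
      comp_ident := hm.paste_const _ (GrayCat.strict_comp _ _) _
      assoc := fun c b a hcb hba => hm.paste_assoc c b a hcb hba _ _
      inv_src := ho.opp_d0
      inv_tgt := ho.opp_d1
      inv_comp := (ho.opp_paste hm _).trans (GrayCat.strict_comp _ _).symm
      comp_inv := (ho.paste_opp hm _).trans (GrayCat.strict_comp _ _).symm }⟩
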